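/- Let $V=V_4(3)$ be the space of row vectors of length $4$ over $GF(3)$ and let $T$ be the group of all translations of $V$. A $2$-$(v,k,\lambda)$ design consists of a set of $v$ points and a set of $k$-subsets (blocks), $2<k<v$, such that any two distinct points lie on exactly $\lambda$ blocks; a group of automorphisms is flag-transitive if it is transitive on the incident point-block pairs. Let \[ \alpha=\begin{pmatrix}0&0&0&-1\\-1&0&1&1\\-1&-1&0&-1\\1&0&0&0\end{pmatrix},\qquad \beta=\begin{pmatrix}1&1&0&0\\0&1&0&0\\0&0&1&1\\0&0&0&1\end{pmatrix} \] act on $V$ by right multiplication, let $H_0=\langle\alpha,\beta\rangle\cong SL_2(5)$ and $B=\langle(1,0,0,0),(0,0,0,1)\rangle_{GF(3)}$, and let $\mathcal{D}_0=(V,B^{TH_0})$, the design whose blocks are all the sets $Bh+w$ with $h\in H_0$ and $w\in V$. Let $R\le GL_4(3)$ be a subgroup isomorphic to the central product $D_8\circ Q_8$ (the centres of order $2$ being identified), and let $G_0\le N_{GL_4(3)}(R)$, where $N_{GL_4(3)}(R)$ is the group $(D_8\circ Q_8).S_5$, also written $(R\circ SL_2(5)):Z_2$. Let $\mathcal{D}$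 be a $2$-$(3^4,3^2,3)$ design with point set $V$ that admits $G=TG_0$ as a flag-transitive automorphism group. Then $\mathcal{D}$ is isomorphic to $\mathcal{D}_0$. -/

import Mathlib

/-- `𝓑` is the block set of a `2`-`(v, k, l)` design with point set `P`: there are `v` points, the
blocks are `k`-subsets of `P`, any two distinct points lie on exactly `l` common blocks, and the
design is non-trivial, i.e. `2 < k < v`. -/
structure IsTwoDesign {P : Type*} (𝓑 : Set (Set P)) (v k l : ℕ) : Prop where
  finite_points : Finite P
  card_points : Nat.card P = v
  card_block : ∀ B ∈ 𝓑, B.ncard = k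
  card_pair : ∀ x y : P, x ≠ y → {B ∈ 𝓑 | x ∈ B ∧ y ∈ B}.ncard = l
  two_lt : 2 < k
  lt_points : k < v

/-- The full automorphism group of the incidence structure with block set `𝓑`: the permutations of
the points that map the block set onto itself. -/
def designAut {P : Type*} (𝓑 : Set (Set P)) : Subgroup (Equiv.Perm P) where
  carrier := {σ | ∀ B : Set P, σ '' B ∈ 𝓑 ↔ B ∈ 𝓑}
  one_mem' := by intro B; simp
  mul_mem' := by
    intro σ τ hσ hτ B
    have h : (σ * τ : Equiv.Perm P) '' B = σ '' (τ '' B) := by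
      rw [Equiv.Perm.coe_mul, Set.image_comp]
    rw [h, hσ, hτ]
  inv_mem' := by
    intro σ hσ B
    have h : σ '' ((σ⁻¹ : Equiv.Perm P) '' B) = B := by
      rw [← Set.image_comp, ← Equiv.Perm.coe_mul]; simp
    rw [← hσ, h]

/-- `G` is a flag-transitive automorphism group of the design with block set `𝓑`. -/
def IsFlagTransitive {P : Type*} (G : Subgroup (Equiv.Perm P)) (𝓑 : Set (Set P)) : Prop :=
  G ≤ designAut 𝓑 ∧
    ∀ (x y : P), ∀ B ∈ 𝓑, ∀ C ∈ 𝓑, x ∈ B → y ∈ C → ∃ g ∈ G, g x = y ∧ g '' B = C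

/-- Two designs are isomorphic if some bijection between the point sets maps one block set onto the
other. -/
def DesignIso {P Q : Type*} (𝓑 : Set (Set P)) (𝓒 : Set (Set Q)) : Prop :=
  ∃ e : P ≃ Q, (fun B : Set P => e '' B) '' 𝓑 = 𝓒

/-- `R` is the (internal) central product `A ∘ B` with the centres of `A` and `B` identified. -/
def IsCentralProduct {G : Type*} [Group G] (A B R : Subgroup G) : Prop :=
  (∀ a ∈ A, ∀ b ∈ B, a * b = b * a) ∧ A ⊔ B = R ∧
    A ⊓ B = (Subgroup.center A).map A.subtype ∧ A ⊓ B = (Subgroup.center B).map B.subtype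

/-- `R ≅ D₈ ∘ Q₈`, where `D₈` is the dihedral group of order `8`, `Q₈` is the quaternion group of
order `8`, and the two centres of order `2` are identified. -/
def IsD8CentralQ8 {G : Type*} [Group G] (R : Subgroup G) : Prop :=
  ∃ A B : Subgroup G, Nonempty (A ≃* DihedralGroup 4) ∧ Nonempty (B ≃* QuaternionGroup 2) ∧
    IsCentralProduct A B R

/-- The vector space `V = V₄(3)`, the row space of dimension `4` over the field with `3` elements. -/
abbrev V43 : Type := Fin 4 → ZMod 3

/-- `GL(V) = GL₄(3)`. -/
abbrev GL43 : Type := V43 ≃ₗ[ZMod 3] V43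

/-- The group `T` of all translations `x ↦ x + w` of `V`. -/
def translationGroup : Subgroup (Equiv.Perm V43) where
  carrier := {σ | ∃ w : V43, ∀ x, σ x = x + w}
  one_mem' := ⟨0, by simp⟩
  mul_mem' := by
    rintro σ τ ⟨w, hw⟩ ⟨u, hu⟩
    exact ⟨u + w, fun x => by rw [Equiv.Perm.mul_apply, hw, hu, add_assoc]⟩
  inv_mem' := by
    rintro σ ⟨w, hw⟩
    exact ⟨-w, fun x => by rw [Equiv.Perm.inv_eq_iff_eq, hw]; simp⟩

/-- `GL(V)` acting on `V`, as a homomorphism to the permutations of `V`. -/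
def linToPerm : GL43 →* Equiv.Perm V43 where
  toFun g := g.toEquiv
  map_one' := rfl
  map_mul' _ _ := rfl

/-- The affine group `T G₀` (a subgroup of `AGL(V)`) for a subgroup `G₀` of `GL(V)`. -/
def affineGroup (G₀ : Subgroup GL43) : Subgroup (Equiv.Perm V43) :=
  translationGroup ⊔ G₀.map linToPerm

/-- The linear map `x ↦ x α` (row vector times matrix). In `toLinearEquivRight'OfInv` the forward
map is multiplication by `M'`, and `M` is its inverse matrix. -/
def exAlpha : GL43 :=
  Matrix.toLinearEquivRight'OfInv
    (M' := !![0, 0, 0, -1; -1, 0, 1, 1; -1, -1, 0, -1; 1, 0, 0, 0])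
    (M := -!![0, 0, 0, -1; -1, 0, 1, 1; -1, -1, 0, -1; 1, 0, 0, 0])
    (by decide) (by decide)

/-- The linear map `x ↦ x β` (row vector times matrix). -/
def exBeta : GL43 :=
  Matrix.toLinearEquivRight'OfInv
    (M' := !![1, 1, 0, 0; 0, 1, 0, 0; 0, 0, 1, 1; 0, 0, 0, 1])
    (M := !![1, -1, 0, 0; 0, 1, 0, 0; 0, 0, 1, -1; 0, 0, 0, 1])
    (by decide) (by decide)

/-- The two maps really are right multiplication of row vectors by the matrices `α` and `β`. -/
theorem exAlpha_exBeta_apply (x : V43) :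
    exAlpha x = Matrix.vecMul x !![0, 0, 0, -1; -1, 0, 1, 1; -1, -1, 0, -1; 1, 0, 0, 0] ∧
      exBeta x = Matrix.vecMul x !![1, 1, 0, 0; 0, 1, 0, 0; 0, 0, 1, 1; 0, 0, 0, 1] :=
  ⟨rfl, rfl⟩

/-- The group `H₀ = ⟨α, β⟩ ≅ SL₂(5)`. -/
def exGroup : Subgroup GL43 := Subgroup.closure {exAlpha, exBeta}

/-- The base block `⟨(1,0,0,0), (0,0,0,1)⟩`. -/
def exBase : Set V43 := (Submodule.span (ZMod 3) {![1, 0, 0, 0], ![0, 0, 0, 1]} : Submodule _ V43)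

/-- The block set `B^(T H₀)` of the example. -/
def exBlocks : Set (Set V43) := {C | ∃ g ∈ affineGroup exGroup, C = g '' exBase}

/-! Counting gives `λ(v-1)/(k-1) = 30` blocks through `0`, and `G₀` is transitive on them, so 30
divides `|G₀|` and `G₀` contains elements `c` of order 5 and `d` of order 3. Let `transStab B` be
the subspace of translations fixing a block `B` through `0`; its dimension is at most 2 and does not
depend on `B`.

Dimension 0 is impossible: translation would split the 30 blocks through `0` into classes of size 9
(`finrank_transStab_ne_zero`). In dimension 1 the nonzero vectors of all these subspaces form a
`G₀`-invariant set of at most 20 vectors (`exists_small_invariant`), while `c`, `d` and `-1` already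
force at least 30 (`thirty_le_ncard`). So the dimension is 2, the blocks through `0` are 30 lines of
`PG(3,3)` covering every point three times (`exists_lines`), and the blocks are their translates.

The structure of `R` makes this finite problem explicit. `R` is generated by four involutions that
anticommute pairwise. They span a Clifford algebra with a unique irreducible module over `GF(3)`, of
dimension 4, so a change of basis brings them to standard form (`exists_intertwiner`,
`exists_stdInv_frame`). The non-central involutions of `R` are then ten explicit matrices `± S₁, …,
± S₅`, which `G₀` permutes by conjugation. An element of the normalizer is determined up to sign by
this signed permutation, so `c` can be moved to one fixed matrix `c₀` (`exists_conj_eq_c0Cols`) and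
`d` runs through an explicit finite list (`orderThreeAll_gcols`).

The 130 lines fall into 26 orbits of length 5 under `c₀`. Two of them consist of the fixed spaces of
the ten involutions, a spread that `G₀` leaves invariant; being too small to contain an orbit of 30
lines, it is disjoint from the line set (`fixedSpan_notMem`). A search lists all unions of the other
24 orbits that cover points three times (`exists_coverSol`), and invariance under `d` leaves two of
them (`mem_goodSols`). Explicit matrices carry both to the `H₀`-orbit of the base block
(`exists_map_eq_of_mem_goodSols`). -/

namespace Ternary

/-! ### Vectors and linear maps of `V` as base 3 codes, suited to kernel computation. -/

/-- The code `x₀ + 3 x₁ + 9 x₂ + 27 x₃` of a vector. -/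
def enc (x : V43) : ℕ := (x 0).val + 3 * (x 1).val + 9 * (x 2).val + 27 * (x 3).val

/-- The vector with a given code. -/
def dec (n : ℕ) : V43 := ![(n : ZMod 3), (n / 3 : ℕ), (n / 9 : ℕ), (n / 27 : ℕ)]

theorem enc_lt (x : V43) : enc x < 81 := by
  have h0 := ZMod.val_lt (x 0)
  have h1 := ZMod.val_lt (x 1)
  have h2 := ZMod.val_lt (x 2)
  have h3 := ZMod.val_lt (x 3)
  unfold enc
  omega

theorem enc_dec {n : ℕ} (h : n < 81) : enc (dec n) = n := by
  simp only [enc, dec, Matrix.cons_val, ZMod.val_natCast]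
  omega

theorem vec_ext {x y : V43} (h0 : x 0 = y 0) (h1 : x 1 = y 1) (h2 : x 2 = y 2) (h3 : x 3 = y 3) :
    x = y := by
  funext i
  fin_cases i <;> assumption

theorem digits_eq {a b c d : ℕ} (ha : a < 3) (hb : b < 3) (hc : c < 3) (hd : d < 3) :
    (a + 3 * b + 9 * c + 27 * d) % 3 = a ∧ (a + 3 * b + 9 * c + 27 * d) / 3 % 3 = b ∧
      (a + 3 * b + 9 * c + 27 * d) / 9 % 3 = c ∧ (a + 3 * b + 9 * c + 27 * d) / 27 % 3 = d := by
  omega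

theorem dec_eq_of_digits {x : V43} {n : ℕ} (h0 : n % 3 = (x 0).val) (h1 : n / 3 % 3 = (x 1).val)
    (h2 : n / 9 % 3 = (x 2).val) (h3 : n / 27 % 3 = (x 3).val) : dec n = x := by
  have key : ∀ (a : ZMod 3) (n : ℕ), n % 3 = a.val → (n : ZMod 3) = a := by
    intro a n h
    apply ZMod.val_injective
    rw [ZMod.val_natCast, h]
  exact vec_ext (key _ _ h0) (key _ _ h1) (key _ _ h2) (key _ _ h3)

theorem dec_enc (x : V43) : dec (enc x) = x := by
  have h := digits_eq (ZMod.val_lt (x 0)) (ZMod.val_lt (x 1)) (ZMod.val_lt (x 2)) (ZMod.val_lt (x 3))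
  exact dec_eq_of_digits h.1 h.2.1 h.2.2.1 h.2.2.2

theorem enc_injective : Function.Injective enc :=
  Function.LeftInverse.injective dec_enc

@[simp] theorem enc_zero : enc 0 = 0 := by decide

theorem enc_eq_zero {x : V43} : enc x = 0 ↔ x = 0 :=
  ⟨fun h => enc_injective (h.trans enc_zero.symm), fun h => by rw [h, enc_zero]⟩

/-- The code of a sum. -/
def addCode (a b : ℕ) : ℕ :=
  (a + b) % 3 + 3 * ((a / 3 + b / 3) % 3) + 9 * ((a / 9 + b / 9) % 3) +
    27 * ((a / 27 + b / 27) % 3)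

theorem mod_three_lt (n : ℕ) : n % 3 < 3 := Nat.mod_lt n (by norm_num)

theorem addCode_lt (a b : ℕ) : addCode a b < 81 := by
  have h0 := mod_three_lt (a + b)
  have h1 := mod_three_lt (a / 3 + b / 3)
  have h2 := mod_three_lt (a / 9 + b / 9)
  have h3 := mod_three_lt (a / 27 + b / 27)
  unfold addCode
  omega

theorem dec_addCode (a b : ℕ) : dec (addCode a b) = dec a + dec b := by
  have key : ∀ m n : ℕ, (m + n) % 3 = ((m : ZMod 3) + n).val := by
    intro m n
    rw [← Nat.cast_add, ZMod.val_natCast]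
  have h := digits_eq (mod_three_lt (a + b)) (mod_three_lt (a / 3 + b / 3))
    (mod_three_lt (a / 9 + b / 9)) (mod_three_lt (a / 27 + b / 27))
  exact dec_eq_of_digits (h.1.trans (key _ _)) (h.2.1.trans (key _ _)) (h.2.2.1.trans (key _ _))
    (h.2.2.2.trans (key _ _))

theorem enc_add (x y : V43) : enc (x + y) = addCode (enc x) (enc y) := by
  rw [← enc_dec (addCode_lt _ _), dec_addCode, dec_enc, dec_enc]

theorem enc_neg (x : V43) : enc (-x) = addCode (enc x) (enc x) := by
  rw [← enc_add]
  congr 1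
  funext i
  simp only [Pi.neg_apply, Pi.add_apply]
  generalize x i = a
  revert a
  decide

/-- The codes of the images of the four standard basis vectors. -/
abbrev Cols := ℕ × ℕ × ℕ × ℕ

/-- The digit of weight `k` in the image of the code `x` under the map with columns `m`. -/
def digitCols (m : Cols) (x k : ℕ) : ℕ :=
  (x % 3 * (m.1 / k) + x / 3 % 3 * (m.2.1 / k) + x / 9 % 3 * (m.2.2.1 / k) +
    x / 27 % 3 * (m.2.2.2 / k)) % 3

/-- The code of the image of the vector with code `x` under the linear map with columns `m`. -/
def applyCols (m : Cols) (x : ℕ) : ℕ :=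
  digitCols m x 1 + 3 * digitCols m x 3 + 9 * digitCols m x 9 + 27 * digitCols m x 27

theorem digitCols_lt (m : Cols) (x k : ℕ) : digitCols m x k < 3 := mod_three_lt _

theorem applyCols_lt (m : Cols) (x : ℕ) : applyCols m x < 81 := by
  have h0 := digitCols_lt m x 1
  have h1 := digitCols_lt m x 3
  have h2 := digitCols_lt m x 9
  have h3 := digitCols_lt m x 27
  unfold applyCols
  omega

theorem dec_applyCols (m : Cols) (x : ℕ) :
    dec (applyCols m x) = dec x 0 • dec m.1 + dec x 1 • dec m.2.1 + dec x 2 • dec m.2.2.1 +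
      dec x 3 • dec m.2.2.2 := by
  -- The quotients `m.1 / k` need no reduction modulo 3, because only their residues enter the final
  -- digit.
  have key : ∀ k, digitCols m x k = ((x : ZMod 3) * (m.1 / k : ℕ) +
      (x / 3 : ℕ) * (m.2.1 / k : ℕ) + (x / 9 : ℕ) * (m.2.2.1 / k : ℕ) +
      (x / 27 : ℕ) * (m.2.2.2 / k : ℕ)).val := by
    intro k
    rw [← ZMod.natCast_mod x 3, ← ZMod.natCast_mod (x / 3) 3, ← ZMod.natCast_mod (x / 9) 3,
      ← ZMod.natCast_mod (x / 27) 3]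
    simp only [← Nat.cast_add, ← Nat.cast_mul, ZMod.val_natCast, digitCols]
  have h := digits_eq (digitCols_lt m x 1) (digitCols_lt m x 3) (digitCols_lt m x 9)
    (digitCols_lt m x 27)
  refine dec_eq_of_digits (h.1.trans ?_) (h.2.1.trans ?_) (h.2.2.1.trans ?_) (h.2.2.2.trans ?_)
  · simpa [dec] using key 1
  · simpa [dec] using key 3
  · simpa [dec] using key 9
  · simpa [dec] using key 27

/-- The columns of a linear map of `V`. -/
def cols (g : V43 →ₗ[ZMod 3] V43) : Cols :=
  (enc (g (dec 1)), enc (g (dec 3)), enc (g (dec 9)), enc (g (dec 27)))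

theorem eq_sum_basis (x : V43) :
    x = x 0 • dec 1 + x 1 • dec 3 + x 2 • dec 9 + x 3 • dec 27 := by
  have h : dec 1 = ![1, 0, 0, 0] ∧ dec 3 = ![0, 1, 0, 0] ∧ dec 9 = ![0, 0, 1, 0] ∧
      dec 27 = ![0, 0, 0, 1] := by decide
  rw [h.1, h.2.1, h.2.2.1, h.2.2.2]
  funext i
  fin_cases i <;> simp

theorem enc_map (g : V43 →ₗ[ZMod 3] V43) (x : V43) :
    enc (g x) = applyCols (cols g) (enc x) := by
  rw [← enc_dec (applyCols_lt _ _), dec_applyCols]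
  congr 1
  simp only [cols, dec_enc]
  conv_lhs => rw [eq_sum_basis x]
  simp only [map_add, map_smul]

theorem cols_injective : Function.Injective cols := by
  intro g h e
  refine LinearMap.ext fun x => enc_injective ?_
  rw [enc_map, enc_map, e]

/-- The linear map with given columns. -/
def ofCols (m : Cols) : V43 →ₗ[ZMod 3] V43 where
  toFun x := x 0 • dec m.1 + x 1 • dec m.2.1 + x 2 • dec m.2.2.1 + x 3 • dec m.2.2.2
  map_add' x y := by
    simp only [Pi.add_apply, add_smul]
    abel
  map_smul' c x := by
    simp only [Pi.smul_apply, smul_eq_mul, mul_smul, RingHom.id_apply, smul_add]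

theorem enc_ofCols (m : Cols) (x : V43) : enc (ofCols m x) = applyCols m (enc x) := by
  rw [← enc_dec (applyCols_lt _ _), dec_applyCols, dec_enc]
  rfl

/-- The columns of a composition. -/
def mulCols (m n : Cols) : Cols :=
  (applyCols m n.1, applyCols m n.2.1, applyCols m n.2.2.1, applyCols m n.2.2.2)

theorem cols_comp (g h : V43 →ₗ[ZMod 3] V43) : cols (g ∘ₗ h) = mulCols (cols g) (cols h) :=
  Prod.ext (enc_map g _) (Prod.ext (enc_map g _) (Prod.ext (enc_map g _) (enc_map g _)))

/-- The columns of an element of `GL(V)`. -/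
def gcols (g : GL43) : Cols := cols (g : V43 →ₗ[ZMod 3] V43)

theorem enc_gmap (g : GL43) (x : V43) : enc (g x) = applyCols (gcols g) (enc x) :=
  enc_map (g : V43 →ₗ[ZMod 3] V43) x

theorem gcols_injective : Function.Injective gcols := fun _ _ h =>
  LinearEquiv.toLinearMap_injective (cols_injective h)

theorem gcols_mul (g h : GL43) : gcols (g * h) = mulCols (gcols g) (gcols h) :=
  cols_comp _ _

theorem gcols_one : gcols 1 = (1, 3, 9, 27) := by
  change cols LinearMap.id = _
  simp only [cols, LinearMap.id_apply]
  decide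

/-- The columns of the negative. -/
def negCols (m : Cols) : Cols :=
  (addCode m.1 m.1, addCode m.2.1 m.2.1, addCode m.2.2.1 m.2.2.1, addCode m.2.2.2 m.2.2.2)

theorem cols_neg (g : V43 →ₗ[ZMod 3] V43) : cols (-g) = negCols (cols g) := by
  simp only [cols, negCols, LinearMap.neg_apply, enc_neg]

theorem gcols_neg_one : gcols (LinearEquiv.neg (ZMod 3)) = (2, 6, 18, 54) := by
  have : ((LinearEquiv.neg (ZMod 3) : GL43) : V43 →ₗ[ZMod 3] V43) = -LinearMap.id := by
    ext1 x
    rfl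
  rw [gcols, this, cols_neg]
  change negCols (gcols 1) = _
  rw [gcols_one]
  decide

/-! ### Orbits of the element `c₀` of order 5 on points and lines. -/

/-- Membership in a set of codes given as a bit mask. -/
def inMask (m n : ℕ) : Bool := Nat.beq (Nat.land (Nat.shiftRight m n) 1) 1

/-- The columns of the element `c₀` of order `5`. -/
def c0Cols : Cols := (50, 10, 76, 33)

/-- Generators of representatives of the `c₀`-orbits on the lines of `V`. -/
def linePairs : List (ℕ × ℕ) :=
  [(1, 3), (1, 9), (1, 12), (1, 15), (1, 27), (1, 30), (1, 33), (1, 39), (1, 42), (1, 45), (1,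
   51), (3, 9), (3, 10), (3, 11), (3, 27), (3, 38), (3, 46), (4, 9), (4, 11), (4, 36), (4, 45),
   (4, 47), (5, 29), (5, 38), (9, 27), (9, 29)]

/-- The bit masks of the lines, one row for each `c₀`-orbit. -/
def lineRows : List (List ℕ) :=
  [[511,
    1210107565283851686118401,
    153476983322603824381953,
    18965561002724184686593,
    302268636693133732675585],
   [1838599,
    76738492518921385574401,
    604536771095202635980801,
    19480050253860247191553,
    344732753254500622401609],
   [117469191,
    5903535690325199699969,
    4740885425343869487105,
    18898725367634803034113,
    302526643341783652638721],
   [14909447,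
    1291275533228133318929,
    1513209510498402465,
    1378931013007969446002761,
    304594944551605335229441],
   [126100790505897991,
    20070202793430070861825,
    302379109921590320578561,
    33056565380568552833031,
    303416659336844943034369],
   [8070450539764121607,
    152296338221640710160385,
    2522015804480815377,
    19038201812910640005121,
    462791915330845957685521],
   [1008806376660533255,
    1346622591217447206985,
    9454028430829702611969,
    19189230026415577006081,
    302305262146700361863169],
   [2115620184329449346433031,
    4132072642835776536583,
    38959596671566837055489,
    18926431547726489715201,
    396678784579329578762401],
   [264452523071486457544711,
    605645808399144437678593,
    76148231892934506643457,
    661131307608484838637841,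
    302822903917546412704257],
   [64563850548588052487,
    1484968562617525207201,
    1209221044082101989675009,
    21251226196770295910401,
    302250478249787735015425],
   [516524596662563241991,
    10625613943042014711809,
    5260204384364527689,
    18907930830825862464513,
    302240822426624944275457],
   [19173961,
    75632229432370645697537,
    604481644924735322095617,
    673308727149561118793,
    38074372506544700916737],
   [76620873,
    36750609,
    4797308632538699300865,
    151189804919129903728641,
    2630102221575946313],
   [38422601,
    4759296070252084855809,
    69773473,
    1208999644872620927631361,
    7083838517733719285761],
   [1315051100990079049,
    151263454535610337854465,
    9594621768816610279425,
    9523133880129403551745,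
    4917930829730021649],
   [689465506519034288406601,
    605057817587367868892161,
    38369245973587536412673,
    37852865210646526165505,
    75705734933705952330241],
   [2693229771679919505481,
    22156449,
    1208963289635014335037441,
    2453419917290625826977,
    1208935331253360428974081],
   [71705361,
    75595910223528386904065,
    760301003753076715159713,
    1209518421550575877883905,
    40140151700537548537857],
   [25762065,
    1765411072719716625,
    151135327266941685473281,
    151127256710859508957185,
    5019824734730862002177],
   [1289206049842173560488209,
    606825246535404067751937,
    151706059581255982383105,
    37818131268884947279873,
    42287777],
   [2517990171394934046993,
    9741038296298833444865,
    151157232705161494794241,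
    2900318181635653793,
    1208944410615736558485505],
   [903895385423860465937,
    37789308196082132455425,
    151411456330173203612161,
    75578616471331232813057,
    604472709677504329220097],
   [4791830014796497057,
    1209073420589916328304641,
    11806060885595643723777,
    4874561128747875041281,
    9481644538928975841281],
   [1256149484449098062889121,
    1211291615106134037496321,
    77919065562289933516801,
    604499947483226444005377,
    774772610138776797345],
   [4731607904558235517441,
    75853160267482155976705,
    604610528798100114378753,
    10035605518617401106433,
    37801990438187014569985],
   [9463215879622922338817,
    75571698836748378316801,
    604758080232691268075521,
    5312806689968729624577,
    37927091287913623193601]]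

/-- Representatives of the `c₀`-orbits of points. -/
def pointReps : List ℕ := [1, 3, 4, 5, 9, 11, 12, 27]

/-- The orbits of lines outside the spread, with the number of their lines on each of `pointReps`. -/
def lineCounts : List (ℕ × List ℕ) :=
  [(3, [1, 1, 1, 1, 0, 0, 0, 0]),
   (1, [1, 1, 0, 0, 1, 1, 0, 0]),
   (6, [1, 1, 0, 0, 0, 0, 1, 1]),
   (10, [1, 1, 0, 0, 0, 0, 1, 1]),
   (8, [1, 0, 1, 0, 2, 0, 0, 0]),
   (5, [1, 0, 2, 0, 0, 0, 0, 1]),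
   (7, [2, 0, 0, 1, 1, 0, 0, 0]),
   (9, [1, 0, 0, 1, 0, 0, 2, 0]),
   (2, [1, 0, 0, 0, 0, 2, 1, 0]),
   (4, [2, 0, 0, 0, 0, 1, 0, 1]),
   (12, [0, 2, 1, 0, 0, 1, 0, 0]),
   (14, [0, 1, 1, 0, 0, 0, 0, 2]),
   (13, [0, 1, 0, 1, 0, 2, 0, 0]),
   (16, [0, 1, 0, 2, 0, 0, 1, 0]),
   (11, [0, 2, 0, 0, 1, 0, 1, 0]),
   (15, [0, 1, 0, 0, 2, 0, 0, 1]),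
   (17, [0, 0, 1, 1, 1, 1, 0, 0]),
   (19, [0, 0, 1, 1, 1, 1, 0, 0]),
   (20, [0, 0, 1, 1, 0, 0, 1, 1]),
   (21, [0, 0, 1, 0, 1, 0, 2, 0]),
   (18, [0, 0, 2, 0, 0, 1, 1, 0]),
   (23, [0, 0, 0, 2, 1, 0, 0, 1]),
   (22, [0, 0, 0, 1, 0, 1, 0, 2]),
   (25, [0, 0, 0, 0, 1, 1, 1, 1])]

/-- The unions of `c₀`-orbits of lines outside the spread that cover each point three times. -/
def coverSols : List (List ℕ) :=
  [[19, 17, 11, 14, 4, 9], [23, 18, 15, 12, 4, 9], [20, 19, 15, 12, 4, 9], [20, 17, 15, 12, 4, 9],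
   [23, 18, 11, 14, 2, 7], [20, 19, 11, 14, 2, 7], [20, 17, 11, 14, 2, 7], [18, 15, 16, 14, 2, 7],
   [23, 21, 14, 12, 2, 7], [18, 15, 13, 14, 9, 7], [22, 18, 15, 12, 9, 7], [25, 19, 14, 12, 9, 7],
   [25, 17, 14, 12, 9, 7], [25, 19, 11, 16, 4, 5], [25, 17, 11, 16, 4, 5], [23, 21, 11, 13, 4, 5],
   [21, 15, 16, 13, 4, 5], [23, 15, 12, 2, 9, 5], [22, 21, 11, 13, 7, 5], [25, 20, 11, 13, 7, 5],
   [22, 18, 11, 16, 4, 8], [21, 16, 13, 14, 4, 8], [22, 21, 16, 12, 4, 8], [25, 20, 16, 12, 4, 8],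
   [23, 14, 12, 2, 9, 8], [22, 11, 16, 2, 5, 8], [22, 11, 13, 9, 5, 8], [23, 18, 19, 11, 4, 10],
   [23, 18, 17, 11, 4, 10], [20, 19, 17, 11, 4, 10], [18, 19, 15, 16, 4, 10], [18, 17, 15, 16, 4,
   10], [23, 21, 19, 12, 4, 10], [23, 21, 17, 12, 4, 10], [22, 18, 19, 11, 7, 10], [22, 18, 17,
   11, 7, 10], [18, 20, 15, 13, 7, 10], [21, 19, 13, 14, 7, 10], [21, 17, 13, 14, 7, 10], [25, 23,
   18, 12, 7, 10], [22, 21, 19, 12, 7, 10], [25, 20, 19, 12, 7, 10], [22, 21, 17, 12, 7, 10], [25,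
   20, 17, 12, 7, 10], [23, 19, 11, 2, 5, 10], [23, 17, 11, 2, 5, 10], [19, 15, 16, 2, 5, 10],
   [17, 15, 16, 2, 5, 10], [19, 15, 13, 9, 5, 10], [17, 15, 13, 9, 5, 10], [19, 16, 14, 2, 8, 10],
   [17, 16, 14, 2, 8, 10], [23, 20, 12, 2, 8, 10], [19, 13, 14, 9, 8, 10], [17, 13, 14, 9, 8, 10],
   [22, 19, 12, 9, 8, 10], [22, 17, 12, 9, 8, 10], [25, 16, 13, 5, 8, 10], [23, 18, 19, 11, 4, 6],
   [23, 18, 17, 11, 4, 6], [20, 19, 17, 11, 4, 6], [18, 19, 15, 16, 4, 6], [18, 17, 15, 16, 4, 6],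
   [23, 21, 19, 12, 4, 6], [23, 21, 17, 12, 4, 6], [22, 18, 19, 11, 7, 6], [22, 18, 17, 11, 7, 6],
   [18, 20, 15, 13, 7, 6], [21, 19, 13, 14, 7, 6], [21, 17, 13, 14, 7, 6], [25, 23, 18, 12, 7, 6],
   [22, 21, 19, 12, 7, 6], [25, 20, 19, 12, 7, 6], [22, 21, 17, 12, 7, 6], [25, 20, 17, 12, 7, 6],
   [23, 19, 11, 2, 5, 6], [23, 17, 11, 2, 5, 6], [19, 15, 16, 2, 5, 6], [17, 15, 16, 2, 5, 6],
   [19, 15, 13, 9, 5, 6], [17, 15, 13, 9, 5, 6], [19, 16, 14, 2, 8, 6], [17, 16, 14, 2, 8, 6],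
   [23, 20, 12, 2, 8, 6], [19, 13, 14, 9, 8, 6], [17, 13, 14, 9, 8, 6], [22, 19, 12, 9, 8, 6],
   [22, 17, 12, 9, 8, 6], [25, 16, 13, 5, 8, 6], [23, 18, 13, 8, 10, 6], [20, 19, 13, 8, 10, 6],
   [20, 17, 13, 8, 10, 6], [23, 18, 20, 11, 4, 1], [18, 20, 15, 16, 4, 1], [21, 19, 16, 14, 4, 1],
   [21, 17, 16, 14, 4, 1], [23, 21, 20, 12, 4, 1], [22, 18, 20, 11, 7, 1], [25, 18, 16, 14, 7, 1],
   [21, 20, 13, 14, 7, 1], [22, 21, 20, 12, 7, 1], [23, 20, 11, 2, 5, 1], [20, 15, 16, 2, 5, 1],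
   [22, 19, 11, 9, 5, 1], [22, 17, 11, 9, 5, 1], [20, 15, 13, 9, 5, 1], [25, 23, 12, 9, 5, 1],
   [20, 16, 14, 2, 8, 1], [20, 13, 14, 9, 8, 1], [22, 20, 12, 9, 8, 1], [19, 17, 14, 9, 10, 1],
   [25, 19, 16, 5, 10, 1], [25, 17, 16, 5, 10, 1], [23, 21, 13, 5, 10, 1], [22, 18, 16, 8, 10, 1],
   [19, 17, 14, 9, 6, 1], [25, 19, 16, 5, 6, 1], [25, 17, 16, 5, 6, 1], [23, 21, 13, 5, 6, 1],
   [22, 18, 16, 8, 6, 1], [23, 18, 19, 10, 6, 1], [23, 18, 17, 10, 6, 1], [20, 19, 17, 10, 6, 1],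
   [25, 23, 18, 11, 4, 3], [22, 21, 19, 11, 4, 3], [25, 20, 19, 11, 4, 3], [22, 21, 17, 11, 4, 3],
   [25, 20, 17, 11, 4, 3], [25, 18, 15, 16, 4, 3], [21, 20, 15, 13, 4, 3], [25, 23, 21, 12, 4, 3],
   [19, 15, 14, 2, 9, 3], [17, 15, 14, 2, 9, 3], [25, 22, 18, 11, 7, 3], [25, 21, 13, 14, 7, 3],
   [25, 22, 21, 12, 7, 3], [25, 23, 11, 2, 5, 3], [25, 15, 16, 2, 5, 3], [25, 15, 13, 9, 5, 3],
   [22, 20, 11, 2, 8, 3], [25, 16, 14, 2, 8, 3], [25, 13, 14, 9, 8, 3], [25, 22, 12, 9, 8, 3],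
   [23, 18, 15, 2, 10, 3], [20, 19, 15, 2, 10, 3], [20, 17, 15, 2, 10, 3], [22, 21, 13, 8, 10, 3],
   [25, 20, 13, 8, 10, 3], [23, 18, 15, 2, 6, 3], [20, 19, 15, 2, 6, 3], [20, 17, 15, 2, 6, 3],
   [22, 21, 13, 8, 6, 3], [25, 20, 13, 8, 6, 3], [25, 19, 17, 10, 6, 3], [23, 21, 14, 2, 1, 3],
   [22, 18, 15, 9, 1, 3], [25, 19, 14, 9, 1, 3], [25, 17, 14, 9, 1, 3], [25, 23, 18, 10, 1, 3],
   [22, 21, 19, 10, 1, 3], [25, 20, 19, 10, 1, 3], [22, 21, 17, 10, 1, 3], [25, 20, 17, 10, 1, 3],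
   [25, 23, 18, 6, 1, 3], [22, 21, 19, 6, 1, 3], [25, 20, 19, 6, 1, 3], [22, 21, 17, 6, 1, 3],
   [25, 20, 17, 6, 1, 3]]

/-- The index of the `c₀`-orbit of the point spanned by a nonzero vector. -/
def pointOrbit : List ℕ :=
  [8, 0, 0, 1, 2, 3, 1, 3, 2, 4, 1, 5, 6, 5, 5, 1, 2, 3, 4, 5, 1, 1, 3, 2, 6, 5, 5, 7, 0, 5, 2, 7,
   2, 7, 6, 1, 5, 0, 7, 0, 3, 4, 4, 2, 4, 6, 3, 6, 4, 3, 0, 1, 6, 7, 7, 5, 0, 7, 1, 6, 2, 2, 7, 6,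
   6, 3, 1, 7, 6, 4, 0, 3, 5, 7, 0, 4, 4, 2, 0, 4, 3]

/-- The codes of the vectors in the span of two vectors. -/
def spanCodes (u v : ℕ) : List ℕ :=
  [0, u, addCode u u, v, addCode u v, addCode (addCode u u) v, addCode v v,
    addCode u (addCode v v), addCode (addCode u u) (addCode v v)]

/-- The bit mask of a list of codes. -/
def maskOf (l : List ℕ) : ℕ := l.foldr (fun c m => Nat.lor (Nat.pow 2 c) m) 0

/-- The code of `c₀ ^ b x`. -/
def c0Pow (b x : ℕ) : ℕ := Nat.rec x (fun _ y => applyCols c0Cols y) b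

/-- The bit mask of the `b`-th line in the `o`-th orbit. -/
def lineMask (o b : ℕ) : ℕ := (lineRows.getD o []).getD b 0

/-- The `b`-th line of the `o`-th orbit is spanned by the vectors with codes `pairFst o b` and
`pairSnd o b`. -/
def pairFst (o b : ℕ) : ℕ := c0Pow b (linePairs.getD o (0, 0)).1

/-- The second spanning vector of a line. -/
def pairSnd (o b : ℕ) : ℕ := c0Pow b (linePairs.getD o (0, 0)).2

/-- `v` is not in the span of `u ≠ 0`. -/
def indepCodes (u v : ℕ) : Bool :=
  !(Nat.beq u 0 || Nat.beq v 0 || Nat.beq v u || Nat.beq v (addCode u u))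

/-- Ties the literal table of masks to its meaning: row `o` is the `c₀`-orbit of the span of the
pair `linePairs[o]`. -/
theorem lineMask_eq : ∀ o < 26, ∀ b < 5,
    lineMask o b = maskOf (spanCodes (pairFst o b) (pairSnd o b)) ∧
      indepCodes (pairFst o b) (pairSnd o b) = true ∧ pairFst o b < 81 ∧ pairSnd o b < 81 := by
  decide +kernel

/-- As `c₀ ^ 5 = 1`, the line with index 5 is again the line with index 0, so each row is a full
cycle. -/
theorem pair_five : ∀ o < 26, pairFst o 5 = pairFst o 0 ∧ pairSnd o 5 = pairSnd o 0 := by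
  decide +kernel

theorem lineRows_eq : ∀ o < 26, lineRows.getD o [] = (List.range 5).map (lineMask o) := by
  decide +kernel

/-- Orbits 0 and 24 make up the spread; `lineCounts` lists the other 24 in the order used by the
search. -/
theorem lineCounts_perm : (List.range 26).Perm (0 :: 24 :: lineCounts.map Prod.fst) := by
  decide +kernel

/-- Together with `lineMask_separate` this shows that the table contains each of the 130 lines
exactly once. -/
theorem lineMask_cover : ((List.range 81).all fun u => (List.range 81).all fun v =>
    !indepCodes u v || lineRows.any fun r => r.any fun m => inMask m u && inMask m v) = true := by
  decide +kernel

theorem lineMask_separate : ((List.range 26).all fun o => (List.range 5).all fun b =>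
    (List.range 26).all fun o' => (List.range 5).all fun b' =>
      !(inMask (lineMask o' b') (pairFst o b) && inMask (lineMask o' b') (pairSnd o b)) ||
        (Nat.beq o o' && Nat.beq b b')) = true := by
  decide +kernel

theorem lineCounts_eq : ∀ e ∈ lineCounts, e.1 < 26 ∧ e.2 = pointReps.map fun w =>
    (lineRows.getD e.1 []).countP fun m => inMask m w := by
  decide +kernel

/-- The unions of orbits with given numbers of lines on the point representatives. -/
def coverSearch : List (ℕ × List ℕ) → List ℕ → List ℕ → List (List ℕ)
  | [], need, acc => if need.all (Nat.beq 0) then [acc] else []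
  | e :: t, need, acc => coverSearch t need acc ++
      if (List.zipWith Nat.ble e.2 need).all id then
        coverSearch t (List.zipWith Nat.sub need e.2) (e.1 :: acc) else []

/-- Branching over taking or skipping each orbit, pruned as soon as some point representative would
be covered more than three times. -/
theorem coverSearch_eq : coverSearch lineCounts [3, 3, 3, 3, 3, 3, 3, 3] [] = coverSols := by
  decide +kernel

/-! ### Signed involutions and the candidates for elements of order 3. -/

/-- The signed involutions `± S₁, …, ± S₅`. -/
def signedCols : List Cols :=
  [(1, 3, 18, 54), (2, 6, 9, 27), (9, 27, 1, 3), (18, 54, 2, 6), (27, 18, 6, 1), (54, 9, 3, 2),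
    (36, 63, 8, 5), (72, 45, 4, 7), (45, 36, 7, 8), (63, 72, 5, 4)]

/-- The columns of `± S_k`. -/
def signedCol (x : ℕ) : Cols := signedCols.getD x (0, 0, 0, 0)

/-- The columns of a basis adapted to anticommuting involutions. -/
def frameCols (b c : Cols) (v : ℕ) : Cols :=
  (v, applyCols b (applyCols c v), applyCols b v, applyCols c v)

/-- The signed permutation of the labels `0, …, 9` with values `f` at the even labels. -/
def signedAct (f : List ℕ) (x : ℕ) : ℕ := Nat.xor (f.getD (x / 2) 0) (x % 2)

/-- `Q` holds for all candidates for the columns of an element of order `3` of the normalizer. -/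
def orderThreeAll (Q : Cols → Bool) : Bool :=
  (List.range 10).all fun a => (List.range 10).all fun b => Nat.beq (a / 2) (b / 2) ||
  (List.range 10).all fun c => Nat.beq (a / 2) (c / 2) || Nat.beq (b / 2) (c / 2) ||
  (List.range 10).all fun d => Nat.beq (a / 2) (d / 2) || Nat.beq (b / 2) (d / 2) ||
    Nat.beq (c / 2) (d / 2) ||
  (List.range 10).all fun e => Nat.beq (a / 2) (e / 2) || Nat.beq (b / 2) (e / 2) ||
    Nat.beq (c / 2) (e / 2) || Nat.beq (d / 2) (e / 2) ||
  !([0, 2, 4, 6, 8].all fun x => Nat.beq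
    (signedAct [a, b, c, d, e] (signedAct [a, b, c, d, e] (signedAct [a, b, c, d, e] x))) x) ||
  (List.range 81).all fun v => Nat.beq v 0 ||
    !(Nat.beq (applyCols (signedCol a) v) v) ||
    !(Nat.beq (applyCols (signedCol d) v)
      (addCode (applyCols (signedCol b) v) (applyCols (signedCol c) v))) ||
    Q (frameCols (signedCol b) (signedCol c) v)

/-- The two solutions with a transitive group. -/
def goodSols : List (List ℕ) := [[19, 17, 11, 14, 4, 9], [23, 18, 13, 8, 10, 6]]

/-- The images of two lines of each orbit in `s` lie in orbits in `s`. -/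
def stabCheck (m : Cols) (s : List ℕ) : Bool :=
  s.all fun o => [0, 1].all fun b => s.any fun o' => (lineRows.getD o' []).any fun k =>
    inMask k (applyCols m (pairFst o b)) && inMask k (applyCols m (pairSnd o b))

/-- `m` is the identity or its negative. -/
def scalarCheck (m : Cols) : Bool := m == (1, 3, 9, 27) || m == (2, 6, 18, 54)

/-- Invariance is tested on two lines per orbit only: this necessary condition already rejects
everything outside `goodSols`. The scalars must be exempted, since the trivial signed permutation
passes the test for order 3. -/
theorem stabCheck_all : orderThreeAll (fun m => scalarCheck m ||
    coverSols.all fun s => goodSols.contains s || !stabCheck m s) = true := by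
  decide +kernel

/-- The orbit index of a point. -/
def ptOrb (x : ℕ) : ℕ := pointOrbit.getD x 0

/-- A non-scalar candidate maps some points of any given `c₀`-orbit into two further `c₀`-orbits, so
an invariant point set contains at least three orbits. -/
theorem pointCheck_all : orderThreeAll (fun m => scalarCheck m ||
    (List.range 8).all fun k => (List.range 5).any fun b => (List.range 5).any fun b' =>
      let w := pointReps.getD k 0
      let i := ptOrb (applyCols m (c0Pow b w))
      let j := ptOrb (applyCols m (c0Pow b' w))
      !(Nat.beq k i) && !(Nat.beq k j) && !(Nat.beq i j)) = true := by
  decide +kernel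

/-! ### Passage from codes and masks to subspaces of dimension 2. -/

theorem inMask_eq (m n : ℕ) : inMask m n = m.testBit n := by
  have h : Nat.land (Nat.shiftRight m n) 1 = (m >>> n) &&& 1 := rfl
  rw [inMask, h, Nat.testBit, Nat.and_comm, Nat.one_and_eq_mod_two]
  rcases Nat.mod_two_eq_zero_or_one (m >>> n) with h | h <;> rw [h] <;> rfl

theorem inMask_maskOf (l : List ℕ) (n : ℕ) : inMask (maskOf l) n = true ↔ n ∈ l := by
  rw [inMask_eq]
  induction l with
  | nil => simp [maskOf]
  | cons c t ih =>
    have h : maskOf (c :: t) = (2 ^ c) ||| maskOf t := rfl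
    rw [h, Nat.testBit_or, Bool.or_eq_true, ih, List.mem_cons, Nat.testBit_two_pow]
    simp [eq_comm]

theorem mem_spanCodes (x y z : V43) :
    enc z ∈ spanCodes (enc x) (enc y) ↔ z ∈ Submodule.span (ZMod 3) {x, y} := by
  have h2 : ∀ w : V43, (2 : ZMod 3) • w = w + w := fun w => two_smul _ w
  have hall : ∀ p : ZMod 3 → Prop, (∃ a, p a) ↔ p 0 ∨ p 1 ∨ p 2 := by
    intro p
    constructor
    · rintro ⟨a, ha⟩
      fin_cases a
      · exact Or.inl ha
      · exact Or.inr (Or.inl ha)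
      · exact Or.inr (Or.inr ha)
    · rintro (h | h | h) <;> exact ⟨_, h⟩
  simp only [Submodule.mem_span_pair, hall, h2, zero_smul, one_smul, zero_add, add_zero]
  simp only [spanCodes, ← enc_add, ← enc_zero, List.mem_cons, enc_injective.eq_iff, List.not_mem_nil,
    or_false]
  rw [show (0 : V43) = z ↔ z = 0 from eq_comm, show x = z ↔ z = x from eq_comm,
    show y = z ↔ z = y from eq_comm, show x + x = z ↔ z = x + x from eq_comm,
    show y + y = z ↔ z = y + y from eq_comm, show x + y = z ↔ z = x + y from eq_comm,
    show x + x + y = z ↔ z = x + x + y from eq_comm,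
    show x + (y + y) = z ↔ z = x + (y + y) from eq_comm,
    show x + x + (y + y) = z ↔ z = x + x + (y + y) from eq_comm]
  tauto

theorem indepCodes_iff (x y : V43) :
    indepCodes (enc x) (enc y) = true ↔ LinearIndependent (ZMod 3) ![x, y] := by
  have h1 : indepCodes (enc x) (enc y) = true ↔ x ≠ 0 ∧ y ≠ 0 ∧ y ≠ x ∧ y ≠ x + x := by
    simp only [indepCodes, ← enc_add, Bool.not_eq_true', ← Bool.not_eq_true,
      Bool.or_eq_true, not_or, and_assoc, Nat.beq_eq, enc_eq_zero, enc_injective.eq_iff, ne_eq]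
  have h3 : ∀ w : V43, w + w = -w := by
    intro w
    funext i
    simp only [Pi.neg_apply, Pi.add_apply]
    generalize w i = a
    revert a
    decide
  rw [h1, LinearIndependent.pair_iff]
  constructor
  · rintro ⟨hx, hy, hyx, hyx2⟩ s t hst
    have hs : ∀ s : ZMod 3, s = 0 ∨ s = 1 ∨ s = -1 := by decide
    rw [h3] at hyx2
    rcases hs s with rfl | rfl | rfl <;> rcases hs t with rfl | rfl | rfl <;>
      simp only [zero_smul, one_smul, neg_smul, zero_add, add_zero, neg_eq_zero] at hst
    · exact ⟨rfl, rfl⟩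
    · exact absurd hst hy
    · exact absurd hst hy
    · exact absurd hst hx
    · exact absurd (eq_neg_of_add_eq_zero_right hst) hyx2
    · exact absurd (add_neg_eq_zero.1 hst).symm hyx
    · exact absurd hst hx
    · exact absurd (neg_add_eq_zero.1 hst).symm hyx
    · rw [← neg_add, neg_eq_zero] at hst
      exact absurd (eq_neg_of_add_eq_zero_right hst) hyx2
  · intro h
    refine ⟨?_, ?_, ?_, ?_⟩
    · rintro rfl
      exact absurd (h 1 0 (by simp)).1 (by decide)
    · rintro rfl
      exact absurd (h 0 1 (by simp)).2 (by decide)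
    · rintro rfl
      exact absurd (h 1 (-1) (by simp)).1 (by decide)
    · rintro rfl
      exact absurd (h 1 1 (by simp [h3])).1 (by decide)

theorem finrank_span_pair {x y : V43} (h : LinearIndependent (ZMod 3) ![x, y]) :
    Module.finrank (ZMod 3) (Submodule.span (ZMod 3) {x, y}) = 2 := by
  have := finrank_span_eq_card h
  rwa [Matrix.range_cons_cons_empty, Fintype.card_fin] at this

theorem card_submodule (W : Submodule (ZMod 3) V43) :
    Nat.card W = 3 ^ Module.finrank (ZMod 3) W := by
  rw [Module.natCard_eq_pow_finrank (K := ZMod 3), Nat.card_zmod]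

theorem finrank_eq_two_iff (W : Submodule (ZMod 3) V43) :
    Nat.card W = 9 ↔ Module.finrank (ZMod 3) W = 2 := by
  rw [card_submodule, show 9 = 3 ^ 2 by norm_num]
  exact (Nat.pow_right_injective (le_refl 2 |>.trans (by norm_num))).eq_iff

theorem eq_span_pair {W : Submodule (ZMod 3) V43} (hW : Module.finrank (ZMod 3) W = 2) {x y : V43}
    (hx : x ∈ W) (hy : y ∈ W) (h : LinearIndependent (ZMod 3) ![x, y]) :
    W = Submodule.span (ZMod 3) {x, y} := by
  refine (Submodule.eq_of_le_of_finrank_eq ?_ ?_).symm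
  · rw [Submodule.span_le]
    rintro z (rfl | rfl) <;> assumption
  · rw [finrank_span_pair h, hW]

/-- The `b`-th line of the `o`-th orbit. -/
def lineSpan (o b : ℕ) : Submodule (ZMod 3) V43 :=
  Submodule.span (ZMod 3) {dec (pairFst o b), dec (pairSnd o b)}

theorem inMask_lineMask {o b : ℕ} (ho : o < 26) (hb : b < 5) (z : V43) :
    inMask (lineMask o b) (enc z) = true ↔ z ∈ lineSpan o b := by
  obtain ⟨h1, -, h2, h3⟩ := lineMask_eq o ho b hb
  rw [h1, inMask_maskOf, lineSpan, ← mem_spanCodes, enc_dec h2, enc_dec h3]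

theorem inMask_lineMask' {o b : ℕ} (ho : o < 26) (hb : b < 5) {n : ℕ} (hn : n < 81) :
    inMask (lineMask o b) n = true ↔ dec n ∈ lineSpan o b := by
  rw [← inMask_lineMask ho hb, enc_dec hn]

theorem linearIndependent_pair {o b : ℕ} (ho : o < 26) (hb : b < 5) :
    LinearIndependent (ZMod 3) ![dec (pairFst o b), dec (pairSnd o b)] := by
  obtain ⟨-, h, h2, h3⟩ := lineMask_eq o ho b hb
  rwa [← indepCodes_iff, enc_dec h2, enc_dec h3]

theorem finrank_lineSpan {o b : ℕ} (ho : o < 26) (hb : b < 5) :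
    Module.finrank (ZMod 3) (lineSpan o b) = 2 :=
  finrank_span_pair (linearIndependent_pair ho hb)

theorem pairFst_mem (o b : ℕ) : dec (pairFst o b) ∈ lineSpan o b :=
  Submodule.subset_span (Or.inl rfl)

theorem pairSnd_mem (o b : ℕ) : dec (pairSnd o b) ∈ lineSpan o b :=
  Submodule.subset_span (Or.inr rfl)

/-- A line is recognised by containing the two spanning vectors of another one, which is what
`lineMask_separate` tests. -/
theorem lineSpan_inj {o b o' b' : ℕ} (ho : o < 26) (hb : b < 5) (ho' : o' < 26) (hb' : b' < 5)
    (h : lineSpan o b = lineSpan o' b') : o = o' ∧ b = b' := by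
  have := lineMask_separate
  simp only [List.all_eq_true, List.mem_range] at this
  have := this o ho b hb o' ho' b' hb'
  obtain ⟨-, -, h2, h3⟩ := lineMask_eq o ho b hb
  have e1 : inMask (lineMask o' b') (pairFst o b) = true := by
    rw [inMask_lineMask' ho' hb' h2, ← h]
    exact pairFst_mem o b
  have e2 : inMask (lineMask o' b') (pairSnd o b) = true := by
    rw [inMask_lineMask' ho' hb' h3, ← h]
    exact pairSnd_mem o b
  simpa [e1, e2] using this

theorem exists_pair {W : Submodule (ZMod 3) V43} (hW : Module.finrank (ZMod 3) W = 2) :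
    ∃ x ∈ W, ∃ y ∈ W, LinearIndependent (ZMod 3) ![x, y] := by
  let B := Module.finBasisOfFinrankEq (ZMod 3) W hW
  refine ⟨B 0, (B 0).2, B 1, (B 1).2, ?_⟩
  have h := B.linearIndependent.map' W.subtype W.ker_subtype
  have e : W.subtype ∘ B = ![(B 0 : V43), (B 1 : V43)] := by
    funext i
    fin_cases i <;> rfl
  rwa [e] at h

theorem exists_lineSpan {W : Submodule (ZMod 3) V43} (hW : Module.finrank (ZMod 3) W = 2) :
    ∃ o < 26, ∃ b < 5, W = lineSpan o b := by
  obtain ⟨x, hx, y, hy, hxy⟩ := exists_pair hW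
  have := lineMask_cover
  simp only [List.all_eq_true, List.mem_range] at this
  have := this _ (enc_lt x) _ (enc_lt y)
  rw [(indepCodes_iff x y).2 hxy] at this
  simp only [Bool.not_true, Bool.false_or, List.any_eq_true] at this
  obtain ⟨r, hr, m, hm, h⟩ := this
  obtain ⟨o, ho, rfl⟩ := List.mem_iff_getElem.1 hr
  have ho' : o < 26 := ho
  have hrow := lineRows_eq o ho'
  rw [List.getD_eq_getElem _ _ ho] at hrow
  rw [hrow, List.mem_map] at hm
  obtain ⟨b, hb, rfl⟩ := hm
  rw [List.mem_range] at hb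
  rw [Bool.and_eq_true, inMask_lineMask ho' hb, inMask_lineMask ho' hb] at h
  refine ⟨o, ho', b, hb, ?_⟩
  rw [eq_span_pair hW hx hy hxy, eq_span_pair (finrank_lineSpan ho' hb) h.1 h.2 hxy]

theorem dec_applyCols_gcols (g : GL43) (n : ℕ) (hn : n < 81) :
    g (dec n) = dec (applyCols (gcols g) n) := by
  apply enc_injective
  rw [enc_gmap, enc_dec hn, enc_dec (applyCols_lt _ _)]

theorem map_lineSpan {c : GL43} (hc : gcols c = c0Cols) {o b : ℕ} (ho : o < 26) (hb : b < 5) :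
    (lineSpan o b).map (c : V43 →ₗ[ZMod 3] V43) = lineSpan o (b + 1) := by
  obtain ⟨-, -, h2, h3⟩ := lineMask_eq o ho b hb
  have e : ∀ n, n < 81 → (c : V43 →ₗ[ZMod 3] V43) (dec n) = dec (applyCols c0Cols n) := by
    intro n hn
    rw [← hc]
    exact dec_applyCols_gcols c n hn
  rw [lineSpan, Submodule.map_span, Set.image_pair, e _ h2, e _ h3]
  rfl

theorem lineSpan_five {o : ℕ} (ho : o < 26) : lineSpan o 5 = lineSpan o 0 := by
  rw [lineSpan, lineSpan, (pair_five o ho).1, (pair_five o ho).2]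

/-! ### Line sets covering every point three times. -/

/-- Completeness of the search: following the branch that takes exactly the orbits satisfying `P`
never triggers the pruning, because a partial sum cannot exceed the total. -/
theorem mem_coverSearch (P : ℕ → Prop) [DecidablePred P] (L : List (ℕ × List ℕ))
    (need acc : List ℕ) (hlen : ∀ e ∈ L, e.2.length = need.length)
    (hsum : ∀ k < need.length,
      (L.map fun e => if P e.1 then e.2.getD k 0 else 0).sum = need.getD k 0) :
    ∃ s ∈ coverSearch L need acc, ∀ o, o ∈ s ↔ o ∈ acc ∨ (P o ∧ o ∈ L.map Prod.fst) := by
  induction L generalizing need acc with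
  | nil =>
    have h : need.all (Nat.beq 0) = true := by
      rw [List.all_eq_true]
      intro x hx
      obtain ⟨k, hk, rfl⟩ := List.mem_iff_getElem.1 hx
      have := hsum k hk
      rw [List.getD_eq_getElem _ _ hk] at this
      rw [← this]
      rfl
    refine ⟨acc, ?_, fun o => by simp⟩
    rw [coverSearch, if_pos h]
    exact List.mem_singleton_self _
  | cons e t ih =>
    have he : e.2.length = need.length := hlen e List.mem_cons_self
    have ht : ∀ e' ∈ t, e'.2.length = need.length := fun e' h => hlen e' (List.mem_cons_of_mem _ h)
    simp only [List.map_cons, List.sum_cons] at hsum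
    by_cases hP : P e.1
    · simp only [if_pos hP] at hsum
      have hble : (List.zipWith Nat.ble e.2 need).all id = true := by
        rw [List.all_eq_true]
        intro x hx
        obtain ⟨k, hk, rfl⟩ := List.mem_iff_getElem.1 hx
        rw [List.length_zipWith] at hk
        have h1 : k < need.length := by omega
        have h2 : k < e.2.length := by omega
        have := hsum k h1
        rw [List.getD_eq_getElem _ _ h1, List.getD_eq_getElem _ _ h2] at this
        rw [List.getElem_zipWith, id, Nat.ble_eq]
        omega
      have hl : (List.zipWith Nat.sub need e.2).length = need.length := by
        rw [List.length_zipWith]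
        omega
      obtain ⟨s, hs, hs'⟩ := ih (List.zipWith Nat.sub need e.2) (e.1 :: acc)
        (fun e' h => (ht e' h).trans hl.symm) (by
          intro k hk
          rw [List.getD_eq_getElem _ _ hk, List.getElem_zipWith]
          have h1 : k < need.length := by omega
          have h2 : k < e.2.length := by omega
          have := hsum k h1
          rw [List.getD_eq_getElem _ _ h1, List.getD_eq_getElem _ _ h2] at this
          change _ = need[k] - e.2[k]
          omega)
      refine ⟨s, ?_, fun o => ?_⟩
      · rw [coverSearch, if_pos hble]
        exact List.mem_append_right _ hs
      · rw [hs', List.mem_cons, List.map_cons, List.mem_cons]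
        constructor
        · rintro ((rfl | h) | h)
          · exact Or.inr ⟨hP, Or.inl rfl⟩
          · exact Or.inl h
          · exact Or.inr ⟨h.1, Or.inr h.2⟩
        · rintro (h | ⟨h, rfl | h'⟩)
          · exact Or.inl (Or.inr h)
          · exact Or.inl (Or.inl rfl)
          · exact Or.inr ⟨h, h'⟩
    · simp only [if_neg hP, zero_add] at hsum
      obtain ⟨s, hs, hs'⟩ := ih need acc ht hsum
      refine ⟨s, ?_, fun o => ?_⟩
      · rw [coverSearch]
        exact List.mem_append_left _ hs
      · rw [hs', List.map_cons, List.mem_cons]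
        constructor
        · rintro (h | h)
          · exact Or.inl h
          · exact Or.inr ⟨h.1, Or.inr h.2⟩
        · rintro (h | ⟨h, rfl | h'⟩)
          · exact Or.inl h
          · exact absurd h hP
          · exact Or.inr ⟨h, h'⟩

section lines

variable {F : Set (Submodule (ZMod 3) V43)} {c : GL43}

/-- A `c`-invariant line set is a union of `c`-orbits, so membership of one line decides for the
whole row. -/
theorem lineSpan_mem_iff (hc : gcols c = c0Cols)
    (hF : ∀ W ∈ F, W.map (c : V43 →ₗ[ZMod 3] V43) ∈ F) {o : ℕ} (ho : o < 26) {b : ℕ} (hb : b < 5) :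
    lineSpan o b ∈ F ↔ lineSpan o 0 ∈ F := by
  have step : ∀ b < 5, lineSpan o b ∈ F → lineSpan o (b + 1) ∈ F := by
    intro b hb h
    rw [← map_lineSpan hc ho hb]
    exact hF _ h
  have up : ∀ k b, b + k ≤ 5 → lineSpan o b ∈ F → lineSpan o (b + k) ∈ F := by
    intro k
    induction k with
    | zero => exact fun b _ h => h
    | succ k ih =>
      intro b hk h
      exact step (b + k) (by omega) (ih b (by omega) h)
  constructor
  · intro h
    -- The remaining `5 - b` applications of `c` close the cycle at index 5, which is index 0.
    have := up (5 - b) b (by omega) h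
    rwa [show b + (5 - b) = 5 by omega, lineSpan_five ho] at this
  · intro h
    simpa using up b 0 (by omega) h

/-- Since `F` is a union of `c`-orbits, the count splits into the tabulated contributions of the
orbits contained in `F`. -/
theorem card_lines_through (hc : gcols c = c0Cols)
    (hF : ∀ W ∈ F, W.map (c : V43 →ₗ[ZMod 3] V43) ∈ F)
    (hdim : ∀ W ∈ F, Module.finrank (ZMod 3) W = 2) (x : V43) [DecidablePred fun o => lineSpan o 0 ∈ F] :
    {W ∈ F | x ∈ W}.ncard = ((List.range 26).map fun o =>
      if lineSpan o 0 ∈ F then (lineRows.getD o []).countP fun m => inMask m (enc x) else 0).sum := by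
  classical
  let A : Finset ((_ : ℕ) × ℕ) := (Finset.range 26).sigma fun o =>
    if lineSpan o 0 ∈ F then (Finset.range 5).filter fun b => inMask (lineMask o b) (enc x) = true
    else ∅
  have hA : ∀ q, q ∈ A ↔ q.1 < 26 ∧ lineSpan q.1 0 ∈ F ∧ q.2 < 5 ∧
      inMask (lineMask q.1 q.2) (enc x) = true := by
    intro q
    simp only [A, Finset.mem_sigma, Finset.mem_range]
    split_ifs with h <;> simp [h]
  have himg : {W ∈ F | x ∈ W} = (fun q : (_ : ℕ) × ℕ => lineSpan q.1 q.2) '' (A : Set _) := by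
    ext W
    simp only [Set.mem_ofPred_eq, Set.mem_image, Finset.mem_coe, hA]
    constructor
    · rintro ⟨hW, hx⟩
      obtain ⟨o, ho, b, hb, rfl⟩ := exists_lineSpan (hdim W hW)
      exact ⟨⟨o, b⟩, ⟨ho, (lineSpan_mem_iff hc hF ho hb).1 hW, hb, (inMask_lineMask ho hb x).2 hx⟩, rfl⟩
    · rintro ⟨⟨o, b⟩, ⟨ho, h, hb, hx⟩, rfl⟩
      exact ⟨(lineSpan_mem_iff hc hF ho hb).2 h, (inMask_lineMask ho hb x).1 hx⟩
  rw [himg, Set.InjOn.ncard_image, Set.ncard_coe_finset, Finset.card_sigma]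
  · have : ∀ f : ℕ → ℕ, ((List.range 26).map f).sum = ∑ o ∈ Finset.range 26, f o := fun f => rfl
    rw [this]
    refine Finset.sum_congr rfl fun o ho => ?_
    rw [lineRows_eq o (Finset.mem_range.1 ho)]
    split_ifs
    · rw [List.countP_map, List.countP_eq_length_filter]
      change (List.filter (fun b => decide (inMask (lineMask o b) (enc x) = true))
        (List.range 5)).length = _
      simp only [Bool.decide_eq_true]
      rfl
    · rfl
  · rintro ⟨o, b⟩ h ⟨o', b'⟩ h' e
    have h := (hA _).1 h
    have h' := (hA _).1 h'
    obtain ⟨rfl, rfl⟩ := lineSpan_inj h.1 h.2.2.1 h'.1 h'.2.2.1 e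
    rfl

/-- The covering condition is used only at the eight point representatives, where it reads as the
linear system solved by the search. -/
theorem exists_coverSol (hc : gcols c = c0Cols)
    (hF : ∀ W ∈ F, W.map (c : V43 →ₗ[ZMod 3] V43) ∈ F)
    (hdim : ∀ W ∈ F, Module.finrank (ZMod 3) W = 2)
    (hcov : ∀ x : V43, x ≠ 0 → {W ∈ F | x ∈ W}.ncard = 3)
    (h0 : lineSpan 0 0 ∉ F) (h24 : lineSpan 24 0 ∉ F) :
    ∃ s ∈ coverSols, ∀ o < 26, o ∈ s ↔ lineSpan o 0 ∈ F := by
  classical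
  rw [← coverSearch_eq]
  have hlen : ∀ e ∈ lineCounts, e.2.length = 8 := by
    intro e he
    rw [(lineCounts_eq e he).2, List.length_map]
    rfl
  obtain ⟨s, hs, hs'⟩ := mem_coverSearch (fun o => lineSpan o 0 ∈ F) lineCounts
    [3, 3, 3, 3, 3, 3, 3, 3] [] hlen (by
      intro k hk
      have hk : k < 8 := hk
      have h3 : ([3, 3, 3, 3, 3, 3, 3, 3] : List ℕ).getD k 0 = 3 := by
        interval_cases k <;> rfl
      have hw : pointReps.getD k 0 < 81 ∧ pointReps.getD k 0 ≠ 0 := by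
        interval_cases k <;> decide
      have hne : dec (pointReps.getD k 0) ≠ 0 := by
        intro h
        have := enc_dec hw.1
        rw [h, enc_zero] at this
        exact hw.2 this.symm
      have key := hcov _ hne
      rw [card_lines_through hc hF hdim, enc_dec hw.1,
        (lineCounts_perm.map _).sum_eq, List.map_cons, List.map_cons, List.sum_cons, List.sum_cons,
        if_neg h0, if_neg h24, zero_add, zero_add, List.map_map] at key
      rw [h3]
      refine Eq.trans ?_ key
      refine congrArg List.sum (List.map_congr_left fun e he => ?_)
      have hk' : k < pointReps.length := hk
      rw [Function.comp_apply, (lineCounts_eq e he).2, List.getD_eq_getElem _ _ (by simpa using hk'),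
        List.getElem_map, List.getD_eq_getElem _ _ hk'])
  refine ⟨s, hs, fun o ho => ?_⟩
  rw [hs']
  have hmem := lineCounts_perm.mem_iff (a := o)
  simp only [List.mem_range, List.mem_cons] at hmem
  constructor
  · rintro (h | h)
    · exact absurd h List.not_mem_nil
    · exact h.1
  · intro h
    rcases hmem.1 ho with rfl | rfl | h'
    · exact absurd h h0
    · exact absurd h h24
    · exact Or.inr ⟨h, h'⟩

theorem stabCheck_of_map (hc : gcols c = c0Cols)
    (hF : ∀ W ∈ F, W.map (c : V43 →ₗ[ZMod 3] V43) ∈ F)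
    (hdim : ∀ W ∈ F, Module.finrank (ZMod 3) W = 2) {d : GL43}
    (hd : ∀ W ∈ F, W.map (d : V43 →ₗ[ZMod 3] V43) ∈ F) {s : List ℕ} (hs26 : ∀ o ∈ s, o < 26)
    (hs : ∀ o < 26, o ∈ s ↔ lineSpan o 0 ∈ F) : stabCheck (gcols d) s = true := by
  simp only [stabCheck, List.all_eq_true, List.any_eq_true]
  intro o ho b hb
  have ho26 := hs26 o ho
  have hb5 : b < 5 := by
    rcases List.mem_cons.1 hb with rfl | hb
    · norm_num
    · rw [List.mem_singleton.1 hb]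
      norm_num
  have h1 : lineSpan o b ∈ F := (lineSpan_mem_iff hc hF ho26 hb5).2 ((hs o ho26).1 ho)
  have h2 := hd _ h1
  obtain ⟨o', ho', b', hb', e⟩ := exists_lineSpan (hdim _ h2)
  rw [e] at h2
  refine ⟨o', (hs o' ho').2 ((lineSpan_mem_iff hc hF ho' hb').1 h2), lineMask o' b', ?_, ?_⟩
  · rw [lineRows_eq o' ho']
    exact List.mem_map.2 ⟨b', List.mem_range.2 hb', rfl⟩
  · obtain ⟨-, -, k1, k2⟩ := lineMask_eq o ho26 b hb5
    rw [Bool.and_eq_true, inMask_lineMask' ho' hb' (applyCols_lt _ _),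
      inMask_lineMask' ho' hb' (applyCols_lt _ _), ← dec_applyCols_gcols d _ k1,
      ← dec_applyCols_gcols d _ k2, ← e]
    exact ⟨Submodule.mem_map_of_mem (pairFst_mem o b), Submodule.mem_map_of_mem (pairSnd_mem o b)⟩

theorem mem_goodSols (hc : gcols c = c0Cols)
    (hF : ∀ W ∈ F, W.map (c : V43 →ₗ[ZMod 3] V43) ∈ F)
    (hdim : ∀ W ∈ F, Module.finrank (ZMod 3) W = 2)
    (hcov : ∀ x : V43, x ≠ 0 → {W ∈ F | x ∈ W}.ncard = 3)
    (h0 : lineSpan 0 0 ∉ F) (h24 : lineSpan 24 0 ∉ F) {d : GL43}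
    (hd : ∀ W ∈ F, W.map (d : V43 →ₗ[ZMod 3] V43) ∈ F)
    (hQ : (coverSols.all fun s => goodSols.contains s || !stabCheck (gcols d) s) = true) :
    ∃ s ∈ goodSols, F = {W | ∃ o ∈ s, ∃ b < 5, W = lineSpan o b} := by
  obtain ⟨s, hs, hs'⟩ := exists_coverSol hc hF hdim hcov h0 h24
  have h26 : ∀ s ∈ coverSols, ∀ o ∈ s, o < 26 := by decide +kernel
  have hst := stabCheck_of_map hc hF hdim hd (h26 s hs) hs'
  rw [List.all_eq_true] at hQ
  have hg := hQ s hs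
  rw [hst, Bool.not_true, Bool.or_false, List.contains_iff_mem] at hg
  refine ⟨s, hg, ?_⟩
  ext W
  constructor
  · intro hW
    obtain ⟨o, ho, b, hb, rfl⟩ := exists_lineSpan (hdim W hW)
    exact ⟨o, (hs' o ho).2 ((lineSpan_mem_iff hc hF ho hb).1 hW), b, hb, rfl⟩
  · rintro ⟨o, ho, b, hb, rfl⟩
    have ho' := h26 s hs o ho
    exact (lineSpan_mem_iff hc hF ho' hb).2 ((hs' o ho').1 ho)

end lines

/-! ### Invariant sets of vectors have at least 30 elements. -/

theorem ptOrb_lt : ∀ x < 81, x ≠ 0 → ptOrb x < 8 := by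
  decide +kernel

theorem ptOrb_rep : ∀ k < 8, ptOrb (pointReps.getD k 0) = k ∧ pointReps.getD k 0 < 81 ∧
    pointReps.getD k 0 ≠ 0 := by
  decide +kernel

/-- Equality of orbit indices means that the points are related by a power of `c₀`, hence the
vectors up to sign. -/
theorem exists_c0Pow : ((List.range 81).all fun x => (List.range 81).all fun y =>
    Nat.beq x 0 || Nat.beq y 0 || !(Nat.beq (ptOrb x) (ptOrb y)) || (List.range 5).any fun b =>
      Nat.beq y (c0Pow b x) || Nat.beq y (addCode (c0Pow b x) (c0Pow b x))) = true := by
  decide +kernel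

/-- Each `c₀`-orbit consists of five points, that is, of ten vectors. -/
theorem card_three_orbits : ((List.range 8).all fun i => (List.range 8).all fun j =>
    (List.range 8).all fun k => Nat.beq k i || Nat.beq k j || Nat.beq i j ||
      Nat.beq ((List.range 81).countP fun x =>
        Nat.beq (ptOrb x) k || Nat.beq (ptOrb x) i || Nat.beq (ptOrb x) j) 30) = true := by
  decide +kernel

theorem c0Pow_lt {x : ℕ} (hx : x < 81) : ∀ b, c0Pow b x < 81
  | 0 => hx
  | _ + 1 => applyCols_lt _ _

theorem dec_c0Pow_mem {U : Set V43} {c : GL43} (hc : gcols c = c0Cols) (hU : ∀ x ∈ U, c x ∈ U)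
    {x : ℕ} (hx : x < 81) (h : dec x ∈ U) : ∀ b, dec (c0Pow b x) ∈ U
  | 0 => h
  | b + 1 => by
    have := hU _ (dec_c0Pow_mem hc hU hx h b)
    rwa [dec_applyCols_gcols c _ (c0Pow_lt hx b), hc] at this

/-- Such a `U` is a union of `c₀`-orbits of points without `0`. By `hQ` the images under `d` of one
orbit reach two more, so `U` contains three orbits of ten vectors each. -/
theorem thirty_le_ncard {U : Set V43} (hne : U.Nonempty) (h0 : (0 : V43) ∉ U)
    (hneg : ∀ x ∈ U, -x ∈ U) {c : GL43} (hc : gcols c = c0Cols) (hU : ∀ x ∈ U, c x ∈ U) {d : GL43}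
    (hd : ∀ x ∈ U, d x ∈ U)
    (hQ : ((List.range 8).all fun k => (List.range 5).any fun b => (List.range 5).any fun b' =>
      let w := pointReps.getD k 0
      let i := ptOrb (applyCols (gcols d) (c0Pow b w))
      let j := ptOrb (applyCols (gcols d) (c0Pow b' w))
      !(Nat.beq k i) && !(Nat.beq k j) && !(Nat.beq i j)) = true) : 30 ≤ U.ncard := by
  have hnz : ∀ n, dec n ∈ U → n < 81 → n ≠ 0 := by
    rintro n hn h81 rfl
    apply h0
    convert hn using 1
    decide
  have horb : ∀ m, dec m ∈ U → m < 81 → ∀ n < 81, n ≠ 0 → ptOrb n = ptOrb m → dec n ∈ U := by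
    intro m hm hm81 n hn hn0 hnm
    have key := exists_c0Pow
    simp only [List.all_eq_true, List.mem_range] at key
    have key := key m hm81 n hn
    simp only [Bool.or_eq_true, Nat.beq_eq, hnz m hm hm81, hn0, hnm, Nat.beq_refl,
      Bool.not_true, Bool.false_eq_true, false_or, List.any_eq_true] at key
    obtain ⟨b, -, rfl | rfl⟩ := key
    · exact dec_c0Pow_mem hc hU hm81 hm b
    · have := hneg _ (dec_c0Pow_mem hc hU hm81 hm b)
      rwa [← dec_enc (-_), enc_neg, enc_dec (c0Pow_lt hm81 b)] at this
  obtain ⟨x, hx⟩ := hne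
  have hx' : dec (enc x) ∈ U := by rwa [dec_enc]
  have hk := ptOrb_lt _ (enc_lt x) (hnz _ hx' (enc_lt x))
  set k := ptOrb (enc x) with hkdef
  obtain ⟨hw, hw81, hw0⟩ := ptOrb_rep k hk
  have hwU := horb _ hx' (enc_lt x) _ hw81 hw0 hw
  simp only [List.all_eq_true, List.mem_range, List.any_eq_true] at hQ
  obtain ⟨b, -, b', -, h⟩ := hQ k hk
  simp only [Bool.and_eq_true, Bool.not_eq_true', ← Bool.not_eq_true, Nat.beq_eq] at h
  obtain ⟨⟨hki, hkj⟩, hij⟩ := h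
  have himg : ∀ b, dec (applyCols (gcols d) (c0Pow b (pointReps.getD k 0))) ∈ U := by
    intro b
    rw [← dec_applyCols_gcols d _ (c0Pow_lt hw81 b)]
    exact hd _ (dec_c0Pow_mem hc hU hw81 hwU b)
  have hi := himg b
  have hj := himg b'
  set i' := applyCols (gcols d) (c0Pow b (pointReps.getD k 0))
  set j' := applyCols (gcols d) (c0Pow b' (pointReps.getD k 0))
  have hi81 : i' < 81 := applyCols_lt _ _
  have hj81 : j' < 81 := applyCols_lt _ _
  have hi8 := ptOrb_lt _ hi81 (hnz _ hi hi81)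
  have hj8 := ptOrb_lt _ hj81 (hnz _ hj hj81)
  have key := card_three_orbits
  simp only [List.all_eq_true, List.mem_range] at key
  have key := key _ hi8 _ hj8 _ hk
  simp only [Bool.or_eq_true, Nat.beq_eq, hki, hkj, hij, false_or] at key
  have hcard : ((Finset.range 81).filter fun n => (Nat.beq (ptOrb n) k || Nat.beq (ptOrb n) (ptOrb i')
      || Nat.beq (ptOrb n) (ptOrb j')) = true).card = 30 := by
    rw [← key, List.countP_eq_length_filter]
    change (List.filter (fun n => decide (_ = true)) (List.range 81)).length = _
    simp only [Bool.decide_eq_true]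
  rw [← hcard, ← Finset.card_image_of_injOn (f := dec), ← Set.ncard_coe_finset]
  · refine Set.ncard_le_ncard ?_ (Set.toFinite U)
    intro y hy
    obtain ⟨n, hn, rfl⟩ := Finset.mem_image.1 hy
    rw [Finset.mem_filter, Finset.mem_range] at hn
    simp only [Bool.or_eq_true, Nat.beq_eq] at hn
    have hn0 : n ≠ 0 := by
      rintro rfl
      -- The zero vector carries the dummy index 8, while the three orbit indices are below 8.
      have h8 : ptOrb 0 = 8 := rfl
      rw [h8] at hn
      omega
    rcases hn with ⟨hn, (h | h) | h⟩
    · exact horb _ hx' (enc_lt x) n hn hn0 h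
    · exact horb _ hi hi81 n hn hn0 h
    · exact horb _ hj hj81 n hn hn0 h
  · intro m hm n hn e
    have hm' := (Finset.mem_filter.1 (Finset.mem_coe.1 hm)).1
    have hn' := (Finset.mem_filter.1 (Finset.mem_coe.1 hn)).1
    rw [Finset.mem_range] at hm' hn'
    rw [← enc_dec hm', e, enc_dec hn']

/-! ### Elements of the normalizer as signed permutations of the involutions. -/

theorem orderThreeAll_apply {Q : Cols → Bool} (hQ : orderThreeAll Q = true) {a b c d e v : ℕ}
    (ha : a < 10) (hb : b < 10) (hc : c < 10) (hd : d < 10) (he : e < 10)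
    (hab : a / 2 ≠ b / 2) (hac : a / 2 ≠ c / 2) (had : a / 2 ≠ d / 2) (hae : a / 2 ≠ e / 2)
    (hbc : b / 2 ≠ c / 2) (hbd : b / 2 ≠ d / 2) (hbe : b / 2 ≠ e / 2) (hcd : c / 2 ≠ d / 2)
    (hce : c / 2 ≠ e / 2) (hde : d / 2 ≠ e / 2)
    (h3 : ∀ x ∈ [0, 2, 4, 6, 8], signedAct [a, b, c, d, e] (signedAct [a, b, c, d, e]
      (signedAct [a, b, c, d, e] x)) = x)
    (hv : v < 81) (hv0 : v ≠ 0) (h1 : applyCols (signedCol a) v = v)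
    (h4 : applyCols (signedCol d) v =
      addCode (applyCols (signedCol b) v) (applyCols (signedCol c) v)) :
    Q (frameCols (signedCol b) (signedCol c) v) = true := by
  simp only [orderThreeAll, List.all_eq_true, List.mem_range, Bool.or_eq_true, Nat.beq_eq] at hQ
  have := hQ a ha b hb
  simp only [hab, false_or] at this
  have := this c hc
  simp only [hac, hbc, false_or] at this
  have := this d hd
  simp only [had, hbd, hcd, false_or] at this
  have := this e he
  simp only [hae, hbe, hce, hde, false_or, Bool.not_eq_true', ← Bool.not_eq_true,
    List.all_eq_true, Nat.beq_eq] at this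
  have := (this.resolve_left (not_not_intro h3)) v hv
  simpa only [hv0, h1, h4, not_true, false_or] using this

theorem signedCol_inj : ∀ x < 10, ∀ y < 10, signedCol x = signedCol y → x = y := by
  decide +kernel

theorem signedCol_neg : ∀ x < 10, Nat.xor x 1 < 10 ∧
    mulCols (2, 6, 18, 54) (signedCol x) = signedCol (Nat.xor x 1) := by
  decide +kernel

theorem neg_mul_comm (g : GL43) : LinearEquiv.neg (ZMod 3) * g = g * LinearEquiv.neg (ZMod 3) := by
  ext1 x
  exact (map_neg g x).symm

section conjugation

variable {s : ℕ → GL43} {d : GL43} {f : ℕ → ℕ}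

theorem signed_eq_of_eq (hs : ∀ x < 10, gcols (s x) = signedCol x) :
    ∀ x < 10, ∀ y < 10, s x = s y → x = y := fun x hx y hy h =>
  signedCol_inj x hx y hy (by rw [← hs x hx, ← hs y hy, h])

theorem signed_xor (hs : ∀ x < 10, gcols (s x) = signedCol x) :
    ∀ x < 10, s (Nat.xor x 1) = LinearEquiv.neg (ZMod 3) * s x := by
  intro x hx
  apply gcols_injective
  rw [gcols_mul, gcols_neg_one, hs x hx, (signedCol_neg x hx).2, hs _ (signedCol_neg x hx).1]

theorem signed_perm_inj (hs : ∀ x < 10, gcols (s x) = signedCol x)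
    (hdf : ∀ x < 10, d * s x = s (f x) * d) : ∀ x < 10, ∀ y < 10, f x = f y → x = y :=
  fun x hx y hy h => signed_eq_of_eq hs x hx y hy
    (mul_left_cancel (a := d) (by rw [hdf x hx, hdf y hy, h]))

/-- Labels `2k` and `2k + 1` stand for an involution and its negative, so `Nat.xor x 1` is a change
of sign; it commutes with conjugation because `-1` is central. -/
theorem signed_perm_xor (hs : ∀ x < 10, gcols (s x) = signedCol x) (hf : ∀ x < 10, f x < 10)
    (hdf : ∀ x < 10, d * s x = s (f x) * d) : ∀ x < 10, f (Nat.xor x 1) = Nat.xor (f x) 1 := by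
  intro x hx
  have hx1 := (signedCol_neg x hx).1
  refine signed_eq_of_eq hs _ (hf _ hx1) _ (signedCol_neg _ (hf x hx)).1
    (mul_right_cancel (b := d) ?_)
  rw [← hdf _ hx1, signed_xor hs x hx, signed_xor hs _ (hf x hx), ← mul_assoc, ← neg_mul_comm,
    mul_assoc, hdf x hx, mul_assoc]

theorem signed_perm_act (hs : ∀ x < 10, gcols (s x) = signedCol x) (hf : ∀ x < 10, f x < 10)
    (hdf : ∀ x < 10, d * s x = s (f x) * d) :
    ∀ x < 10, signedAct [f 0, f 2, f 4, f 6, f 8] x = f x := by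
  intro x hx
  have hfneg := signed_perm_xor hs hf hdf
  interval_cases x
  · exact Nat.xor_zero _
  · exact (hfneg 0 (by norm_num)).symm
  · exact Nat.xor_zero _
  · exact (hfneg 2 (by norm_num)).symm
  · exact Nat.xor_zero _
  · exact (hfneg 4 (by norm_num)).symm
  · exact Nat.xor_zero _
  · exact (hfneg 6 (by norm_num)).symm
  · exact Nat.xor_zero _
  · exact (hfneg 8 (by norm_num)).symm

theorem signed_perm_iterate (hf : ∀ x < 10, f x < 10) (hdf : ∀ x < 10, d * s x = s (f x) * d)
    (n : ℕ) : ∀ x < 10, f^[n] x < 10 ∧ d ^ n * s x = s (f^[n] x) * d ^ n := by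
  induction n with
  | zero => exact fun x hx => ⟨hx, by rw [pow_zero, one_mul, mul_one]; rfl⟩
  | succ n ih =>
    intro x hx
    obtain ⟨h1, h2⟩ := ih x hx
    rw [Function.iterate_succ_apply']
    exact ⟨hf _ h1, by rw [pow_succ', mul_assoc, h2, ← mul_assoc, hdf _ h1, mul_assoc]⟩

theorem signed_perm_periodic (hs : ∀ x < 10, gcols (s x) = signedCol x) (hf : ∀ x < 10, f x < 10)
    (hdf : ∀ x < 10, d * s x = s (f x) * d) {n : ℕ} (hd : d ^ n = 1) : ∀ x < 10, f^[n] x = x := by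
  intro x hx
  obtain ⟨h1, h2⟩ := signed_perm_iterate hf hdf n x hx
  rw [hd, one_mul, mul_one] at h2
  exact (signed_eq_of_eq hs _ hx _ h1 h2).symm

/-- A bijection that respects signs induces a bijection on the five pairs `± S`. -/
theorem signed_perm_div (hs : ∀ x < 10, gcols (s x) = signedCol x) (hf : ∀ x < 10, f x < 10)
    (hdf : ∀ x < 10, d * s x = s (f x) * d) :
    ∀ x < 10, ∀ y < 10, x / 2 ≠ y / 2 → f x / 2 ≠ f y / 2 := by
  intro x hx y hy hxy h
  have hxor : ∀ a < 10, ∀ b < 10, a / 2 = b / 2 → b = a ∨ b = Nat.xor a 1 := by decide +kernel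
  have hxor' : ∀ a < 10, Nat.xor a 1 / 2 = a / 2 := by decide +kernel
  rcases hxor _ (hf x hx) _ (hf y hy) h with h | h
  · exact hxy (by rw [signed_perm_inj hs hdf _ hy _ hx h])
  · rw [← signed_perm_xor hs hf hdf x hx] at h
    exact hxy (by rw [signed_perm_inj hs hdf _ hy _ (signedCol_neg x hx).1 h, hxor' x hx])

/-- A linear map is determined by the conjugates of four standard involutions and the image of one
vector. -/
theorem gcols_eq_frameCols (hs : ∀ x < 10, gcols (s x) = signedCol x) {a b c e : ℕ} (ha : a < 10)
    (hb : b < 10) (hc : c < 10) (he : e < 10) (h0 : d * s 0 = s a * d) (h2 : d * s 2 = s b * d)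
    (h4 : d * s 4 = s c * d) (h6 : d * s 6 = s e * d) :
    ∃ v < 81, v ≠ 0 ∧ applyCols (signedCol a) v = v ∧ applyCols (signedCol e) v =
      addCode (applyCols (signedCol b) v) (applyCols (signedCol c) v) ∧
      gcols d = frameCols (signedCol b) (signedCol c) v := by
  have hv : ∀ {x y : ℕ}, d * s x = s y * d → x < 10 → y < 10 → ∀ n < 81,
      applyCols (signedCol y) (enc (d (dec n))) = enc (d (dec (applyCols (signedCol x) n))) := by
    intro x y h hx hy n hn
    rw [← hs y hy, ← enc_gmap, ← hs x hx, ← dec_applyCols_gcols _ _ hn]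
    exact congrArg enc (congrArg (fun g : GL43 => g (dec n)) h).symm
  -- The vector `v` is `d e₀`. The constraints on it are the images under `d` of `S₁ e₀ = e₀` and
  -- `S₄ e₀ = S₂ e₀ + S₃ e₀`.
  refine ⟨enc (d (dec 1)), enc_lt _, ?_, hv h0 (by norm_num) ha 1 (by norm_num), ?_, ?_⟩
  · rw [enc_eq_zero.ne, map_ne_zero_iff _ d.injective]
    decide
  · rw [hv h2 (by norm_num) hb 1 (by norm_num), hv h4 (by norm_num) hc 1 (by norm_num),
      hv h6 (by norm_num) he 1 (by norm_num), ← enc_add, ← map_add, ← dec_addCode]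
    rfl
  · rw [frameCols, hv h2 (by norm_num) hb 1 (by norm_num), hv h4 (by norm_num) hc 1 (by norm_num)]
    -- The basis is `e₀`, `e₁ = S₂ S₃ e₀`, `e₂ = S₂ e₀`, `e₃ = S₃ e₀`, so conjugation data and `d
    -- e₀` give all columns.
    rw [show applyCols (signedCol 4) 1 = 27 from rfl, hv h2 (by norm_num) hb 27 (by norm_num)]
    rfl

/-- From `d ^ 3 = 1` the signed permutation has trivial cube, so `d` occurs among the enumerated
candidates. -/
theorem orderThreeAll_gcols {Q : Cols → Bool} (hQ : orderThreeAll Q = true)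
    (hs : ∀ x < 10, gcols (s x) = signedCol x) (hf : ∀ x < 10, f x < 10)
    (hdf : ∀ x < 10, d * s x = s (f x) * d) (hd3 : d ^ 3 = 1) : Q (gcols d) = true := by
  have hact := signed_perm_act hs hf hdf
  have hdist := signed_perm_div hs hf hdf
  have h10 : ∀ x ∈ [0, 2, 4, 6, 8], x < 10 := by decide
  obtain ⟨v, hv, hv0, hv1, hv4, e⟩ := gcols_eq_frameCols hs (hf 0 (by norm_num))
    (hf 2 (by norm_num)) (hf 4 (by norm_num)) (hf 6 (by norm_num)) (hdf 0 (by norm_num))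
    (hdf 2 (by norm_num)) (hdf 4 (by norm_num)) (hdf 6 (by norm_num))
  rw [e]
  refine orderThreeAll_apply hQ (a := f 0) (b := f 2) (c := f 4) (d := f 6) (e := f 8)
    (hf _ ?_) (hf _ ?_) (hf _ ?_) (hf _ ?_) (hf _ ?_) (hdist _ ?_ _ ?_ ?_) (hdist _ ?_ _ ?_ ?_)
    (hdist _ ?_ _ ?_ ?_) (hdist _ ?_ _ ?_ ?_) (hdist _ ?_ _ ?_ ?_) (hdist _ ?_ _ ?_ ?_)
    (hdist _ ?_ _ ?_ ?_) (hdist _ ?_ _ ?_ ?_) (hdist _ ?_ _ ?_ ?_) (hdist _ ?_ _ ?_ ?_)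
    (fun x hx => ?_) hv hv0 hv1 hv4
  case refine_36 =>
    rw [hact x (h10 x hx), hact _ (hf x (h10 x hx)), hact _ (hf _ (hf x (h10 x hx)))]
    exact signed_perm_periodic hs hf hdf hd3 x (h10 x hx)
  all_goals decide

end conjugation

/-! ### Identification of the two remaining line sets with the example. -/

theorem submodule_map_mul (g h : GL43) (W : Submodule (ZMod 3) V43) :
    W.map ((g * h : GL43) : V43 →ₗ[ZMod 3] V43) =
      (W.map (h : V43 →ₗ[ZMod 3] V43)).map (g : V43 →ₗ[ZMod 3] V43) :=
  Submodule.map_comp _ _ _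

theorem submodule_map_one (W : Submodule (ZMod 3) V43) :
    W.map ((1 : GL43) : V43 →ₗ[ZMod 3] V43) = W :=
  Submodule.map_id _

theorem finrank_map (g : GL43) (W : Submodule (ZMod 3) V43) :
    Module.finrank (ZMod 3) (W.map (g : V43 →ₗ[ZMod 3] V43)) = Module.finrank (ZMod 3) W :=
  LinearEquiv.finrank_map_eq g W

/-- The map with columns `m` sends the line `(o, b)` to the line `(o', b')`. -/
def lineMap (m : Cols) (o b o' b' : ℕ) : Bool :=
  inMask (lineMask o' b') (applyCols m (pairFst o b)) &&
    inMask (lineMask o' b') (applyCols m (pairSnd o b))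

/-- It is enough that two spanning vectors land in the target: their images stay independent and
both sides have dimension 2. -/
theorem map_eq_of_lineMap {g : GL43} {o b o' b' : ℕ} (ho : o < 26) (hb : b < 5) (ho' : o' < 26)
    (hb' : b' < 5) (h : lineMap (gcols g) o b o' b' = true) :
    (lineSpan o b).map (g : V43 →ₗ[ZMod 3] V43) = lineSpan o' b' := by
  obtain ⟨-, -, k1, k2⟩ := lineMask_eq o ho b hb
  rw [lineMap, Bool.and_eq_true, inMask_lineMask' ho' hb' (applyCols_lt _ _),
    inMask_lineMask' ho' hb' (applyCols_lt _ _), ← dec_applyCols_gcols g _ k1,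
    ← dec_applyCols_gcols g _ k2] at h
  have hi := (linearIndependent_pair ho hb).map' (g : V43 →ₗ[ZMod 3] V43) g.ker
  have e : (g : V43 →ₗ[ZMod 3] V43) ∘ ![dec (pairFst o b), dec (pairSnd o b)] =
      ![g (dec (pairFst o b)), g (dec (pairSnd o b))] := by
    funext i
    fin_cases i <;> rfl
  rw [e] at hi
  rw [eq_span_pair (finrank_lineSpan ho' hb') h.1 h.2 hi]
  refine eq_span_pair ?_ ?_ ?_ hi
  · rw [finrank_map, finrank_lineSpan ho hb]
  · exact Submodule.mem_map_of_mem (pairFst_mem o b)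
  · exact Submodule.mem_map_of_mem (pairSnd_mem o b)

/-- The union of the orbits of lines with indices in `s`. -/
def lineUnion (s : List ℕ) : Set (Submodule (ZMod 3) V43) :=
  {W | ∃ o ∈ s, ∃ b < 5, W = lineSpan o b}

theorem gcols_exAlpha : gcols exAlpha = (54, 38, 62, 1) := by
  have h := fun x => (exAlpha_exBeta_apply x).1
  change (enc (exAlpha _), enc (exAlpha _), enc (exAlpha _), enc (exAlpha _)) = _
  simp only [h]
  decide

theorem gcols_exBeta : gcols exBeta = (4, 3, 36, 27) := by
  have h := fun x => (exAlpha_exBeta_apply x).2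
  change (enc (exBeta _), enc (exBeta _), enc (exBeta _), enc (exBeta _)) = _
  simp only [h]
  decide

/-- The base block as a subspace. -/
def baseSpan : Submodule (ZMod 3) V43 := Submodule.span (ZMod 3) {![1, 0, 0, 0], ![0, 0, 0, 1]}

theorem baseSpan_eq : baseSpan = Submodule.span (ZMod 3) {dec 1, dec 27} := by
  have h : dec 1 = ![1, 0, 0, 0] ∧ dec 27 = ![0, 0, 0, 1] := by decide
  rw [baseSpan, h.1, h.2]

/-- The columns of a conjugate of `α`. -/
def aCols : Cols := (43, 15, 12, 79)

/-- The columns of a conjugate of `β`. -/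
def bCols : Cols := (7, 3, 54, 63)

/-- A certificate that `lineUnion s` is mapped by the matrix `E` to the orbit of the base block. -/
def isoCheck (s : List ℕ) (E E' : Cols) (o₁ b₁ : ℕ) : Bool :=
  mulCols E E' == (1, 3, 9, 27) && mulCols E' E == (1, 3, 9, 27) &&
  mulCols E (1, 3, 9, 27) == E && mulCols E' (1, 3, 9, 27) == E' &&
  mulCols E' (mulCols (54, 38, 62, 1) E) == aCols && mulCols E' (mulCols (4, 3, 36, 27) E) == bCols &&
  s.contains o₁ && Nat.blt b₁ 5 && s.all (fun o => Nat.blt o 26) &&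
  inMask (lineMask o₁ b₁) (applyCols E' 1) && inMask (lineMask o₁ b₁) (applyCols E' 27) &&
  ([aCols, mulCols aCols (mulCols aCols aCols), bCols, mulCols bCols bCols].all fun m =>
    s.all fun o => (List.range 5).all fun b => s.any fun o' => (List.range 5).any fun b' =>
      lineMap m o b o' b')

/-- Every orbit in the list after the first is reached from an earlier one by a conjugate of `α` or
`β`. -/
def reachCheck : List ℕ → List ℕ → Bool
  | _, [] => true
  | known, o' :: t => ([aCols, bCols].any fun m => known.any fun o => (List.range 5).any fun b =>
      (List.range 5).any fun b' => lineMap m o b o' b') && reachCheck (o' :: known) t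

/-- Invariance under `c` makes membership in `T` a property of whole orbits; `a` and `b` then
propagate it from one orbit to the next along the list. -/
theorem mem_of_reachCheck {T : Set (Submodule (ZMod 3) V43)} {c a b : GL43} (hc : gcols c = c0Cols)
    (ha : gcols a = aCols) (hb : gcols b = bCols)
    (hTc : ∀ W ∈ T, W.map (c : V43 →ₗ[ZMod 3] V43) ∈ T)
    (hTa : ∀ W ∈ T, W.map (a : V43 →ₗ[ZMod 3] V43) ∈ T)
    (hTb : ∀ W ∈ T, W.map (b : V43 →ₗ[ZMod 3] V43) ∈ T) {l : List ℕ} (hl : ∀ o ∈ l, o < 26) :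
    ∀ {known : List ℕ}, (∀ o ∈ known, o < 26 ∧ lineSpan o 0 ∈ T) → reachCheck known l = true →
      ∀ o ∈ l, lineSpan o 0 ∈ T := by
  induction l with
  | nil => exact fun _ _ o ho => absurd ho List.not_mem_nil
  | cons o' t ih =>
    intro known hk h
    have ho' := hl o' List.mem_cons_self
    rw [reachCheck, Bool.and_eq_true] at h
    obtain ⟨h, ht⟩ := h
    simp only [List.any_eq_true, List.mem_range] at h
    obtain ⟨m, hm, o, ho, i, hi, j, hj, h⟩ := h
    have hmem : lineSpan o i ∈ T := (lineSpan_mem_iff hc hTc (hk o ho).1 hi).2 (hk o ho).2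
    have hnew : lineSpan o' 0 ∈ T := by
      rw [← lineSpan_mem_iff hc hTc ho' hj]
      rcases List.mem_cons.1 hm with rfl | hm
      · rw [← ha] at h
        rw [← map_eq_of_lineMap (hk o ho).1 hi ho' hj h]
        exact hTa _ hmem
      · obtain rfl := List.mem_singleton.1 hm
        rw [← hb] at h
        rw [← map_eq_of_lineMap (hk o ho).1 hi ho' hj h]
        exact hTb _ hmem
    intro q hq
    rcases List.mem_cons.1 hq with rfl | hq
    · exact hnew
    · refine ih (fun o h => hl o (List.mem_cons_of_mem _ h)) (known := o' :: known) ?_ ht q hq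
      intro p hp
      rcases List.mem_cons.1 hp with rfl | hp
      · exact ⟨ho', hnew⟩
      · exact hk p hp

theorem cols_ofCols {E : Cols} (hE : mulCols E (1, 3, 9, 27) = E) : cols (ofCols E) = E := by
  conv_rhs => rw [← hE]
  simp only [cols, enc_ofCols]
  rfl

/-- The linear equivalence with given columns and inverse columns. -/
def equivOfCols (E E' : Cols) (h : mulCols E E' = (1, 3, 9, 27)) (h' : mulCols E' E = (1, 3, 9, 27))
    (hE : mulCols E (1, 3, 9, 27) = E) (hE' : mulCols E' (1, 3, 9, 27) = E') : GL43 :=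
  LinearEquiv.ofLinearMap (ofCols E) (ofCols E')
    (cols_injective (by rw [cols_comp, cols_ofCols hE, cols_ofCols hE', h]; exact gcols_one.symm))
    (cols_injective (by rw [cols_comp, cols_ofCols hE, cols_ofCols hE', h']; exact gcols_one.symm))

/-- Conjugation by `e` turns `α`, `β` into the matrices `aCols`, `bCols`. The union `lineUnion s` is
invariant under them, contains the preimage of the base block, and is generated from it, so it is
one orbit of `e⁻¹ H₀ e`. -/
theorem exists_map_eq {s : List ℕ} {E E' : Cols} {o₁ b₁ : ℕ} (h : isoCheck s E E' o₁ b₁ = true)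
    (hr : reachCheck [o₁] s = true) :
    ∃ e : GL43, ∀ W : Submodule (ZMod 3) V43, W ∈ lineUnion s ↔
      ∃ g ∈ exGroup, W.map (e : V43 →ₗ[ZMod 3] V43) = baseSpan.map (g : V43 →ₗ[ZMod 3] V43) := by
  simp only [isoCheck, Bool.and_eq_true, beq_iff_eq, List.contains_iff_mem,
    List.all_eq_true, List.any_eq_true, List.mem_range, Nat.blt_eq] at h
  obtain ⟨⟨⟨⟨⟨⟨⟨⟨⟨⟨⟨h1, h2⟩, h3⟩, h4⟩, h5⟩, h6⟩, h7⟩, h8⟩, h9⟩, h10⟩, h11⟩, h12⟩ := h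
  set e : GL43 := equivOfCols E E' h1 h2 h3 h4 with he
  have hcE : gcols e = E := cols_ofCols h3
  have hcE' : gcols e⁻¹ = E' := cols_ofCols h4
  have hA : gcols (e⁻¹ * (exAlpha * e)) = aCols := by
    rw [gcols_mul, gcols_mul, hcE, hcE', gcols_exAlpha, h5]
  have hB : gcols (e⁻¹ * (exBeta * e)) = bCols := by
    rw [gcols_mul, gcols_mul, hcE, hcE', gcols_exBeta, h6]
  obtain ⟨A, hAdef⟩ : ∃ A, A = e⁻¹ * (exAlpha * e) := ⟨_, rfl⟩
  obtain ⟨B, hBdef⟩ : ∃ B, B = e⁻¹ * (exBeta * e) := ⟨_, rfl⟩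
  rw [← hAdef] at hA
  rw [← hBdef] at hB
  have ho₁ := h9 o₁ h7
  have hbase : baseSpan.map ((e⁻¹ : GL43) : V43 →ₗ[ZMod 3] V43) = lineSpan o₁ b₁ := by
    have hi : LinearIndependent (ZMod 3) ![dec (applyCols E' 1), dec (applyCols E' 27)] := by
      have h0 : LinearIndependent (ZMod 3) ![dec 1, dec 27] := (indepCodes_iff _ _).1 (by decide)
      have := h0.map' ((e⁻¹ : GL43) : V43 →ₗ[ZMod 3] V43) (e⁻¹ : GL43).ker
      have e' : ((e⁻¹ : GL43) : V43 →ₗ[ZMod 3] V43) ∘ ![dec 1, dec 27] =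
          ![dec (applyCols E' 1), dec (applyCols E' 27)] := by
        rw [← hcE', ← dec_applyCols_gcols _ 1 (by norm_num), ← dec_applyCols_gcols _ 27 (by norm_num)]
        funext i
        fin_cases i <;> rfl
      rwa [e'] at this
    rw [inMask_lineMask' ho₁ h8 (applyCols_lt _ _)] at h10 h11
    rw [eq_span_pair (finrank_lineSpan ho₁ h8) h10 h11 hi, baseSpan_eq, Submodule.map_span,
      Set.image_pair, ← hcE', ← dec_applyCols_gcols _ 1 (by norm_num),
      ← dec_applyCols_gcols _ 27 (by norm_num)]
    rfl
  refine ⟨e, fun W => ⟨?_, ?_⟩⟩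
  · let T : Set (Submodule (ZMod 3) V43) := {W | ∃ g ∈ exGroup,
      W.map (e : V43 →ₗ[ZMod 3] V43) = baseSpan.map (g : V43 →ₗ[ZMod 3] V43)}
    have hT : ∀ x ∈ exGroup, ∀ W ∈ T,
        W.map ((e⁻¹ * (x * e) : GL43) : V43 →ₗ[ZMod 3] V43) ∈ T := by
      rintro x hx W ⟨g, hg, hW⟩
      refine ⟨x * g, mul_mem hx hg, ?_⟩
      rw [← submodule_map_mul, mul_inv_cancel_left, submodule_map_mul, hW, ← submodule_map_mul]
    have hα : exAlpha ∈ exGroup := Subgroup.subset_closure (Or.inl rfl)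
    have hβ : exBeta ∈ exGroup := Subgroup.subset_closure (Or.inr rfl)
    -- The conjugate of `(α β) ^ 3` is `c₀`, so `T` is a union of `c₀`-orbits and only one line per
    -- orbit has to be reached.
    have hc : gcols (e⁻¹ * ((exAlpha * exBeta * (exAlpha * exBeta * (exAlpha * exBeta))) * e)) =
        c0Cols := by
      have : e⁻¹ * ((exAlpha * exBeta * (exAlpha * exBeta * (exAlpha * exBeta))) * e) =
          A * B * (A * B * (A * B)) := by
        rw [hAdef, hBdef]
        group
      rw [this]
      simp only [gcols_mul, hA, hB]
      decide
    have hTc := hT _ (mul_mem (mul_mem hα hβ) (mul_mem (mul_mem hα hβ) (mul_mem hα hβ)))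
    have hb₁ : lineSpan o₁ b₁ ∈ T := by
      refine ⟨1, one_mem _, ?_⟩
      rw [← hbase, ← submodule_map_mul, mul_inv_cancel]
    have h0 : lineSpan o₁ 0 ∈ T := (lineSpan_mem_iff hc hTc ho₁ h8).1 hb₁
    rintro ⟨o, ho, b, hb, rfl⟩
    have := mem_of_reachCheck hc hA hB hTc (hAdef ▸ hT _ hα) (hBdef ▸ hT _ hβ) h9 (known := [o₁]) (by
      intro o ho
      obtain rfl := List.mem_singleton.1 ho
      exact ⟨ho₁, h0⟩) hr o ho
    exact (lineSpan_mem_iff hc hTc (h9 o ho) hb).2 this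
  · rintro ⟨g, hg, hW⟩
    have hgen : ∀ m ∈ [aCols, mulCols aCols (mulCols aCols aCols), bCols, mulCols bCols bCols],
        ∀ x : GL43, gcols (e⁻¹ * (x * e)) = m → ∀ W ∈ lineUnion s,
          W.map ((e⁻¹ * (x * e) : GL43) : V43 →ₗ[ZMod 3] V43) ∈ lineUnion s := by
      rintro m hm x rfl W ⟨o, ho, b, hb, rfl⟩
      obtain ⟨o', ho', b', hb', h⟩ := h12 _ hm o ho b hb
      exact ⟨o', ho', b', hb', map_eq_of_lineMap (h9 o ho) hb (h9 o' ho') hb' h⟩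
    -- `α` has order 4 and `β` order 3, so the inverses are the positive powers included in the
    -- certificate.
    have hinvα : exAlpha⁻¹ = exAlpha * (exAlpha * exAlpha) := by
      rw [inv_eq_iff_mul_eq_one]
      apply gcols_injective
      simp only [gcols_mul, gcols_exAlpha, gcols_one]
      decide
    have hinvβ : exBeta⁻¹ = exBeta * exBeta := by
      rw [inv_eq_iff_mul_eq_one]
      apply gcols_injective
      simp only [gcols_mul, gcols_exBeta, gcols_one]
      decide
    have key : ∀ W ∈ lineUnion s, W.map ((e⁻¹ * (g * e) : GL43) : V43 →ₗ[ZMod 3] V43) ∈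
        lineUnion s := by
      clear hW
      induction hg using Subgroup.closure_induction'' with
      | mem x hx =>
        rcases hx with rfl | rfl
        · exact hgen aCols (by simp) _ (by rw [← hAdef, hA])
        · exact hgen bCols (by simp) _ (by rw [← hBdef, hB])
      | inv_mem x hx =>
        rcases hx with rfl | rfl
        · refine hgen (mulCols aCols (mulCols aCols aCols)) (by simp) _ ?_
          have : e⁻¹ * (exAlpha⁻¹ * e) = A * (A * A) := by
            rw [hinvα, hAdef]
            group
          rw [this, gcols_mul, gcols_mul, hA]
        · refine hgen (mulCols bCols bCols) (by simp) _ ?_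
          have : e⁻¹ * (exBeta⁻¹ * e) = B * B := by
            rw [hinvβ, hBdef]
            group
          rw [this, gcols_mul, hB]
      | one =>
        intro W hW
        rwa [one_mul, inv_mul_cancel, submodule_map_one]
      | mul x y _ _ hx hy =>
        intro W hW
        have : e⁻¹ * (x * y * e) = e⁻¹ * (x * e) * (e⁻¹ * (y * e)) := by group
        rw [this, submodule_map_mul]
        exact hx _ (hy _ hW)
    have hfin := key _ ⟨o₁, h7, b₁, h8, rfl⟩
    rw [← hbase, ← submodule_map_mul, mul_assoc, mul_assoc, mul_inv_cancel, mul_one,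
      submodule_map_mul, ← hW, ← submodule_map_mul,
      inv_mul_cancel, submodule_map_one] at hfin
    exact hfin

theorem exists_map_eq_of_mem_goodSols {s : List ℕ} (hs : s ∈ goodSols) :
    ∃ e : GL43, ∀ W : Submodule (ZMod 3) V43, W ∈ lineUnion s ↔
      ∃ g ∈ exGroup, W.map (e : V43 →ₗ[ZMod 3] V43) = baseSpan.map (g : V43 →ₗ[ZMod 3] V43) := by
  rcases List.mem_cons.1 hs with rfl | hs
  -- The orbits are reordered so that the first contains the preimage of the base block and each
  -- later one is reached from an earlier one.
  · obtain ⟨e, he⟩ := exists_map_eq (s := [4, 17, 9, 19, 11, 14]) (E := (41, 57, 13, 77))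
      (E' := (70, 42, 26, 39)) (o₁ := 4) (b₁ := 4) (by decide +kernel) (by decide +kernel)
    refine ⟨e, fun W => Iff.trans ?_ (he W)⟩
    have hp : [19, 17, 11, 14, 4, 9].Perm [4, 17, 9, 19, 11, 14] := by decide
    simp only [lineUnion, Set.mem_ofPred_eq, hp.mem_iff]
  · obtain rfl := List.mem_singleton.1 hs
    obtain ⟨e, he⟩ := exists_map_eq (s := [13, 6, 10, 18, 23, 8]) (E := (13, 60, 51, 12))
      (E' := (55, 78, 66, 36)) (o₁ := 13) (b₁ := 1) (by decide +kernel) (by decide +kernel)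
    refine ⟨e, fun W => Iff.trans ?_ (he W)⟩
    have hp : [23, 18, 13, 8, 10, 6].Perm [13, 6, 10, 18, 23, 8] := by decide
    simp only [lineUnion, Set.mem_ofPred_eq, hp.mem_iff]

/-! ### Translation stabilizers of blocks. -/

/-- A block set on `V` that is invariant under translations and under `G₀ ≤ GL(V)`, such that `G₀`
is transitive on the blocks through `0`, with blocks of size `9`, three on any two points. -/
structure IsLinearFlagDesign (𝓑 : Set (Set V43)) (G₀ : Subgroup GL43) : Prop where
  trans_mem : ∀ B ∈ 𝓑, ∀ w : V43, (fun x => x + w) '' B ∈ 𝓑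
  map_mem : ∀ g ∈ G₀, ∀ B ∈ 𝓑, g '' B ∈ 𝓑
  flag : ∀ B ∈ 𝓑, ∀ C ∈ 𝓑, 0 ∈ B → 0 ∈ C → ∃ g ∈ G₀, g '' B = C
  card_block : ∀ B ∈ 𝓑, B.ncard = 9
  card_pair : ∀ x y : V43, x ≠ y → {B ∈ 𝓑 | x ∈ B ∧ y ∈ B}.ncard = 3

/-- The maps of this shape already form a group containing both generating subgroups. -/
theorem exists_of_mem_affineGroup {G₀ : Subgroup GL43} {σ : Equiv.Perm V43}
    (h : σ ∈ affineGroup G₀) : ∃ g ∈ G₀, ∃ w, ∀ x, σ x = g x + w := by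
  let K : Subgroup (Equiv.Perm V43) :=
    { carrier := {σ | ∃ g ∈ G₀, ∃ w, ∀ x, σ x = g x + w}
      one_mem' := ⟨1, one_mem _, 0, fun x => (add_zero _).symm⟩
      mul_mem' := by
        rintro σ τ ⟨g, hg, w, hw⟩ ⟨k, hk, u, hu⟩
        refine ⟨g * k, mul_mem hg hk, g u + w, fun x => ?_⟩
        rw [Equiv.Perm.mul_apply, hw, hu, map_add, add_assoc]
        rfl
      inv_mem' := by
        rintro σ ⟨g, hg, w, hw⟩
        refine ⟨g⁻¹, inv_mem hg, -(g⁻¹ w), fun x => ?_⟩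
        rw [Equiv.Perm.inv_eq_iff_eq, hw, map_add, map_neg]
        have h : ∀ y, g (g⁻¹ y) = y := g.apply_symm_apply
        rw [h, h, neg_add_cancel_right] }
  have hle : affineGroup G₀ ≤ K := by
    refine sup_le ?_ ?_
    · rintro σ ⟨w, hw⟩
      exact ⟨1, one_mem _, w, hw⟩
    · rintro σ ⟨g, hg, rfl⟩
      exact ⟨g, hg, 0, fun x => (add_zero _).symm⟩
  exact hle h

theorem linToPerm_mem_affineGroup {G₀ : Subgroup GL43} {g : GL43} (hg : g ∈ G₀) :
    linToPerm g ∈ affineGroup G₀ :=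
  Subgroup.mem_sup_right (Subgroup.mem_map_of_mem _ hg)

theorem addRight_mem_affineGroup (G₀ : Subgroup GL43) (w : V43) :
    Equiv.addRight w ∈ affineGroup G₀ :=
  Subgroup.mem_sup_left ⟨w, fun _ => rfl⟩

theorem isLinearFlagDesign {𝓑 : Set (Set V43)} (h𝓑 : IsTwoDesign 𝓑 (3 ^ 4) (3 ^ 2) 3)
    {G₀ : Subgroup GL43} (hflag : IsFlagTransitive (affineGroup G₀) 𝓑) :
    IsLinearFlagDesign 𝓑 G₀ where
  trans_mem B hB w := (hflag.1 (addRight_mem_affineGroup G₀ w) B).2 hB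
  map_mem g hg B hB := (hflag.1 (linToPerm_mem_affineGroup hg) B).2 hB
  flag B hB C hC h0B h0C := by
    obtain ⟨σ, hσ, h0, hBC⟩ := hflag.2 0 0 B hB C hC h0B h0C
    obtain ⟨g, hg, w, hw⟩ := exists_of_mem_affineGroup hσ
    -- An affine map fixing `0` is linear, so flags at `0` are permuted by `G₀` itself.
    have hw0 : w = 0 := by
      rw [hw, map_zero, zero_add] at h0
      exact h0
    refine ⟨g, hg, ?_⟩
    rw [← hBC]
    refine Set.image_congr fun x _ => ?_
    rw [hw, hw0, add_zero]
  card_block := h𝓑.card_block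
  card_pair := h𝓑.card_pair

/-- The translations that fix a set of vectors. -/
def transStab (B : Set V43) : Submodule (ZMod 3) V43 where
  carrier := {w | ∀ x, x + w ∈ B ↔ x ∈ B}
  zero_mem' x := by rw [add_zero]
  add_mem' := by
    intro a b ha hb x
    rw [← add_assoc, hb, ha]
  smul_mem' := by
    intro c w hw x
    have hc : c = 0 ∨ c = 1 ∨ c = 2 := by
      revert c
      decide
    rcases hc with rfl | rfl | rfl
    · rw [zero_smul, add_zero]
    · rw [one_smul, hw]
    · rw [two_smul, ← add_assoc, hw, hw]

theorem mem_transStab {B : Set V43} {w : V43} : w ∈ transStab B ↔ ∀ x, x + w ∈ B ↔ x ∈ B :=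
  Iff.rfl

theorem mem_image_add {B : Set V43} {v x : V43} : x ∈ (fun y => y + v) '' B ↔ x - v ∈ B := by
  constructor
  · rintro ⟨y, hy, rfl⟩
    rwa [add_sub_cancel_right]
  · exact fun h => ⟨_, h, sub_add_cancel _ _⟩

theorem transStab_add (B : Set V43) (v : V43) :
    transStab ((fun x => x + v) '' B) = transStab B := by
  ext w
  simp only [mem_transStab, mem_image_add]
  constructor
  · intro h x
    have := h (x + v)
    rwa [add_sub_cancel_right, add_right_comm, add_sub_cancel_right] at this
  · intro h x
    rw [← h (x - v), sub_add_eq_add_sub]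

theorem mem_image_gl {B : Set V43} {g : GL43} {x : V43} : x ∈ g '' B ↔ g.symm x ∈ B := by
  constructor
  · rintro ⟨y, hy, rfl⟩
    rwa [g.symm_apply_apply]
  · exact fun h => ⟨_, h, g.apply_symm_apply x⟩

theorem transStab_map (B : Set V43) (g : GL43) :
    transStab (g '' B) = (transStab B).map (g : V43 →ₗ[ZMod 3] V43) := by
  ext w
  have e : w ∈ (transStab B).map (g : V43 →ₗ[ZMod 3] V43) ↔ g.symm w ∈ transStab B := by
    constructor
    · rintro ⟨y, hy, rfl⟩
      exact (g.symm_apply_apply y).symm ▸ hy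
    · exact fun h => ⟨_, h, g.apply_symm_apply w⟩
  rw [e]
  simp only [mem_transStab, mem_image_gl, map_add]
  exact ⟨fun h x => by simpa using h (g x), fun h x => h _⟩

theorem transStab_le {B : Set V43} (h0 : 0 ∈ B) {w : V43} (hw : w ∈ transStab B) : w ∈ B := by
  simpa [h0] using hw 0

/-- Moving a point `a` of `B` to `0` gives translates of `B` through `0`; this determines when two
of them coincide, and so how many there are. -/
theorem image_add_eq_iff {B : Set V43} {a b : V43} :
    (fun x => x + -a) '' B = (fun x => x + -b) '' B ↔ b - a ∈ transStab B := by
  rw [mem_transStab, Set.ext_iff]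
  simp only [mem_image_add, sub_neg_eq_add]
  constructor
  · intro h x
    have := h (x - a)
    rw [sub_add_cancel] at this
    rw [this, add_sub_assoc', sub_add_eq_add_sub]
  · intro h x
    rw [← h (x + a)]
    rw [add_assoc, add_sub_cancel]

namespace IsLinearFlagDesign

variable {𝓑 : Set (Set V43)} {G₀ : Subgroup GL43}

/-- Counting pairs of a nonzero vector and a block through `0` containing it gives `80 · 3 = r · 8`.
-/
theorem card_through_zero (h : IsLinearFlagDesign 𝓑 G₀) : {B ∈ 𝓑 | 0 ∈ B}.ncard = 30 := by
  classical
  have hfin : {B ∈ 𝓑 | (0 : V43) ∈ B}.Finite := Set.toFinite _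
  have key := Finset.sum_card_bipartiteAbove_eq_sum_card_bipartiteBelow
    (s := (Finset.univ.erase (0 : V43))) (t := hfin.toFinset) (fun x B => x ∈ B)
  have hbelow : ∀ B ∈ hfin.toFinset,
      ((Finset.univ.erase (0 : V43)).bipartiteBelow (fun x B => x ∈ B) B).card = 8 := by
    intro B hB
    have hB' : B ∈ 𝓑 ∧ 0 ∈ B := by simpa using hB
    have h9 := h.card_block B hB'.1
    rw [Set.ncard_eq_toFinset_card'] at h9
    have e : (Finset.univ.erase (0 : V43)).bipartiteBelow (fun x B => x ∈ B) B =
        B.toFinset.erase 0 := by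
      ext x
      simp [Finset.mem_bipartiteBelow]
    rw [e, Finset.card_erase_of_mem (by simpa using hB'.2), h9]
  have habove : ∀ x ∈ Finset.univ.erase (0 : V43),
      (hfin.toFinset.bipartiteAbove (fun x B => x ∈ B) x).card = 3 := by
    intro x hx
    have e : (hfin.toFinset.bipartiteAbove (fun x B => x ∈ B) x : Set (Set V43)) =
        {B ∈ 𝓑 | 0 ∈ B ∧ x ∈ B} := by
      ext B
      simp [and_assoc]
    rw [← Set.ncard_coe_finset, e]
    exact h.card_pair 0 x (Finset.ne_of_mem_erase hx).symm
  rw [Finset.sum_congr rfl habove, Finset.sum_congr rfl hbelow, Finset.sum_const, Finset.sum_const,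
    Finset.card_erase_of_mem (Finset.mem_univ _)] at key
  rw [Set.ncard_eq_toFinset_card _ hfin]
  have h81 : (Finset.univ : Finset V43).card = 81 := by
    rw [Finset.card_univ, Fintype.card_fun, ZMod.card, Fintype.card_fin]
    norm_num
  rw [h81, smul_eq_mul, smul_eq_mul] at key
  omega

theorem exists_through_zero (h : IsLinearFlagDesign 𝓑 G₀) : ∃ B ∈ 𝓑, 0 ∈ B := by
  have : {B ∈ 𝓑 | (0 : V43) ∈ B}.Nonempty := by
    apply Set.nonempty_of_ncard_ne_zero
    rw [h.card_through_zero]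
    norm_num
  exact this

open scoped Pointwise in
-- The blocks through `0` form a single `G₀`-orbit of length 30. This is the source of the elements
-- of order 3 and 5.
theorem thirty_dvd (h : IsLinearFlagDesign 𝓑 G₀) : 30 ∣ Nat.card G₀ := by
  obtain ⟨B, hB, h0⟩ := h.exists_through_zero
  have horb : MulAction.orbit G₀ B = {B ∈ 𝓑 | (0 : V43) ∈ B} := by
    ext C
    constructor
    · rintro ⟨g, rfl⟩
      exact ⟨h.map_mem g g.2 B hB, ⟨0, h0, map_zero (g : GL43)⟩⟩
    · rintro ⟨hC, h0C⟩
      obtain ⟨g, hg, e⟩ := h.flag B hB C hC h0 h0C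
      exact ⟨⟨g, hg⟩, e⟩
  have := Subgroup.index_dvd_card (MulAction.stabilizer G₀ B)
  rwa [MulAction.index_stabilizer, horb, h.card_through_zero] at this

theorem finrank_transStab_eq (h : IsLinearFlagDesign 𝓑 G₀) {B C : Set V43} (hB : B ∈ 𝓑) (hC : C ∈ 𝓑)
    (h0B : 0 ∈ B) (h0C : 0 ∈ C) :
    Module.finrank (ZMod 3) (transStab C) = Module.finrank (ZMod 3) (transStab B) := by
  obtain ⟨g, hg, rfl⟩ := h.flag B hB C hC h0B h0C
  rw [transStab_map, finrank_map]

theorem finrank_transStab_le (h : IsLinearFlagDesign 𝓑 G₀) {B : Set V43} (hB : B ∈ 𝓑)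
    (h0 : 0 ∈ B) : Module.finrank (ZMod 3) (transStab B) ≤ 2 := by
  have h1 : (transStab B : Set V43).ncard ≤ B.ncard :=
    Set.ncard_le_ncard (fun w hw => transStab_le h0 hw) (Set.toFinite B)
  rw [h.card_block B hB, ← Nat.card_coe_set_eq] at h1
  have h2 := card_submodule (transStab B)
  change Nat.card (transStab B) ≤ 9 at h1
  rw [h2, show 9 = 3 ^ 2 by norm_num] at h1
  exact (Nat.pow_le_pow_iff_right (by norm_num)).1 h1

theorem sub_mem_through_zero (h : IsLinearFlagDesign 𝓑 G₀) {B : Set V43} (hB : B ∈ 𝓑) {b : V43}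
    (hb : b ∈ B) : (fun x => x + -b) '' B ∈ {B ∈ 𝓑 | (0 : V43) ∈ B} :=
  ⟨h.trans_mem B hB _, ⟨b, hb, add_neg_cancel b⟩⟩

/-- With trivial stabilizers each block through `0` has nine distinct translates through `0`, and 9
does not divide 30. -/
theorem finrank_transStab_ne_zero (h : IsLinearFlagDesign 𝓑 G₀) {B : Set V43} (hB : B ∈ 𝓑)
    (h0 : 0 ∈ B) : Module.finrank (ZMod 3) (transStab B) ≠ 0 := by
  classical
  intro hz
  have hbot : ∀ C ∈ 𝓑, 0 ∈ C → transStab C = ⊥ := fun C hC h0C =>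
    Submodule.finrank_eq_zero.1 ((h.finrank_transStab_eq hB hC h0 h0C).trans hz)
  have hfin : {B ∈ 𝓑 | (0 : V43) ∈ B}.Finite := Set.toFinite _
  -- `φ` sends a block to its translation class; its fibres on the blocks through `0` all have nine
  -- elements.
  let φ : Set V43 → Set (Set V43) := fun C => {D | ∃ t : V43, D = (fun x => x + t) '' C}
  have hφ : ∀ C D, φ C = φ D ↔ ∃ t : V43, D = (fun x => x + t) '' C := by
    intro C D
    constructor
    · intro e
      have : D ∈ φ D := ⟨0, by simp⟩
      rw [← e] at this
      exact this
    · rintro ⟨t, rfl⟩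
      ext E
      constructor
      · rintro ⟨u, rfl⟩
        exact ⟨u - t, by rw [Set.image_image]; simp⟩
      · rintro ⟨u, rfl⟩
        exact ⟨t + u, by rw [Set.image_image]; simp [add_assoc]⟩
  have key := Finset.card_eq_sum_card_image φ hfin.toFinset
  rw [Finset.sum_congr rfl (g := fun _ => 9), Finset.sum_const, ← Set.ncard_eq_toFinset_card _ hfin,
    h.card_through_zero, smul_eq_mul] at key
  · omega
  · intro c hc
    obtain ⟨C, hC, rfl⟩ := Finset.mem_image.1 hc
    have hC : C ∈ 𝓑 ∧ 0 ∈ C := by simpa using hC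
    rw [← h.card_block C hC.1, ← Set.ncard_coe_finset]
    have e : (({D ∈ hfin.toFinset | φ D = φ C} : Finset (Set V43)) : Set (Set V43)) =
        (fun b => (fun x => x + -b) '' C) '' C := by
      ext D
      simp only [Finset.coe_filter, Set.Finite.mem_toFinset, Set.mem_ofPred_eq, Set.mem_image]
      rw [eq_comm (a := φ D), hφ]
      constructor
      · rintro ⟨⟨hD, h0D⟩, t, rfl⟩
        obtain ⟨b, hb, hbt⟩ := h0D
        refine ⟨b, hb, ?_⟩
        rw [eq_neg_of_add_eq_zero_left hbt, neg_neg]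
      · rintro ⟨b, hb, rfl⟩
        exact ⟨h.sub_mem_through_zero hC.1 hb, -b, rfl⟩
    rw [e]
    refine Set.InjOn.ncard_image fun a _ b _ hab => ?_
    have := image_add_eq_iff.1 hab
    rw [hbot C hC.1 hC.2, Submodule.mem_bot, sub_eq_zero] at this
    exact this.symm

/-- `U` collects the nonzero translations fixing some block through `0`. Each of the 30 blocks
contributes two vectors, and each vector arises from at least three blocks, so `3 |U| ≤ 60`. -/
theorem exists_small_invariant (h : IsLinearFlagDesign 𝓑 G₀) {B₀ : Set V43} (hB₀ : B₀ ∈ 𝓑)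
    (h0 : 0 ∈ B₀) (h1 : Module.finrank (ZMod 3) (transStab B₀) = 1) :
    ∃ U : Set V43, U.Nonempty ∧ (0 : V43) ∉ U ∧ (∀ x ∈ U, -x ∈ U) ∧ (∀ g ∈ G₀, ∀ x ∈ U, g x ∈ U) ∧
      U.ncard ≤ 20 := by
  classical
  have hone : ∀ C ∈ 𝓑, 0 ∈ C → Nat.card (transStab C) = 3 := fun C hC h0C => by
    rw [card_submodule, h.finrank_transStab_eq hB₀ hC h0 h0C, h1]
    norm_num
  let U : Set V43 := {w | w ≠ 0 ∧ ∃ B ∈ 𝓑, 0 ∈ B ∧ w ∈ transStab B}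
  refine ⟨U, ?_, fun hU => hU.1 rfl, ?_, ?_, ?_⟩
  · obtain ⟨w, hw⟩ := Module.finrank_pos_iff_exists_ne_zero.1 (h1.symm ▸ Nat.one_pos)
    exact ⟨w, fun e => hw (Subtype.ext e), B₀, hB₀, h0, w.2⟩
  · rintro x ⟨hx, B, hB, h0B, hxB⟩
    exact ⟨neg_ne_zero.2 hx, B, hB, h0B, neg_mem hxB⟩
  · rintro g hg x ⟨hx, B, hB, h0B, hxB⟩
    refine ⟨(map_ne_zero_iff _ g.injective).2 hx, g '' B, h.map_mem g hg B hB,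
      ⟨0, h0B, map_zero g⟩, ?_⟩
    rw [transStab_map]
    exact Submodule.mem_map_of_mem hxB
  · have hfin : {B ∈ 𝓑 | (0 : V43) ∈ B}.Finite := Set.toFinite _
    have key := Finset.sum_card_bipartiteAbove_eq_sum_card_bipartiteBelow
      (s := U.toFinset) (t := hfin.toFinset) (fun x B => x ∈ transStab B)
    have hb : ∑ B ∈ hfin.toFinset, (U.toFinset.bipartiteBelow (fun x B => x ∈ transStab B) B).card =
        60 := by
      rw [Finset.sum_congr rfl (g := fun _ => 2), Finset.sum_const,
        ← Set.ncard_eq_toFinset_card _ hfin, h.card_through_zero, smul_eq_mul]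
      intro B hB
      have hB' : B ∈ 𝓑 ∧ 0 ∈ B := by simpa using hB
      have h3 : (transStab B : Set V43).ncard = 3 := hone B hB'.1 hB'.2
      rw [Set.ncard_eq_toFinset_card'] at h3
      have e : U.toFinset.bipartiteBelow (fun x B => x ∈ transStab B) B =
          (transStab B : Set V43).toFinset.erase 0 := by
        ext x
        simp only [Finset.mem_bipartiteBelow, Set.mem_toFinset, Finset.mem_erase, SetLike.mem_coe]
        exact ⟨fun hx => ⟨hx.1.1, hx.2⟩, fun hx => ⟨⟨hx.1, B, hB'.1, hB'.2, hx.2⟩, hx.2⟩⟩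
      rw [e, Finset.card_erase_of_mem (by simp), h3]
    -- A translation fixing `B` fixes all translates of `B`; as the stabilizer has order 3, at least
    -- `9 / 3` distinct ones pass through `0`.
    have ha : U.toFinset.card * 3 ≤ ∑ x ∈ U.toFinset,
        (hfin.toFinset.bipartiteAbove (fun x B => x ∈ transStab B) x).card := by
      rw [← smul_eq_mul]
      refine Finset.card_nsmul_le_sum _ _ _ fun w hw => ?_
      obtain ⟨hw0, B, hB, h0B, hwB⟩ := Set.mem_toFinset.1 hw
      have h9 : B.toFinset.card = 9 := by
        rw [← Set.ncard_eq_toFinset_card']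
        exact h.card_block B hB
      have himg : B.toFinset.image (fun b => (fun x => x + -b) '' B) ⊆
          hfin.toFinset.bipartiteAbove (fun x B => x ∈ transStab B) w := by
        intro D hD
        obtain ⟨b, hb, rfl⟩ := Finset.mem_image.1 hD
        rw [Finset.mem_bipartiteAbove]
        refine ⟨hfin.mem_toFinset.2 (h.sub_mem_through_zero hB (Set.mem_toFinset.1 hb)), ?_⟩
        rw [transStab_add]
        exact hwB
      have hle := Finset.card_le_mul_card_image (f := fun b => (fun x => x + -b) '' B) B.toFinset 3 (by
        intro D hD
        obtain ⟨b, hb, rfl⟩ := Finset.mem_image.1 hD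
        have h3 : (transStab B : Set V43).toFinset.card = 3 := by
          rw [← Set.ncard_eq_toFinset_card']
          exact hone B hB h0B
        refine (Finset.card_le_card_of_injOn (fun a => b - a) ?_ ?_).trans h3.le
        · intro a ha
          have := (Finset.mem_filter.1 ha).2
          simpa using image_add_eq_iff.1 this
        · intro a _ a' _ e
          exact sub_right_injective e)
      have := Finset.card_le_card himg
      omega
    rw [Set.ncard_eq_toFinset_card']
    omega

/-- The stabilizer lies in `B` and has nine elements, just as `B` does. -/
theorem eq_transStab (h : IsLinearFlagDesign 𝓑 G₀) {B : Set V43} (hB : B ∈ 𝓑)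
    (h0 : 0 ∈ B) (h2 : Module.finrank (ZMod 3) (transStab B) = 2) : (transStab B : Set V43) = B := by
  refine Set.eq_of_subset_of_ncard_le (fun w hw => transStab_le h0 hw) ?_ (Set.toFinite B)
  rw [h.card_block B hB]
  exact ((finrank_eq_two_iff _).2 h2).ge

theorem coe_map_eq (g : GL43) (W : Submodule (ZMod 3) V43) :
    ((W.map (g : V43 →ₗ[ZMod 3] V43) : Submodule (ZMod 3) V43) : Set V43) = g '' (W : Set V43) :=
  Submodule.map_coe _ _

/-- `F` consists of the subspaces that are blocks. Each block through `0` equals its stabilizer, so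
all design conditions at `0` become statements on `F`, and translations recover the other blocks. -/
theorem exists_lines (h : IsLinearFlagDesign 𝓑 G₀) {B₀ : Set V43} (hB₀ : B₀ ∈ 𝓑)
    (h0 : 0 ∈ B₀) (h2 : Module.finrank (ZMod 3) (transStab B₀) = 2) :
    ∃ F : Set (Submodule (ZMod 3) V43), (∀ W ∈ F, Module.finrank (ZMod 3) W = 2) ∧
      (∀ x : V43, x ≠ 0 → {W ∈ F | x ∈ W}.ncard = 3) ∧
      (∀ g ∈ G₀, ∀ W ∈ F, W.map (g : V43 →ₗ[ZMod 3] V43) ∈ F) ∧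
      (∀ W ∈ F, ∀ W' ∈ F, ∃ g ∈ G₀, W.map (g : V43 →ₗ[ZMod 3] V43) = W') ∧ F.ncard = 30 ∧
      ∀ B, B ∈ 𝓑 ↔ ∃ W ∈ F, ∃ w : V43, B = (fun x => x + w) '' (W : Set V43) := by
  let F : Set (Submodule (ZMod 3) V43) := {W | (W : Set V43) ∈ 𝓑}
  have hstab : ∀ B ∈ 𝓑, 0 ∈ B → (transStab B : Set V43) = B := fun B hB h0B =>
    h.eq_transStab hB h0B ((h.finrank_transStab_eq hB₀ hB h0 h0B).trans h2)
  have himg : ∀ p : Set V43 → Prop, {B ∈ 𝓑 | 0 ∈ B ∧ p B} =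
      (fun W : Submodule (ZMod 3) V43 => (W : Set V43)) '' {W ∈ F | p W} := by
    intro p
    ext B
    constructor
    · rintro ⟨hB, h0B, hp⟩
      have e := hstab B hB h0B
      refine ⟨transStab B, ⟨?_, ?_⟩, e⟩
      · change (transStab B : Set V43) ∈ 𝓑
        rwa [e]
      · rwa [e]
    · rintro ⟨W, ⟨hW, hp⟩, rfl⟩
      exact ⟨hW, W.zero_mem, hp⟩
  refine ⟨F, ?_, ?_, ?_, ?_, ?_, ?_⟩
  · intro W hW
    rw [← finrank_eq_two_iff]
    exact h.card_block _ hW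
  · intro x hx
    refine Eq.trans ?_ (h.card_pair 0 x hx.symm)
    rw [himg (fun B => x ∈ B), Set.ncard_image_of_injective _ SetLike.coe_injective]
    rfl
  · intro g hg W hW
    change _ ∈ 𝓑
    rw [coe_map_eq]
    exact h.map_mem g hg _ hW
  · intro W hW W' hW'
    obtain ⟨g, hg, e⟩ := h.flag _ hW _ hW' W.zero_mem W'.zero_mem
    refine ⟨g, hg, SetLike.coe_injective ?_⟩
    rw [coe_map_eq, e]
  · have := himg (fun _ => True)
    simp only [and_true] at this
    rw [← h.card_through_zero, this, Set.ncard_image_of_injective _ SetLike.coe_injective]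
    rfl
  · intro B
    constructor
    · intro hB
      obtain ⟨b, hb⟩ : B.Nonempty := by
        apply Set.nonempty_of_ncard_ne_zero
        rw [h.card_block B hB]
        norm_num
      have hC := h.sub_mem_through_zero hB hb
      have e := hstab _ hC.1 hC.2
      refine ⟨transStab ((fun x => x + -b) '' B), ?_, b, ?_⟩
      · change _ ∈ 𝓑
        rw [e]
        exact hC.1
      · rw [e, Set.image_image]
        simp
    · rintro ⟨W, hW, w, rfl⟩
      exact h.trans_mem _ hW w

end IsLinearFlagDesign

/-! ### Four anticommuting involutions over `GF(3)` have a unique standard form. -/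

theorem linearMap_ext {M : Type*} [AddCommGroup M] [Module (ZMod 3) M] {f g : V43 →ₗ[ZMod 3] M}
    (h1 : f (dec 1) = g (dec 1)) (h3 : f (dec 3) = g (dec 3)) (h9 : f (dec 9) = g (dec 9))
    (h27 : f (dec 27) = g (dec 27)) : f = g := by
  refine LinearMap.ext fun x => ?_
  rw [eq_sum_basis x]
  simp only [map_add, map_smul, h1, h3, h9, h27]

/-- The linear map sending the standard basis to `v₀, v₁, v₂, v₃`. -/
def linOf {M : Type*} [AddCommGroup M] [Module (ZMod 3) M] (v₀ v₁ v₂ v₃ : M) : V43 →ₗ[ZMod 3] M where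
  toFun x := x 0 • v₀ + x 1 • v₁ + x 2 • v₂ + x 3 • v₃
  map_add' x y := by
    simp only [Pi.add_apply, add_smul]
    abel
  map_smul' c x := by
    simp only [Pi.smul_apply, smul_eq_mul, mul_smul, RingHom.id_apply, smul_add]

theorem linOf_apply {M : Type*} [AddCommGroup M] [Module (ZMod 3) M] (v₀ v₁ v₂ v₃ : M) (x : V43) :
    linOf v₀ v₁ v₂ v₃ x = x 0 • v₀ + x 1 • v₁ + x 2 • v₂ + x 3 • v₃ := rfl

theorem linOf_dec {M : Type*} [AddCommGroup M] [Module (ZMod 3) M] (v₀ v₁ v₂ v₃ : M) (n : ℕ) :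
    linOf v₀ v₁ v₂ v₃ (dec n) = (n % 3) • v₀ + (n / 3 % 3) • v₁ + (n / 9 % 3) • v₂ +
      (n / 27 % 3) • v₃ := by
  have h : ∀ (k : ℕ) (v : M), (k : ZMod 3) • v = (k % 3) • v := by
    intro k v
    rw [← ZMod.natCast_mod k 3, Nat.cast_smul_eq_nsmul]
  rw [← h, ← h, ← h, ← h]
  rfl

theorem ofCols_dec (m : Cols) : ofCols m (dec 1) = dec m.1 ∧ ofCols m (dec 3) = dec m.2.1 ∧
    ofCols m (dec 9) = dec m.2.2.1 ∧ ofCols m (dec 27) = dec m.2.2.2 := by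
  have h : dec 1 = ![1, 0, 0, 0] ∧ dec 3 = ![0, 1, 0, 0] ∧ dec 9 = ![0, 0, 1, 0] ∧
      dec 27 = ![0, 0, 0, 1] := by decide
  rw [h.1, h.2.1, h.2.2.1, h.2.2.2]
  simp [ofCols]

section frame

variable {M : Type*} [AddCommGroup M] [Module (ZMod 3) M]

theorem add_self_eq_neg (x : M) : x + x = -x := by
  rw [← two_smul (ZMod 3) x, show (2 : ZMod 3) = -1 by decide, neg_one_smul]

theorem eq_zero_of_eq_neg {x : M} (h : x = -x) : x = 0 := by
  have := add_self_eq_neg x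
  rw [← h] at this
  simpa using this

/-- Since `-1` is not a square modulo 3, `a² + b² = 0` forces `a = b = 0`. -/
theorem smul_add_smul_eq_zero {I : M →ₗ[ZMod 3] M} {v : M} (hv : v ≠ 0) (hI : I (I v) = -v)
    {a b : ZMod 3} (h : a • v + b • I v = 0) : a = 0 ∧ b = 0 := by
  have h2 := congrArg I h
  rw [map_add, map_smul, map_smul, hI, map_zero] at h2
  have h3 : (a * a + b * b) • v = 0 := by
    have : (a * a + b * b) • v = a • (a • v + b • I v) - b • (a • I v + b • -v) := by
      module
    rw [this, h, h2, smul_zero, smul_zero, sub_zero]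
  have h4 : a * a + b * b = 0 := (smul_eq_zero.1 h3).resolve_right hv
  clear h h2 h3
  revert a b
  decide

/-- The operator `X = t₄ - t₂ - t₃` satisfies `X² = 3 = 0` and anticommutes with `t₁`. For `w` fixed
by `t₁`, both `X t₂ w` and `X t₃ w` are therefore fixed by `t₁` and killed by `X`, and they cannot
both vanish. -/
theorem exists_frame [Nontrivial M] {t₁ t₂ t₃ t₄ : M →ₗ[ZMod 3] M}
    (h11 : ∀ x, t₁ (t₁ x) = x) (h22 : ∀ x, t₂ (t₂ x) = x) (h33 : ∀ x, t₃ (t₃ x) = x)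
    (h44 : ∀ x, t₄ (t₄ x) = x) (h12 : ∀ x, t₁ (t₂ x) = -t₂ (t₁ x)) (h13 : ∀ x, t₁ (t₃ x) = -t₃ (t₁ x))
    (h14 : ∀ x, t₁ (t₄ x) = -t₄ (t₁ x)) (h23 : ∀ x, t₂ (t₃ x) = -t₃ (t₂ x))
    (h24 : ∀ x, t₂ (t₄ x) = -t₄ (t₂ x)) (h34 : ∀ x, t₃ (t₄ x) = -t₄ (t₃ x)) :
    ∃ v : M, v ≠ 0 ∧ t₁ v = v ∧ t₄ v = t₂ v + t₃ v := by
  obtain ⟨w, hw0, hw⟩ : ∃ w : M, w ≠ 0 ∧ t₁ w = w := by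
    -- If `u + t₁ u` vanishes, then `u` has eigenvalue `-1` for `t₁`, and `t₂` exchanges the two
    -- eigenspaces.
    obtain ⟨u, hu⟩ := exists_ne (0 : M)
    by_cases h : u + t₁ u = 0
    · refine ⟨t₂ u, fun e => hu ?_, ?_⟩
      · rw [← h22 u, e, map_zero]
      · rw [h12, eq_neg_of_add_eq_zero_right h, map_neg, neg_neg]
    · exact ⟨u + t₁ u, h, by rw [map_add, h11, add_comm]⟩
  let X : M →ₗ[ZMod 3] M := t₄ - t₂ - t₃
  have hX : ∀ x, X x = t₄ x - t₂ x - t₃ x := fun x => rfl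
  have hXX : ∀ x, X (X x) = 0 := by
    intro x
    simp only [hX, map_sub, h44, h22, h33, h34, h24, h23]
    have k := add_self_eq_neg x
    calc _ = (x + x) + x := by abel
      _ = 0 := by rw [k, neg_add_cancel]
  have hX1 : ∀ x, t₁ (X x) = -X (t₁ x) := by
    intro x
    simp only [hX, map_sub, h12, h13, h14]
    abel
  have hX2 : ∀ x, X (t₂ x) = x - t₂ (X x) := by
    intro x
    have k := add_self_eq_neg x
    simp only [hX, map_sub, h22, h24, h23]
    calc _ = (t₄ (t₂ x) - t₃ (t₂ x)) + (-(x + x) + x) := by abel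
      _ = _ := by rw [k]; abel
  have hX3 : ∀ x, X (t₃ x) = x - t₃ (X x) := by
    intro x
    have k := add_self_eq_neg x
    simp only [hX, map_sub, h33, h34, h23]
    calc _ = (t₄ (t₃ x) + t₃ (t₂ x)) + (-(x + x) + x) := by abel
      _ = _ := by rw [k]; abel
  have fin : ∀ v, v ≠ 0 → t₁ v = v → X v = 0 → ∃ v : M, v ≠ 0 ∧ t₁ v = v ∧ t₄ v = t₂ v + t₃ v :=
    fun v h1 h2 h3 => ⟨v, h1, h2, by rw [hX, sub_sub, sub_eq_zero] at h3; exact h3⟩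
  by_cases h2 : X (t₂ w) = 0
  · refine fin (X (t₃ w)) ?_ ?_ (hXX _)
    -- If both vanish, then `w = t₂ (X w) = t₃ (X w)`. Hence `t₂ t₃` and `t₃ t₂` both fix `X w`,
    -- which anticommutation turns into `X w = -X w`.
    · intro h3
      rw [hX2, sub_eq_zero] at h2
      rw [hX3, sub_eq_zero] at h3
      have e : t₂ (X w) = t₃ (X w) := h2.symm.trans h3
      have e2 : X w = t₂ (t₃ (X w)) := by rw [← e, h22]
      have e3 : X w = t₃ (t₂ (X w)) := by rw [e, h33]
      rw [h23, ← e3] at e2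
      apply hw0
      rw [h2, eq_zero_of_eq_neg e2, map_zero]
    · rw [hX1, h13, map_neg, neg_neg, hw]
  · exact fin _ h2 (by rw [hX1, h12, map_neg, neg_neg, hw]) (hXX _)

/-- The vectors `v, t₂ t₃ v, t₂ v, t₃ v` span a copy of the standard module. Allowing any nontrivial
`M` gives both the standard form on `V` and a lower bound 4 on the dimension of an invariant
subspace. -/
theorem exists_intertwiner [Nontrivial M] {t₁ t₂ t₃ t₄ : M →ₗ[ZMod 3] M}
    (h11 : ∀ x, t₁ (t₁ x) = x) (h22 : ∀ x, t₂ (t₂ x) = x) (h33 : ∀ x, t₃ (t₃ x) = x)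
    (h44 : ∀ x, t₄ (t₄ x) = x) (h12 : ∀ x, t₁ (t₂ x) = -t₂ (t₁ x)) (h13 : ∀ x, t₁ (t₃ x) = -t₃ (t₁ x))
    (h14 : ∀ x, t₁ (t₄ x) = -t₄ (t₁ x)) (h23 : ∀ x, t₂ (t₃ x) = -t₃ (t₂ x))
    (h24 : ∀ x, t₂ (t₄ x) = -t₄ (t₂ x)) (h34 : ∀ x, t₃ (t₄ x) = -t₄ (t₃ x)) :
    ∃ L : V43 →ₗ[ZMod 3] M, Function.Injective L ∧
      t₁ ∘ₗ L = L ∘ₗ ofCols (signedCol 0) ∧ t₂ ∘ₗ L = L ∘ₗ ofCols (signedCol 2) ∧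
      t₃ ∘ₗ L = L ∘ₗ ofCols (signedCol 4) ∧ t₄ ∘ₗ L = L ∘ₗ ofCols (signedCol 6) := by
  obtain ⟨v, hv, h1, h4⟩ := exists_frame h11 h22 h33 h44 h12 h13 h14 h23 h24 h34
  have k32 : t₃ (t₂ v) = -t₂ (t₃ v) := by rw [h23, neg_neg]
  have k42 : t₄ (t₂ v) = -t₂ (t₄ v) := by rw [h24, neg_neg]
  have k43 : t₄ (t₃ v) = -t₃ (t₄ v) := by rw [h34, neg_neg]
  have k323 : t₃ (t₂ (t₃ v)) = -t₂ v := by rw [h23, map_neg, h33]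
  have k423 : t₄ (t₂ (t₃ v)) = t₂ v - t₃ v := by
    rw [← neg_neg (t₄ (t₂ (t₃ v))), ← h24, k43, map_neg, neg_neg, h4, map_add, map_add, k32, map_neg,
      h22, h33]
    abel
  have c1 : ∀ n : ℕ, linOf v (t₂ (t₃ v)) (t₂ v) (t₃ v) (dec n) = (n % 3) • v +
      (n / 3 % 3) • t₂ (t₃ v) + (n / 9 % 3) • t₂ v + (n / 27 % 3) • t₃ v := linOf_dec _ _ _ _
  have two : ∀ x : M, (2 : ℕ) • x = -x := fun x => by rw [two_nsmul, add_self_eq_neg]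
  refine ⟨linOf v (t₂ (t₃ v)) (t₂ v) (t₃ v), ?_, ?_, ?_, ?_, ?_⟩
  · rw [← LinearMap.ker_eq_bot, LinearMap.ker_eq_bot']
    intro x hx
    rw [linOf_apply] at hx
    have hx1 := congrArg t₁ hx
    simp only [map_add, map_smul, h12, h13, h1, map_neg, neg_neg, map_zero] at hx1
    -- `t₁` is `1` on the first two vectors and `-1` on the last two, so a relation splits; each
    -- half is handled by `(t₂ t₃)² = -1`.
    have e1 : x 0 • v + x 1 • t₂ (t₃ v) = 0 := by
      apply eq_zero_of_eq_neg
      rw [← add_self_eq_neg (x 0 • v + x 1 • t₂ (t₃ v))]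
      have : x 0 • v + x 1 • t₂ (t₃ v) + (x 0 • v + x 1 • t₂ (t₃ v)) =
        (x 0 • v + x 1 • t₂ (t₃ v) + x 2 • t₂ v + x 3 • t₃ v) +
          (x 0 • v + x 1 • t₂ (t₃ v) + x 2 • -t₂ v + x 3 • -t₃ v) := by
        rw [smul_neg, smul_neg]
        abel
      have e := this.trans (by rw [hx, hx1, add_zero])
      rw [add_self_eq_neg, neg_eq_zero] at e
      rw [e, add_zero]
    have e2 : x 2 • t₂ v + x 3 • t₃ v = 0 := by
      rw [e1, zero_add] at hx
      exact hx
    have e3 : x 2 • v + x 3 • t₂ (t₃ v) = 0 := by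
      have := congrArg t₂ e2
      rwa [map_add, map_smul, map_smul, h22, map_zero] at this
    have hI : (t₂ ∘ₗ t₃) ((t₂ ∘ₗ t₃) v) = -v := by
      simp only [LinearMap.comp_apply, k323, map_neg, h22]
    obtain ⟨r0, r1⟩ := smul_add_smul_eq_zero (I := t₂ ∘ₗ t₃) hv hI e1
    obtain ⟨r2, r3⟩ := smul_add_smul_eq_zero (I := t₂ ∘ₗ t₃) hv hI e3
    exact vec_ext r0 r1 r2 r3
  all_goals
    refine linearMap_ext ?_ ?_ ?_ ?_ <;>
    simp only [LinearMap.comp_apply, ofCols_dec] <;>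
    simp [c1, signedCol, signedCols, two, h1, h4, h12, h13, h22, h33, k32, k42, k43, k323, k423] <;>
    try abel

end frame

/-- The negation of `V`. -/
abbrev negGL : GL43 := LinearEquiv.neg (ZMod 3)

theorem negGL_apply (x : V43) : negGL x = -x := rfl

theorem gcols_eq_of_comp {g P : GL43} {m : Cols}
    (h : (g : V43 →ₗ[ZMod 3] V43) ∘ₗ (P⁻¹ : GL43) = ((P⁻¹ : GL43) : V43 →ₗ[ZMod 3] V43) ∘ₗ ofCols m)
    (hm : mulCols m (1, 3, 9, 27) = m) : gcols (P * g * P⁻¹) = m := by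
  rw [← cols_ofCols hm, gcols]
  congr 1
  refine LinearMap.ext fun x => ?_
  have := congrArg P (LinearMap.congr_fun h x)
  have hP : ∀ y, P (P⁻¹ y) = y := P.apply_symm_apply
  exact this.trans (hP _)

/-- Pairwise anticommuting involutions of `V` have the standard form in a suitable basis. -/
theorem exists_conj {t₁ t₂ t₃ t₄ : GL43}
    (h11 : t₁ * t₁ = 1) (h22 : t₂ * t₂ = 1) (h33 : t₃ * t₃ = 1) (h44 : t₄ * t₄ = 1)
    (h12 : t₁ * t₂ = negGL * (t₂ * t₁)) (h13 : t₁ * t₃ = negGL * (t₃ * t₁))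
    (h14 : t₁ * t₄ = negGL * (t₄ * t₁)) (h23 : t₂ * t₃ = negGL * (t₃ * t₂))
    (h24 : t₂ * t₄ = negGL * (t₄ * t₂)) (h34 : t₃ * t₄ = negGL * (t₄ * t₃)) :
    ∃ P : GL43, gcols (P * t₁ * P⁻¹) = signedCol 0 ∧ gcols (P * t₂ * P⁻¹) = signedCol 2 ∧
      gcols (P * t₃ * P⁻¹) = signedCol 4 ∧ gcols (P * t₄ * P⁻¹) = signedCol 6 := by
  have app : ∀ {a b : GL43}, a = b → ∀ x, a x = b x := fun h x => by rw [h]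
  obtain ⟨L, hL, h1, h2, h3, h4⟩ := exists_intertwiner (t₁ := (t₁ : V43 →ₗ[ZMod 3] V43)) (t₂ := t₂)
    (t₃ := t₃) (t₄ := t₄) (app h11) (app h22) (app h33) (app h44) (app h12) (app h13) (app h14)
    (app h23) (app h24) (app h34)
  let Q : GL43 := LinearEquiv.ofInjectiveEndo L hL
  exact ⟨Q⁻¹, gcols_eq_of_comp h1 rfl, gcols_eq_of_comp h2 rfl, gcols_eq_of_comp h3 rfl,
    gcols_eq_of_comp h4 rfl⟩

/-- A central involution `z ≠ 1` that is the common commutator of four involutions is `-1`. -/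
theorem eq_neg_of_commutators {z t₁ t₂ t₃ t₄ : GL43} (hz : z ≠ 1) (hzz : z * z = 1)
    (c1 : t₁ * z = z * t₁) (c2 : t₂ * z = z * t₂) (c3 : t₃ * z = z * t₃) (c4 : t₄ * z = z * t₄)
    (h11 : t₁ * t₁ = 1) (h22 : t₂ * t₂ = 1) (h33 : t₃ * t₃ = 1) (h44 : t₄ * t₄ = 1)
    (h12 : t₁ * t₂ = z * (t₂ * t₁)) (h13 : t₁ * t₃ = z * (t₃ * t₁))
    (h14 : t₁ * t₄ = z * (t₄ * t₁)) (h23 : t₂ * t₃ = z * (t₃ * t₂))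
    (h24 : t₂ * t₄ = z * (t₄ * t₂)) (h34 : t₃ * t₄ = z * (t₄ * t₃)) : z = negGL := by
  have app : ∀ {a b : GL43}, a = b → ∀ x, a x = b x := fun h x => by rw [h]
  let W : Submodule (ZMod 3) V43 :=
    LinearMap.ker ((z : V43 →ₗ[ZMod 3] V43) + LinearMap.id)
  have hW : ∀ x, x ∈ W ↔ z x = -x := fun x => by
    rw [LinearMap.mem_ker, LinearMap.add_apply, LinearMap.id_apply]
    exact add_eq_zero_iff_eq_neg
  have hmaps : ∀ t : GL43, t * z = z * t → ∀ x ∈ W, (t : V43 →ₗ[ZMod 3] V43) x ∈ W := by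
    intro t ht x hx
    rw [hW] at hx ⊢
    have := app ht x
    change t (z x) = z (t x) at this
    rw [hx, map_neg] at this
    exact this.symm
  have hrel : ∀ a b : GL43, a * b = z * (b * a) → ∀ x ∈ W, b * z = z * b → a * z = z * a →
      a (b x) = -b (a x) := by
    intro a b h x hx hb ha
    have h1 := app h x
    change a (b x) = z (b (a x)) at h1
    rw [h1]
    exact (hW _).1 (hmaps b hb _ (hmaps a ha x hx))
  -- Any `x` moved by `z` gives the nonzero vector `x - z x` of the `-1`-eigenspace `W`. By the
  -- intertwiner `W` has dimension at least 4.
  have hne : Nontrivial W := by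
    obtain ⟨x, hx⟩ : ∃ x, z x ≠ x := by
      by_contra! hcon
      exact hz (LinearEquiv.ext hcon)
    refine ⟨⟨⟨x - z x, ?_⟩, 0, fun e => hx ?_⟩⟩
    · rw [hW, map_sub]
      have : z (z x) = x := app hzz x
      rw [this, neg_sub]
    · exact (sub_eq_zero.1 (congrArg Subtype.val e)).symm
  obtain ⟨L, hL, -⟩ := exists_intertwiner (M := W)
    (t₁ := (t₁ : V43 →ₗ[ZMod 3] V43).restrict (hmaps t₁ c1))
    (t₂ := (t₂ : V43 →ₗ[ZMod 3] V43).restrict (hmaps t₂ c2))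
    (t₃ := (t₃ : V43 →ₗ[ZMod 3] V43).restrict (hmaps t₃ c3))
    (t₄ := (t₄ : V43 →ₗ[ZMod 3] V43).restrict (hmaps t₄ c4))
    (fun x => Subtype.ext (app h11 x)) (fun x => Subtype.ext (app h22 x))
    (fun x => Subtype.ext (app h33 x)) (fun x => Subtype.ext (app h44 x))
    (fun x => Subtype.ext (hrel _ _ h12 x x.2 c2 c1)) (fun x => Subtype.ext (hrel _ _ h13 x x.2 c3 c1))
    (fun x => Subtype.ext (hrel _ _ h14 x x.2 c4 c1)) (fun x => Subtype.ext (hrel _ _ h23 x x.2 c3 c2))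
    (fun x => Subtype.ext (hrel _ _ h24 x x.2 c4 c2)) (fun x => Subtype.ext (hrel _ _ h34 x x.2 c4 c3))
  have hcard := LinearMap.finrank_le_finrank_of_injective hL
  have htop : W = ⊤ := Submodule.eq_top_of_finrank_eq (le_antisymm (Submodule.finrank_le W) hcard)
  refine LinearEquiv.ext fun x => ?_
  rw [negGL_apply, ← hW, htop]
  exact Submodule.mem_top

/-! ### The group `D₈ ∘ Q₈` and its involutions. -/

theorem dihedral_word : ∀ x : DihedralGroup 4, ∃ k < 4, ∃ l < 2,
    x = DihedralGroup.r 1 ^ k * DihedralGroup.sr 0 ^ l := by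
  decide

theorem quaternion_word : ∀ x : QuaternionGroup 2, ∃ k < 4, ∃ l < 2,
    x = QuaternionGroup.a 1 ^ k * QuaternionGroup.xa 0 ^ l := by
  decide

theorem quaternion_center : ∀ x : QuaternionGroup 2, (∀ y, y * x = x * y) →
    x = 1 ∨ x = QuaternionGroup.a 2 := by
  decide

/-- Generators of `D₈ ∘ Q₈` with their relations. -/
theorem exists_generators {G : Type*} [Group G] {R : Subgroup G} (hR : IsD8CentralQ8 R) :
    ∃ r s i j z : G, r ∈ R ∧ s ∈ R ∧ i ∈ R ∧ j ∈ R ∧ z ≠ 1 ∧ z * z = 1 ∧ r * r = z ∧ s * s = 1 ∧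
      s * r = z * (r * s) ∧ i * i = z ∧ j * j = z ∧ i * j = z * (j * i) ∧
      i * r = r * i ∧ i * s = s * i ∧ j * r = r * j ∧ j * s = s * j ∧
      ∀ x ∈ R, ∃ k < 4, ∃ l < 2, ∃ m < 4, ∃ n < 2, x = r ^ k * s ^ l * (i ^ m * j ^ n) := by
  obtain ⟨A, B, ⟨f⟩, ⟨g⟩, hcomm, hsup, hZA, hZB⟩ := hR
  have hf : ∀ {x y : DihedralGroup 4}, x = y → ((f.symm x : A) : G) = f.symm y := fun h => by rw [h]
  have hg : ∀ {x y : QuaternionGroup 2}, x = y → ((g.symm x : B) : G) = g.symm y := fun h => by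
    rw [h]
  have hfm : ∀ x y : DihedralGroup 4, ((f.symm (x * y) : A) : G) = f.symm x * f.symm y :=
    fun x y => by rw [map_mul, Subgroup.coe_mul]
  have hgm : ∀ x y : QuaternionGroup 2, ((g.symm (x * y) : B) : G) = g.symm x * g.symm y :=
    fun x y => by rw [map_mul, Subgroup.coe_mul]
  have hf1 : ((f.symm 1 : A) : G) = 1 := by rw [map_one, Subgroup.coe_one]
  -- The rotation by a half turn is central in `A`, hence lies in the centre of `B`, whose only
  -- nontrivial element is the square of the quaternion generators.
  have hz : ((f.symm (DihedralGroup.r 2) : A) : G) = g.symm (QuaternionGroup.a 2) := by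
    have h1 : ((f.symm (DihedralGroup.r 2) : A) : G) ∈ A ⊓ B := by
      rw [hZA]
      refine Subgroup.mem_map_of_mem A.subtype ?_
      rw [Subgroup.mem_center_iff]
      intro y
      apply f.injective
      rw [map_mul, map_mul, f.apply_symm_apply]
      generalize f y = y'
      revert y'
      decide
    rw [hZB] at h1
    obtain ⟨y, hy, e⟩ := h1
    rw [SetLike.mem_coe, Subgroup.mem_center_iff] at hy
    have hy' : ∀ q, q * g y = g y * q := by
      intro q
      have := congrArg g (hy (g.symm q))
      rwa [map_mul, map_mul, g.apply_symm_apply] at this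
    rw [← e]
    rcases quaternion_center _ hy' with h | h
    · exfalso
      rw [map_eq_one_iff g g.injective] at h
      rw [h, map_one] at e
      have : f.symm (DihedralGroup.r 2) = 1 := Subtype.ext e.symm
      rw [map_eq_one_iff f.symm f.symm.injective] at this
      revert this
      decide
    · rw [← h, g.symm_apply_apply]
      rfl
  have hA : ∀ x, ((f.symm x : A) : G) ∈ R := fun x => hsup ▸ Subgroup.mem_sup_left (f.symm x).2
  have hB : ∀ x, ((g.symm x : B) : G) ∈ R := fun x => hsup ▸ Subgroup.mem_sup_right (g.symm x).2
  have hc : ∀ x y, ((g.symm y : B) : G) * f.symm x = f.symm x * g.symm y := fun x y =>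
    (hcomm _ (f.symm x).2 _ (g.symm y).2).symm
  refine ⟨f.symm (DihedralGroup.r 1), f.symm (DihedralGroup.sr 0), g.symm (QuaternionGroup.a 1),
    g.symm (QuaternionGroup.xa 0), f.symm (DihedralGroup.r 2), hA _, hA _, hB _, hB _, ?_, ?_, ?_,
    ?_, ?_, ?_, ?_, ?_, hc _ _, hc _ _, hc _ _, hc _ _, ?_⟩
  · intro e
    have : f.symm (DihedralGroup.r 2) = 1 := Subtype.ext e
    rw [map_eq_one_iff f.symm f.symm.injective] at this
    revert this
    decide
  · rw [← hfm, ← hf1]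
    exact hf (by decide)
  · rw [← hfm]
    exact hf (by decide)
  · rw [← hfm, ← hf1]
    exact hf (by decide)
  · rw [← hfm, ← hfm, ← hfm]
    exact hf (by decide)
  · rw [← hgm, hz]
    exact hg (by decide)
  · rw [← hgm, hz]
    exact hg (by decide)
  · rw [hz, ← hgm, ← hgm, ← hgm]
    exact hg (by decide)
  · intro x hx
    have hx' : ∃ a ∈ A, ∃ b ∈ B, x = a * b := by
      let K : Subgroup G :=
        { carrier := {x | ∃ a ∈ A, ∃ b ∈ B, x = a * b}
          one_mem' := ⟨1, one_mem _, 1, one_mem _, (mul_one _).symm⟩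
          mul_mem' := by
            rintro _ _ ⟨a, ha, b, hb, rfl⟩ ⟨a', ha', b', hb', rfl⟩
            refine ⟨a * a', mul_mem ha ha', b * b', mul_mem hb hb', ?_⟩
            rw [mul_assoc, ← mul_assoc b a', ← hcomm a' ha' b hb, mul_assoc, mul_assoc]
          inv_mem' := by
            rintro _ ⟨a, ha, b, hb, rfl⟩
            refine ⟨a⁻¹, inv_mem ha, b⁻¹, inv_mem hb, ?_⟩
            rw [mul_inv_rev, hcomm _ (inv_mem ha) _ (inv_mem hb)] }
      have hle : A ⊔ B ≤ K := sup_le (fun a ha => ⟨a, ha, 1, one_mem _, (mul_one _).symm⟩)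
        (fun b hb => ⟨1, one_mem _, b, hb, (one_mul _).symm⟩)
      rw [hsup] at hle
      exact hle hx
    obtain ⟨a, ha, b, hb, rfl⟩ := hx'
    obtain ⟨k, hk, l, hl, e⟩ := dihedral_word (f ⟨a, ha⟩)
    obtain ⟨m, hm, n, hn, e'⟩ := quaternion_word (g ⟨b, hb⟩)
    refine ⟨k, hk, l, hl, m, hm, n, hn, ?_⟩
    rw [← f.eq_symm_apply] at e
    rw [← g.eq_symm_apply] at e'
    have e := congrArg Subtype.val e
    have e' := congrArg Subtype.val e'
    simp only [map_mul, map_pow, Subgroup.coe_mul, Subgroup.coe_pow] at e e'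
    rw [← e, ← e']

/-- The signed involutions `s 0, …, s 9` are the involutions of `R` other than `± 1`. -/
structure IsInvolutionFrame (R : Subgroup GL43) (s : ℕ → GL43) : Prop where
  mem : ∀ x < 10, s x ∈ R
  sq : ∀ x < 10, s x * s x = 1
  ne_one : ∀ x < 10, s x ≠ 1
  ne_neg : ∀ x < 10, s x ≠ negGL
  exhaust : ∀ g ∈ R, g * g = 1 → g = 1 ∨ g = negGL ∨ ∃ x < 10, g = s x

/-- The conjugate `P R P⁻¹`. -/
def conjSubgroup (P : GL43) (R : Subgroup GL43) : Subgroup GL43 :=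
  R.map (MulAut.conj P).toMonoidHom

theorem mem_conjSubgroup {P g : GL43} {R : Subgroup GL43} :
    g ∈ conjSubgroup P R ↔ P⁻¹ * g * P ∈ R := by
  constructor
  · rintro ⟨x, hx, rfl⟩
    have : P⁻¹ * (P * x * P⁻¹) * P = x := by group
    exact this.symm ▸ hx
  · intro h
    refine ⟨_, h, ?_⟩
    change P * (P⁻¹ * g * P) * P⁻¹ = g
    group

theorem conj_mem_conjSubgroup {P g : GL43} {R : Subgroup GL43} (h : g ∈ R) :
    P * g * P⁻¹ ∈ conjSubgroup P R := ⟨g, h, rfl⟩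

theorem IsInvolutionFrame.conj {R : Subgroup GL43} {s : ℕ → GL43} (h : IsInvolutionFrame R s)
    (P : GL43) : IsInvolutionFrame (conjSubgroup P R) (fun x => P * s x * P⁻¹) where
  mem x hx := conj_mem_conjSubgroup (h.mem x hx)
  sq x hx := by
    have : P * s x * P⁻¹ * (P * s x * P⁻¹) = P * (s x * s x) * P⁻¹ := by group
    rw [this, h.sq x hx, mul_one, mul_inv_cancel]
  ne_one x hx e := by
    apply h.ne_one x hx
    rwa [conj_eq_one_iff] at e
  ne_neg x hx e := by
    apply h.ne_neg x hx
    rw [mul_inv_eq_iff_eq_mul, neg_mul_comm] at e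
    exact mul_left_cancel e
  exhaust g hg hgg := by
    have key := h.exhaust _ (mem_conjSubgroup.1 hg) (by
      have : P⁻¹ * g * P * (P⁻¹ * g * P) = P⁻¹ * (g * g) * P := by group
      rw [this, hgg, mul_one, inv_mul_cancel])
    have e : ∀ y, P⁻¹ * g * P = y → g = P * y * P⁻¹ := by
      rintro y rfl
      group
    rcases key with k | k | ⟨x, hx, k⟩
    · exact Or.inl (by rw [e _ k, mul_one, mul_inv_cancel])
    · exact Or.inr (Or.inl (by rw [e _ k, ← neg_mul_comm, mul_assoc, mul_inv_cancel, mul_one]))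
    · exact Or.inr (Or.inr ⟨x, hx, e _ k⟩)

theorem IsInvolutionFrame.exists_conj_eq {R : Subgroup GL43} {s : ℕ → GL43}
    (h : IsInvolutionFrame R s) {g : GL43} (hg : g ∈ Subgroup.normalizer (R : Set GL43)) :
    ∃ f : ℕ → ℕ, (∀ x < 10, f x < 10) ∧ ∀ x < 10, g * s x = s (f x) * g := by
  have key : ∀ x, ∃ y, x < 10 → y < 10 ∧ g * s x = s y * g := by
    intro x
    by_cases hx : x < 10
    · have hmem : g * s x * g⁻¹ ∈ R := (Subgroup.mem_normalizer_iff.1 hg _).1 (h.mem x hx)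
      rcases h.exhaust _ hmem (by
        have : g * s x * g⁻¹ * (g * s x * g⁻¹) = g * (s x * s x) * g⁻¹ := by group
        rw [this, h.sq x hx, mul_one, mul_inv_cancel]) with k | k | ⟨y, hy, k⟩
      · exact absurd (conj_eq_one_iff.1 k) (h.ne_one x hx)
      · rw [mul_inv_eq_iff_eq_mul, neg_mul_comm] at k
        exact absurd (mul_left_cancel k) (h.ne_neg x hx)
      · exact ⟨y, fun _ => ⟨hy, by rw [← k, inv_mul_cancel_right]⟩⟩
    · exact ⟨0, fun h => absurd h hx⟩
  choose f hf using key
  exact ⟨f, fun x hx => (hf x hx).1, fun x hx => (hf x hx).2⟩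

/-- Powers of a column tuple. -/
def powCols (m : Cols) (k : ℕ) : Cols := Nat.rec (1, 3, 9, 27) (fun _ y => mulCols m y) k

theorem gcols_pow (g : GL43) (k : ℕ) : gcols (g ^ k) = powCols (gcols g) k := by
  induction k with
  | zero => exact gcols_one
  | succ k ih =>
    rw [pow_succ', gcols_mul, ih]
    rfl

/-- The columns of `r ^ k * s ^ l * (i ^ m * j ^ n)`, where `s, r * s, r * i, r * j` are the first four
standard involutions. -/
def wordCols (k l m n : ℕ) : Cols :=
  mulCols (mulCols (powCols (mulCols (signedCol 2) (signedCol 0)) k) (powCols (signedCol 0) l))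
    (mulCols (powCols (mulCols (2, 6, 18, 54) (mulCols (mulCols (signedCol 2) (signedCol 0)) (signedCol 4))) m)
      (powCols (mulCols (2, 6, 18, 54) (mulCols (mulCols (signedCol 2) (signedCol 0)) (signedCol 6))) n))

/-- Every element of `R` is one of these words, so this finds all solutions of `g² = 1` in `R`: `±
1` and the ten signed involutions. -/
theorem wordCols_check : ((List.range 4).all fun k => (List.range 2).all fun l =>
    (List.range 4).all fun m => (List.range 2).all fun n =>
      !(mulCols (wordCols k l m n) (wordCols k l m n) == (1, 3, 9, 27)) ||
        (wordCols k l m n == (1, 3, 9, 27) || (wordCols k l m n == (2, 6, 18, 54) ||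
          (List.range 10).any fun x => wordCols k l m n == signedCol x))) = true := by
  decide +kernel

theorem wordCols_involution {k l m n : ℕ} (hk : k < 4) (hl : l < 2) (hm : m < 4) (hn : n < 2)
    (h : mulCols (wordCols k l m n) (wordCols k l m n) = (1, 3, 9, 27)) :
    wordCols k l m n = (1, 3, 9, 27) ∨ wordCols k l m n = (2, 6, 18, 54) ∨
      ∃ x < 10, wordCols k l m n = signedCol x := by
  have key := wordCols_check
  simp only [List.all_eq_true, List.mem_range] at key
  have key := key k hk l hl m hm n hn
  rw [h] at key
  simpa using key

theorem negGL_mul_self : negGL * negGL = 1 := LinearEquiv.ext fun x => neg_neg x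

/-- `D₈ ∘ Q₈` is generated by four involutions that commute pairwise up to the central element. -/
theorem anticommuting_of_relations {G : Type*} [Group G] {r s i j z : G} (hzz : z * z = 1)
    (hrr : r * r = z) (hss : s * s = 1) (hsr : s * r = z * (r * s)) (hii : i * i = z)
    (hjj : j * j = z) (hij : i * j = z * (j * i)) (hir : i * r = r * i) (his : i * s = s * i)
    (hjr : j * r = r * j) (hjs : j * s = s * j) :
    (s * z = z * s ∧ r * s * z = z * (r * s) ∧ r * i * z = z * (r * i) ∧ r * j * z = z * (r * j)) ∧
    (r * s * (r * s) = 1 ∧ r * i * (r * i) = 1 ∧ r * j * (r * j) = 1) ∧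
    (s * (r * s) = z * (r * s * s) ∧ s * (r * i) = z * (r * i * s) ∧ s * (r * j) = z * (r * j * s)) ∧
    (r * s * (r * i) = z * (r * i * (r * s)) ∧ r * s * (r * j) = z * (r * j * (r * s)) ∧
      r * i * (r * j) = z * (r * j * (r * i))) ∧
    r = r * s * s ∧ i = z * (r * s * s * (r * i)) ∧ j = z * (r * s * s * (r * j)) := by
  have az : ∀ x, z * (z * x) = x := fun x => by rw [← mul_assoc, hzz, one_mul]
  have ar : ∀ x, r * (r * x) = z * x := fun x => by rw [← mul_assoc, hrr]
  have rz : r * z = z * r := by rw [← hrr, mul_assoc]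
  have arz : ∀ x, r * (z * x) = z * (r * x) := fun x => by rw [← mul_assoc, rz, mul_assoc]
  have asr : ∀ x, s * (r * x) = z * (r * (s * x)) := fun x => by
    rw [← mul_assoc, hsr, mul_assoc, mul_assoc]
  have sz : s * z = z * s := by rw [← hrr, asr, hsr, arz, az, mul_assoc]
  have air : ∀ x, i * (r * x) = r * (i * x) := fun x => by rw [← mul_assoc, hir, mul_assoc]
  have ajr : ∀ x, j * (r * x) = r * (j * x) := fun x => by rw [← mul_assoc, hjr, mul_assoc]
  have iz : i * z = z * i := by rw [← hrr, air, hir, mul_assoc]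
  have jz : j * z = z * j := by rw [← hrr, ajr, hjr, mul_assoc]
  refine ⟨⟨?_, ?_, ?_, ?_⟩, ⟨?_, ?_, ?_⟩, ⟨?_, ?_, ?_⟩, ⟨?_, ?_, ?_⟩, ?_, ?_, ?_⟩ <;>
  simp only [mul_assoc, hzz, az, hrr, ar, hss, rz, arz, asr, sz, air, his, ajr, hjs, hii, hjj, iz, jz,
    hij, mul_one]

/-- The standard signed involutions. -/
def stdInv (x : ℕ) : GL43 :=
  if h : mulCols (signedCol x) (signedCol x) = (1, 3, 9, 27) ∧
      mulCols (signedCol x) (1, 3, 9, 27) = signedCol x then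
    equivOfCols (signedCol x) (signedCol x) h.1 h.1 h.2 h.2
  else 1

theorem signedCol_sq : ∀ x < 10, mulCols (signedCol x) (signedCol x) = (1, 3, 9, 27) ∧
    mulCols (signedCol x) (1, 3, 9, 27) = signedCol x := by
  decide +kernel

theorem gcols_stdInv : ∀ x < 10, gcols (stdInv x) = signedCol x := by
  intro x hx
  rw [stdInv, dif_pos (signedCol_sq x hx)]
  exact cols_ofCols (signedCol_sq x hx).2

theorem eq_stdInv {g : GL43} {x : ℕ} (hx : x < 10) (h : gcols g = signedCol x) : g = stdInv x :=
  gcols_injective (h.trans (gcols_stdInv x hx).symm)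

theorem stdInv_mul_self : ∀ x < 10, stdInv x * stdInv x = 1 := by
  intro x hx
  apply gcols_injective
  rw [gcols_mul, gcols_stdInv x hx, gcols_one, (signedCol_sq x hx).1]

theorem stdInv_xor : ∀ x < 10, stdInv (Nat.xor x 1) = negGL * stdInv x :=
  signed_xor gcols_stdInv

theorem signedCol_ne : ∀ x < 10, signedCol x ≠ (1, 3, 9, 27) ∧ signedCol x ≠ (2, 6, 18, 54) := by
  decide +kernel

theorem stdInv_ne_one : ∀ x < 10, stdInv x ≠ 1 := fun x hx h =>
  (signedCol_ne x hx).1 (by rw [← gcols_stdInv x hx, h, gcols_one])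

theorem stdInv_ne_neg : ∀ x < 10, stdInv x ≠ negGL := fun x hx h =>
  (signedCol_ne x hx).2 (by rw [← gcols_stdInv x hx, h, gcols_neg_one])

theorem stdInv_eight : stdInv 8 = stdInv 0 * stdInv 2 * (stdInv 4 * stdInv 6) := by
  apply gcols_injective
  simp only [gcols_mul]
  rw [gcols_stdInv 0 (by norm_num), gcols_stdInv 2 (by norm_num), gcols_stdInv 4 (by norm_num),
    gcols_stdInv 6 (by norm_num), gcols_stdInv 8 (by norm_num)]
  decide +kernel

theorem stdInv_mem {K : Subgroup GL43} (hn : negGL ∈ K) (h0 : stdInv 0 ∈ K) (h2 : stdInv 2 ∈ K)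
    (h4 : stdInv 4 ∈ K) (h6 : stdInv 6 ∈ K) : ∀ x < 10, stdInv x ∈ K := by
  have h8 : stdInv 8 ∈ K := stdInv_eight ▸ mul_mem (mul_mem h0 h2) (mul_mem h4 h6)
  intro x hx
  interval_cases x
  · exact h0
  · exact stdInv_xor 0 (by norm_num) ▸ mul_mem hn h0
  · exact h2
  · exact stdInv_xor 2 (by norm_num) ▸ mul_mem hn h2
  · exact h4
  · exact stdInv_xor 4 (by norm_num) ▸ mul_mem hn h4
  · exact h6
  · exact stdInv_xor 6 (by norm_num) ▸ mul_mem hn h6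
  · exact h8
  · exact stdInv_xor 8 (by norm_num) ▸ mul_mem hn h8

theorem conj_mul (P g h : GL43) : P * (g * h) * P⁻¹ = P * g * P⁻¹ * (P * h * P⁻¹) := by group

theorem conj_negGL (P : GL43) : P * negGL * P⁻¹ = negGL := by
  rw [← neg_mul_comm, mul_assoc, mul_inv_cancel, mul_one]

theorem conj_pow' (P g : GL43) (n : ℕ) : P * g ^ n * P⁻¹ = (P * g * P⁻¹) ^ n :=
  (conj_pow).symm

/-- In a suitable basis the non-central involutions of `D₈ ∘ Q₈` are the standard ones. -/
theorem exists_stdInv_frame {R : Subgroup GL43} (hR : IsD8CentralQ8 R) :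
    ∃ P : GL43, IsInvolutionFrame (conjSubgroup P R) stdInv := by
  obtain ⟨r, s, i, j, z, hr, hs, hi, hj, hz1, hzz, hrr, hss, hsr, hii, hjj, hij, hir, his, hjr, hjs,
    hword⟩ := exists_generators hR
  obtain ⟨⟨c1, c2, c3, c4⟩, ⟨h22, h33, h44⟩, ⟨h12, h13, h14⟩, ⟨h23, h24, h34⟩, er, ei, ej⟩ :=
    anticommuting_of_relations hzz hrr hss hsr hii hjj hij hir his hjr hjs
  have hz := eq_neg_of_commutators hz1 hzz c1 c2 c3 c4 hss h22 h33 h44 h12 h13 h14 h23 h24 h34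
  rw [hz] at h12 h13 h14 h23 h24 h34 ei ej
  -- The four involutions `s, r s, r i, r j` become `S₁, …, S₄`; the words in `r, s, i, j` can then
  -- be computed as matrices.
  obtain ⟨P, p1, p2, p3, p4⟩ := exists_conj hss h22 h33 h44 h12 h13 h14 h23 h24 h34
  have q1 := eq_stdInv (by norm_num) p1
  have q2 := eq_stdInv (by norm_num) p2
  have q3 := eq_stdInv (by norm_num) p3
  have q4 := eq_stdInv (by norm_num) p4
  have m0 : stdInv 0 ∈ conjSubgroup P R := q1 ▸ conj_mem_conjSubgroup hs
  have m2 : stdInv 2 ∈ conjSubgroup P R := q2 ▸ conj_mem_conjSubgroup (mul_mem hr hs)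
  have m4 : stdInv 4 ∈ conjSubgroup P R := q3 ▸ conj_mem_conjSubgroup (mul_mem hr hi)
  have m6 : stdInv 6 ∈ conjSubgroup P R := q4 ▸ conj_mem_conjSubgroup (mul_mem hr hj)
  have mn : negGL ∈ conjSubgroup P R :=
    conj_negGL P ▸ conj_mem_conjSubgroup (hz ▸ hrr ▸ mul_mem hr hr)
  refine ⟨P, stdInv_mem mn m0 m2 m4 m6, stdInv_mul_self, stdInv_ne_one, stdInv_ne_neg, ?_⟩
  rintro _ ⟨x, hx, rfl⟩ hgg
  change P * x * P⁻¹ * (P * x * P⁻¹) = 1 at hgg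
  change P * x * P⁻¹ = 1 ∨ P * x * P⁻¹ = negGL ∨ ∃ y < 10, P * x * P⁻¹ = stdInv y
  obtain ⟨k, hk, l, hl, m, hm, n, hn, rfl⟩ := hword x hx
  have e : gcols (P * (r ^ k * s ^ l * (i ^ m * j ^ n)) * P⁻¹) = wordCols k l m n := by
    have e1 : P * r * P⁻¹ = stdInv 2 * stdInv 0 := by
      conv_lhs => rw [er]
      rw [conj_mul, q2, q1]
    have e2 : P * i * P⁻¹ = negGL * (stdInv 2 * stdInv 0 * stdInv 4) := by
      conv_lhs => rw [ei]
      rw [conj_mul, conj_mul, conj_mul, q1, q2, q3, conj_negGL]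
    have e3 : P * j * P⁻¹ = negGL * (stdInv 2 * stdInv 0 * stdInv 6) := by
      conv_lhs => rw [ej]
      rw [conj_mul, conj_mul, conj_mul, q1, q2, q4, conj_negGL]
    rw [conj_mul, conj_mul, conj_mul, conj_pow', conj_pow', conj_pow', conj_pow', e1, e2, e3, q1]
    simp only [gcols_mul, gcols_pow]
    rw [gcols_neg_one, gcols_stdInv 0 (by norm_num), gcols_stdInv 2 (by norm_num),
      gcols_stdInv 4 (by norm_num), gcols_stdInv 6 (by norm_num)]
    rfl
  have hgg' := congrArg gcols hgg
  rw [gcols_mul, gcols_one, e] at hgg'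
  rcases wordCols_involution hk hl hm hn hgg' with h | h | ⟨y, hy, h⟩
  · exact Or.inl (gcols_injective (by rw [e, h, gcols_one]))
  · exact Or.inr (Or.inl (gcols_injective (by rw [e, h, gcols_neg_one])))
  · exact Or.inr (Or.inr ⟨y, hy, eq_stdInv hy (by rw [e, h])⟩)

/-! ### Normalizing the element of order 5. -/

/-- The labels `ys` form a signed frame with product `1` which is permuted cyclically by the signed
permutation with values `f`. -/
def isCyclicFrame (f ys : List ℕ) : Bool :=
  ((List.range 10).all fun x => Nat.blt (signedAct ys x) 10 &&
    (List.range 10).any fun w => Nat.beq (signedAct ys w) x) &&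
  ((List.range 5).all fun k =>
    Nat.beq (signedAct f (signedAct ys (2 * k))) (signedAct ys (2 * ((k + 1) % 5)))) &&
  ((List.range 5).all fun i => (List.range 5).all fun j => Nat.beq i j ||
    mulCols (signedCol (signedAct ys (2 * i))) (signedCol (signedAct ys (2 * j))) ==
      mulCols (2, 6, 18, 54)
        (mulCols (signedCol (signedAct ys (2 * j))) (signedCol (signedAct ys (2 * i))))) &&
  signedCol (signedAct ys 8) ==
    mulCols (mulCols (signedCol (signedAct ys 0)) (signedCol (signedAct ys 2)))
      (mulCols (signedCol (signedAct ys 4)) (signedCol (signedAct ys 6)))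

/-- A signed permutation of order `5` is the identity or permutes a frame cyclically. -/
def orderFiveCheck (f : List ℕ) : Bool :=
  let g := signedAct f
  !((List.range 5).all fun k => Nat.beq (g (g (g (g (g (2 * k)))))) (2 * k)) ||
    f == [0, 2, 4, 6, 8] ||
    isCyclicFrame f [0, g 0, g (g 0), g (g (g 0)), g (g (g (g 0)))] ||
    isCyclicFrame f [1, g 1, g (g 1), g (g (g 1)), g (g (g (g 1)))]

/-- The cyclic frame may start at `S₁` or `-S₁`. Negating all five members changes the sign of the
fifth but not the product of the other four, so one of the two starts meets the product condition.
-/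
theorem orderFiveCheck_all : ((List.range 10).all fun a => (List.range 10).all fun b =>
    Nat.beq (a / 2) (b / 2) || (List.range 10).all fun c => Nat.beq (a / 2) (c / 2) ||
    (Nat.beq (b / 2) (c / 2) || (List.range 10).all fun d => Nat.beq (a / 2) (d / 2) ||
    (Nat.beq (b / 2) (d / 2) || (Nat.beq (c / 2) (d / 2) || (List.range 10).all fun e =>
    Nat.beq (a / 2) (e / 2) || (Nat.beq (b / 2) (e / 2) || (Nat.beq (c / 2) (e / 2) ||
    (Nat.beq (d / 2) (e / 2) || orderFiveCheck [a, b, c, d, e]))))))) = true := by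
  decide +kernel

theorem orderFiveCheck_apply {a b c d e : ℕ} (ha : a < 10) (hb : b < 10) (hc : c < 10) (hd : d < 10)
    (he : e < 10) (hab : a / 2 ≠ b / 2) (hac : a / 2 ≠ c / 2) (had : a / 2 ≠ d / 2)
    (hae : a / 2 ≠ e / 2) (hbc : b / 2 ≠ c / 2) (hbd : b / 2 ≠ d / 2) (hbe : b / 2 ≠ e / 2)
    (hcd : c / 2 ≠ d / 2) (hce : c / 2 ≠ e / 2) (hde : d / 2 ≠ e / 2) :
    orderFiveCheck [a, b, c, d, e] = true := by
  have h := orderFiveCheck_all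
  simp only [List.all_eq_true, List.mem_range, Bool.or_eq_true, Nat.beq_eq] at h
  have := h a ha b hb
  simp only [hab, false_or] at this
  have := this c hc
  simp only [hac, hbc, false_or] at this
  have := this d hd
  simp only [had, hbd, hcd, false_or] at this
  have := this e he
  simpa only [hae, hbe, hce, hde, false_or] using this

/-- `Q` holds for all candidates for the columns of a map with prescribed action on a frame. -/
def frameAll (a b c e : ℕ) (Q : Cols → Bool) : Bool :=
  (List.range 81).all fun v => Nat.beq v 0 || !(Nat.beq (applyCols (signedCol a) v) v) ||
    !(Nat.beq (applyCols (signedCol e) v)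
      (addCode (applyCols (signedCol b) v) (applyCols (signedCol c) v))) ||
    Q (frameCols (signedCol b) (signedCol c) v)

theorem frameAll_gcols {a b c e : ℕ} {Q : Cols → Bool} (hQ : frameAll a b c e Q = true) {d : GL43}
    (ha : a < 10) (hb : b < 10) (hc : c < 10) (he : e < 10) (h0 : d * stdInv 0 = stdInv a * d)
    (h2 : d * stdInv 2 = stdInv b * d) (h4 : d * stdInv 4 = stdInv c * d)
    (h6 : d * stdInv 6 = stdInv e * d) : Q (gcols d) = true := by
  obtain ⟨v, hv, hv0, hv1, hv4, e⟩ := gcols_eq_frameCols gcols_stdInv ha hb hc he h0 h2 h4 h6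
  simp only [frameAll, List.all_eq_true, List.mem_range] at hQ
  simpa only [hv0, hv1, hv4, ← e, Nat.beq_eq_true_eq, Nat.beq_refl, Bool.not_true, Bool.or_false,
    Bool.or_eq_true, Nat.beq_eq, Bool.false_eq_true, false_or, or_false] using hQ v hv

/-- Schur's lemma for the irreducible module: only `± 1` commute with `S₁, …, S₄`. -/
theorem scalarCheck_of_commute : frameAll 0 2 4 6 scalarCheck = true := by
  decide +kernel

/-- A map conjugating `S₁ → S₂ → S₃ → S₄ → S₅` is unique up to sign; the second tuple is `-c₀`. -/
theorem c0Cols_of_cyclic :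
    frameAll 2 4 6 8 (fun m => m == c0Cols || m == (70, 20, 44, 57)) = true := by
  decide +kernel

theorem negGL_pow_five : negGL ^ 5 = negGL := by
  rw [pow_succ, pow_succ, pow_succ, pow_succ, pow_one, negGL_mul_self, one_mul, negGL_mul_self, one_mul]

theorem eq_one_or_neg_of_scalarCheck {g : GL43} (h : scalarCheck (gcols g) = true) :
    g = 1 ∨ g = negGL := by
  rw [scalarCheck, Bool.or_eq_true, beq_iff_eq, beq_iff_eq] at h
  exact h.imp (fun h => gcols_injective (by rw [h, gcols_one]))
    (fun h => gcols_injective (by rw [h, gcols_neg_one]))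

/-- An element of order `5` of the normalizer permutes a signed frame cyclically. -/
theorem exists_cyclic_labels {c : GL43} {f : ℕ → ℕ} (hf : ∀ x < 10, f x < 10)
    (hcf : ∀ x < 10, c * stdInv x = stdInv (f x) * c) (hc5 : c ^ 5 = 1) (hc1 : c ≠ 1) :
    ∃ ys, isCyclicFrame [f 0, f 2, f 4, f 6, f 8] ys = true := by
  have hact := signed_perm_act gcols_stdInv hf hcf
  have hdist := signed_perm_div gcols_stdInv hf hcf
  have key : orderFiveCheck [f 0, f 2, f 4, f 6, f 8] = true := by
    refine orderFiveCheck_apply (hf _ ?_) (hf _ ?_) (hf _ ?_) (hf _ ?_) (hf _ ?_) (hdist _ ?_ _ ?_ ?_)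
      (hdist _ ?_ _ ?_ ?_) (hdist _ ?_ _ ?_ ?_) (hdist _ ?_ _ ?_ ?_) (hdist _ ?_ _ ?_ ?_)
      (hdist _ ?_ _ ?_ ?_) (hdist _ ?_ _ ?_ ?_) (hdist _ ?_ _ ?_ ?_) (hdist _ ?_ _ ?_ ?_)
      (hdist _ ?_ _ ?_ ?_) <;> norm_num
  have hper : ∀ k < 5, signedAct [f 0, f 2, f 4, f 6, f 8] (signedAct [f 0, f 2, f 4, f 6, f 8]
      (signedAct [f 0, f 2, f 4, f 6, f 8] (signedAct [f 0, f 2, f 4, f 6, f 8]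
      (signedAct [f 0, f 2, f 4, f 6, f 8] (2 * k))))) = 2 * k := by
    intro k hk
    have h0 : 2 * k < 10 := by omega
    rw [hact _ h0, hact _ (hf _ h0), hact _ (hf _ (hf _ h0)), hact _ (hf _ (hf _ (hf _ h0))),
      hact _ (hf _ (hf _ (hf _ (hf _ h0))))]
    exact signed_perm_periodic gcols_stdInv hf hcf hc5 _ h0
  simp only [orderFiveCheck, Bool.or_eq_true, Bool.not_eq_true', ← Bool.not_eq_true,
    List.all_eq_true, List.mem_range, Nat.beq_eq, beq_iff_eq] at key
  rcases key with ((h | h) | h) | h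
  · exact absurd hper h
  · exfalso
    simp only [List.cons.injEq, and_true] at h
    obtain ⟨e0, e2, e4, e6, -⟩ := h
    have h0 := hcf 0 (by norm_num)
    have h2 := hcf 2 (by norm_num)
    have h4 := hcf 4 (by norm_num)
    have h6 := hcf 6 (by norm_num)
    rw [e0] at h0
    rw [e2] at h2
    rw [e4] at h4
    rw [e6] at h6
    rcases eq_one_or_neg_of_scalarCheck (frameAll_gcols scalarCheck_of_commute (by norm_num)
      (by norm_num) (by norm_num) (by norm_num) h0 h2 h4 h6) with h | h
    · exact hc1 h
    -- `(-1) ^ 5 = -1`, so the scalar `-1` is excluded by `c ^ 5 = 1`.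
    · rw [h, negGL_pow_five] at hc5
      rw [h] at hc1
      exact hc1 hc5
  · exact ⟨_, h⟩
  · exact ⟨_, h⟩

theorem IsInvolutionFrame.reindex {R : Subgroup GL43} {s t : ℕ → GL43} (h : IsInvolutionFrame R s)
    {p : ℕ → ℕ} (hp : ∀ x < 10, p x < 10) (hsurj : ∀ y < 10, ∃ x < 10, p x = y)
    (ht : ∀ x < 10, s (p x) = t x) : IsInvolutionFrame R t where
  mem x hx := ht x hx ▸ h.mem _ (hp x hx)
  sq x hx := ht x hx ▸ h.sq _ (hp x hx)
  ne_one x hx := ht x hx ▸ h.ne_one _ (hp x hx)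
  ne_neg x hx := ht x hx ▸ h.ne_neg _ (hp x hx)
  exhaust g hg hgg := by
    rcases h.exhaust g hg hgg with k | k | ⟨y, hy, k⟩
    · exact Or.inl k
    · exact Or.inr (Or.inl k)
    · obtain ⟨x, hx, rfl⟩ := hsurj y hy
      exact Or.inr (Or.inr ⟨x, hx, k.trans (ht x hx)⟩)

theorem signedAct_xor (ys : List ℕ) : ∀ k, signedAct ys (2 * k + 1) = Nat.xor (signedAct ys (2 * k)) 1 := by
  intro k
  have h1 : (2 * k + 1) / 2 = k := by omega
  have h2 : (2 * k + 1) % 2 = 1 := by omega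
  have h3 : 2 * k / 2 = k := by omega
  have h4 : 2 * k % 2 = 0 := by omega
  rw [signedAct, signedAct, h1, h2, h3, h4]
  exact congrArg (Nat.xor · 1) (Nat.xor_zero _).symm

/-- After a change of basis an element of order `5` of the normalizer is the standard one. -/
theorem exists_conj_eq_c0Cols {R : Subgroup GL43} (hR : IsInvolutionFrame R stdInv) {c : GL43}
    (hc : c ∈ Subgroup.normalizer (R : Set GL43)) (hc5 : c ^ 5 = 1) (hc1 : c ≠ 1) :
    ∃ P : GL43, IsInvolutionFrame (conjSubgroup P R) stdInv ∧ gcols (P * c * P⁻¹) = c0Cols := by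
  obtain ⟨f, hf, hcf⟩ := hR.exists_conj_eq hc
  obtain ⟨ys, hys⟩ := exists_cyclic_labels hf hcf hc5 hc1
  have hact := signed_perm_act gcols_stdInv hf hcf
  simp only [isCyclicFrame, Bool.and_eq_true, List.all_eq_true, List.any_eq_true, List.mem_range,
    Nat.blt_eq, Nat.beq_eq, Bool.or_eq_true, beq_iff_eq] at hys
  obtain ⟨⟨⟨hperm, hcyc⟩, hanti⟩, hprod⟩ := hys
  obtain ⟨p, hpdef⟩ : ∃ p, p = signedAct ys := ⟨_, rfl⟩
  rw [← hpdef] at hperm hcyc hanti hprod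
  have hp : ∀ x < 10, p x < 10 := fun x hx => (hperm x hx).1
  have hanti' : ∀ i < 5, ∀ j < 5, i ≠ j → stdInv (p (2 * i)) * stdInv (p (2 * j)) =
      negGL * (stdInv (p (2 * j)) * stdInv (p (2 * i))) := by
    intro i hi j hj hij
    apply gcols_injective
    simp only [gcols_mul]
    rw [gcols_neg_one, gcols_stdInv _ (hp _ (by omega)), gcols_stdInv _ (hp _ (by omega))]
    exact (hanti i hi j hj).resolve_left hij
  have hsq : ∀ i < 5, stdInv (p (2 * i)) * stdInv (p (2 * i)) = 1 := fun i hi =>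
    stdInv_mul_self _ (hp _ (by omega))
  -- `P` moves the cyclic frame to the standard one. The fifth involution follows because in both
  -- frames it is the product of the other four.
  obtain ⟨P, p0, p1, p2, p3⟩ := exists_conj (hsq 0 (by norm_num)) (hsq 1 (by norm_num))
    (hsq 2 (by norm_num)) (hsq 3 (by norm_num)) (hanti' 0 (by norm_num) 1 (by norm_num) (by norm_num))
    (hanti' 0 (by norm_num) 2 (by norm_num) (by norm_num))
    (hanti' 0 (by norm_num) 3 (by norm_num) (by norm_num))
    (hanti' 1 (by norm_num) 2 (by norm_num) (by norm_num))
    (hanti' 1 (by norm_num) 3 (by norm_num) (by norm_num))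
    (hanti' 2 (by norm_num) 3 (by norm_num) (by norm_num))
  have q0 : P * stdInv (p 0) * P⁻¹ = stdInv 0 := eq_stdInv (by norm_num) p0
  have q1 : P * stdInv (p 2) * P⁻¹ = stdInv 2 := eq_stdInv (by norm_num) p1
  have q2 : P * stdInv (p 4) * P⁻¹ = stdInv 4 := eq_stdInv (by norm_num) p2
  have q3 : P * stdInv (p 6) * P⁻¹ = stdInv 6 := eq_stdInv (by norm_num) p3
  have hprod' : stdInv (p 8) = stdInv (p 0) * stdInv (p 2) * (stdInv (p 4) * stdInv (p 6)) := by
    apply gcols_injective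
    simp only [gcols_mul]
    rw [gcols_stdInv _ (hp 0 (by norm_num)), gcols_stdInv _ (hp 2 (by norm_num)),
      gcols_stdInv _ (hp 4 (by norm_num)), gcols_stdInv _ (hp 6 (by norm_num)),
      gcols_stdInv _ (hp 8 (by norm_num)), hprod]
  have q4 : P * stdInv (p 8) * P⁻¹ = stdInv 8 := by
    rw [hprod', conj_mul, conj_mul, conj_mul, q0, q1, q2, q3, stdInv_eight]
  have hq : ∀ k < 5, P * stdInv (p (2 * k)) * P⁻¹ = stdInv (2 * k) := by
    intro k hk
    interval_cases k
    exacts [q0, q1, q2, q3, q4]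
  have hq' : ∀ x < 10, P * stdInv (p x) * P⁻¹ = stdInv x := by
    intro x hx
    obtain ⟨k, rfl | rfl⟩ : ∃ k, x = 2 * k ∨ x = 2 * k + 1 := ⟨x / 2, by omega⟩
    · exact hq k (by omega)
    · have h1 : stdInv (2 * k + 1) = negGL * stdInv (2 * k) := by
        rw [← stdInv_xor _ (by omega)]
        have : ∀ k < 5, 2 * k + 1 = Nat.xor (2 * k) 1 := by decide +kernel
        exact congrArg stdInv (this k (by omega))
      rw [hpdef, signedAct_xor, ← hpdef, stdInv_xor _ (hp _ (by omega)), conj_mul, conj_negGL,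
        hq k (by omega), h1]
  refine ⟨P, (hR.conj P).reindex hp (fun y hy => (hperm y hy).2) hq', ?_⟩
  have hcc : ∀ k < 5, P * c * P⁻¹ * stdInv (2 * k) = stdInv (2 * ((k + 1) % 5)) * (P * c * P⁻¹) := by
    intro k hk
    rw [← hq k hk, ← hq _ (Nat.mod_lt (k + 1) (by norm_num)), ← conj_mul, ← conj_mul,
      hcf _ (hp _ (by omega)), ← hact _ (hp _ (by omega)), hcyc k hk]
  have key := frameAll_gcols c0Cols_of_cyclic (by norm_num) (by norm_num) (by norm_num) (by norm_num)
    (hcc 0 (by norm_num)) (hcc 1 (by norm_num)) (hcc 2 (by norm_num)) (hcc 3 (by norm_num))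
  simp only [Bool.or_eq_true, beq_iff_eq] at key
  rcases key with e | e
  · exact e
  -- The alternative `-c₀` does not have fifth power 1.
  · exfalso
    have : gcols ((P * c * P⁻¹) ^ 5) = (1, 3, 9, 27) := by
      rw [← conj_pow', hc5, mul_one, mul_inv_cancel, gcols_one]
    rw [gcols_pow, e] at this
    revert this
    decide +kernel

/-! ### Change of basis for designs. -/

/-- The blocks `B` for which `P⁻¹ B` is a block of `𝓑`. -/
def transport (P : GL43) (𝓑 : Set (Set V43)) : Set (Set V43) := {B | P ⁻¹' B ∈ 𝓑}

theorem image_preimage_gl (P : GL43) (B : Set V43) : P '' (P ⁻¹' B) = B :=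
  Set.image_preimage_eq B P.surjective

theorem preimage_image_gl (P : GL43) (B : Set V43) : P ⁻¹' (P '' B) = B :=
  Set.preimage_image_eq B P.injective

theorem preimage_conj_image (P g : GL43) (B : Set V43) :
    P ⁻¹' ((P * g * P⁻¹ : GL43) '' B) = g '' (P ⁻¹' B) := by
  have e : ((P * g * P⁻¹ : GL43) : V43 → V43) '' B = P '' (g '' (P ⁻¹' B)) := by
    conv_lhs => rw [← image_preimage_gl P B]
    rw [Set.image_image, Set.image_image]
    refine Set.image_congr fun x _ => ?_
    exact congrArg (fun y => P (g y)) (P.symm_apply_apply x)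
  rw [e, preimage_image_gl]

theorem preimage_trans_image (P : GL43) (w : V43) (B : Set V43) :
    P ⁻¹' ((fun x => x + w) '' B) = (fun x => x + P.symm w) '' (P ⁻¹' B) := by
  ext x
  rw [mem_image_add, Set.mem_preimage, Set.mem_preimage, mem_image_add, map_sub, P.apply_symm_apply]

theorem preimage_gl_injective (P : GL43) : Function.Injective fun B : Set V43 => P ⁻¹' B :=
  Set.preimage_injective.2 P.surjective

theorem IsLinearFlagDesign.transport {𝓑 : Set (Set V43)} {G₀ : Subgroup GL43}
    (h : IsLinearFlagDesign 𝓑 G₀) (P : GL43) :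
    IsLinearFlagDesign (transport P 𝓑) (conjSubgroup P G₀) where
  trans_mem B hB w := by
    change P ⁻¹' _ ∈ 𝓑
    rw [preimage_trans_image]
    exact h.trans_mem _ hB _
  map_mem := by
    rintro _ ⟨g, hg, rfl⟩ B hB
    change P ⁻¹' ((P * g * P⁻¹ : GL43) '' B) ∈ 𝓑
    rw [preimage_conj_image]
    exact h.map_mem g hg _ hB
  flag B hB C hC h0B h0C := by
    obtain ⟨g, hg, e⟩ := h.flag _ hB _ hC (by rwa [Set.mem_preimage, map_zero])
      (by rwa [Set.mem_preimage, map_zero])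
    refine ⟨_, conj_mem_conjSubgroup hg, preimage_gl_injective P ?_⟩
    change P ⁻¹' _ = P ⁻¹' C
    rw [preimage_conj_image, e]
  card_block B hB := by
    rw [← h.card_block _ hB, Set.ncard_preimage_of_injective_subset_range P.injective]
    rw [P.surjective.range_eq]
    exact Set.subset_univ B
  card_pair x y hxy := by
    rw [← h.card_pair (P.symm x) (P.symm y) (P.symm.injective.ne hxy),
      ← Set.ncard_image_of_injective _ (preimage_gl_injective P)]
    refine congrArg Set.ncard (Set.ext fun B => ?_)
    constructor
    · rintro ⟨C, ⟨hC, hx, hy⟩, rfl⟩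
      refine ⟨hC, ?_, ?_⟩
      · rwa [Set.mem_preimage, P.apply_symm_apply]
      · rwa [Set.mem_preimage, P.apply_symm_apply]
    · rintro ⟨hB, hx, hy⟩
      refine ⟨P '' B, ⟨?_, ?_, ?_⟩, preimage_image_gl P B⟩
      · change P ⁻¹' _ ∈ 𝓑
        rwa [preimage_image_gl]
      · exact mem_image_gl.2 hx
      · exact mem_image_gl.2 hy

theorem designIso_of_transport {𝓑 𝓒 : Set (Set V43)} {P : GL43}
    (h : DesignIso (transport P 𝓑) 𝓒) : DesignIso 𝓑 𝓒 := by
  obtain ⟨e, rfl⟩ := h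
  refine ⟨P.toEquiv.trans e, Set.ext fun C => ⟨?_, ?_⟩⟩
  · rintro ⟨B, hB, rfl⟩
    refine ⟨P '' B, ?_, Set.image_image _ _ _⟩
    change P ⁻¹' _ ∈ 𝓑
    rwa [preimage_image_gl]
  · rintro ⟨B, hB, rfl⟩
    refine ⟨P ⁻¹' B, hB, ?_⟩
    change (fun x => e (P x)) '' (P ⁻¹' B) = e '' B
    conv_rhs => rw [← image_preimage_gl P B, Set.image_image]

theorem conjSubgroup_le_normalizer {R G₀ : Subgroup GL43}
    (h : G₀ ≤ Subgroup.normalizer (R : Set GL43)) (P : GL43) :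
    conjSubgroup P G₀ ≤ Subgroup.normalizer (conjSubgroup P R : Set GL43) := by
  rintro _ ⟨g, hg, rfl⟩
  change P * g * P⁻¹ ∈ _
  refine Subgroup.mem_normalizer_iff.2 fun x => ?_
  rw [mem_conjSubgroup, mem_conjSubgroup, Subgroup.mem_normalizer_iff.1 (h hg) (P⁻¹ * x * P)]
  have e : P⁻¹ * (P * g * P⁻¹ * x * (P * g * P⁻¹)⁻¹) * P = g * (P⁻¹ * x * P) * g⁻¹ := by group
  rw [e]

/-! ### Exclusion of the spread and conclusion. -/

/-- The fixed space of a linear map. -/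
def fixedSpan (g : GL43) : Submodule (ZMod 3) V43 :=
  LinearMap.eqLocus (g : V43 →ₗ[ZMod 3] V43) LinearMap.id

theorem mem_fixedSpan {g : GL43} {x : V43} : x ∈ fixedSpan g ↔ g x = x := Iff.rfl

theorem map_fixedSpan {g s t : GL43} (h : g * s = t * g) :
    (fixedSpan s).map (g : V43 →ₗ[ZMod 3] V43) = fixedSpan t := by
  have h' : ∀ x, g (s x) = t (g x) := fun x => congrArg (fun k : GL43 => k x) h
  ext x
  constructor
  · rintro ⟨y, hy, rfl⟩
    change t (g y) = g y
    rw [← h', mem_fixedSpan.1 hy]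
  · intro hx
    refine ⟨g.symm x, g.injective ?_, g.apply_symm_apply x⟩
    change g (s (g.symm x)) = g (g.symm x)
    rw [h', g.apply_symm_apply, mem_fixedSpan.1 hx]

/-- The two excluded orbits are represented by the fixed spaces of `S₁` and `-S₁`. -/
theorem lineMask_fixed : ∀ n < 81, (inMask (lineMask 0 0) n = Nat.beq (applyCols (signedCol 0) n) n) ∧
    (inMask (lineMask 24 0) n = Nat.beq (applyCols (signedCol 1) n) n) := by
  decide +kernel

theorem lineSpan_eq_fixedSpan : lineSpan 0 0 = fixedSpan (stdInv 0) ∧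
    lineSpan 24 0 = fixedSpan (stdInv 1) := by
  constructor
  · ext x
    rw [← inMask_lineMask (by norm_num) (by norm_num), (lineMask_fixed _ (enc_lt x)).1, Nat.beq_eq,
      ← gcols_stdInv 0 (by norm_num), ← enc_gmap, enc_injective.eq_iff, mem_fixedSpan]
  · ext x
    rw [← inMask_lineMask (by norm_num) (by norm_num), (lineMask_fixed _ (enc_lt x)).2, Nat.beq_eq,
      ← gcols_stdInv 1 (by norm_num), ← enc_gmap, enc_injective.eq_iff, mem_fixedSpan]

/-- The fixed spaces of the standard involutions do not occur in large orbits. -/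
theorem fixedSpan_notMem {R G₀ : Subgroup GL43} (hR : IsInvolutionFrame R stdInv)
    (hG : G₀ ≤ Subgroup.normalizer (R : Set GL43)) {F : Set (Submodule (ZMod 3) V43)}
    (htrans : ∀ W ∈ F, ∀ W' ∈ F, ∃ g ∈ G₀, W.map (g : V43 →ₗ[ZMod 3] V43) = W')
    (h30 : F.ncard = 30) {x : ℕ} (hx : x < 10) : fixedSpan (stdInv x) ∉ F := by
  intro hF
  -- `G₀` permutes the ten fixed spaces and is transitive on `F`, so one of them in `F` would leave
  -- room for at most ten lines.
  have hsub : F ⊆ ((Finset.range 10).image fun x => fixedSpan (stdInv x) : Finset _) := by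
    intro W hW
    obtain ⟨g, hg, rfl⟩ := htrans _ hF W hW
    obtain ⟨f, hf, hgf⟩ := hR.exists_conj_eq (hG hg)
    rw [map_fixedSpan (hgf x hx), Finset.mem_coe, Finset.mem_image]
    exact ⟨f x, Finset.mem_range.2 (hf x hx), rfl⟩
  have h1 := Set.ncard_le_ncard hsub (Finset.finite_toSet _)
  rw [Set.ncard_coe_finset] at h1
  have h2 := h1.trans Finset.card_image_le
  rw [h30, Finset.card_range] at h2
  omega

theorem designIso_exBlocks {𝓑 : Set (Set V43)} {F : Set (Submodule (ZMod 3) V43)} {e : GL43}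
    (h𝓑 : ∀ B, B ∈ 𝓑 ↔ ∃ W ∈ F, ∃ w : V43, B = (fun x => x + w) '' (W : Set V43))
    (he : ∀ W : Submodule (ZMod 3) V43, W ∈ F ↔
      ∃ g ∈ exGroup, W.map (e : V43 →ₗ[ZMod 3] V43) = baseSpan.map (g : V43 →ₗ[ZMod 3] V43)) :
    DesignIso 𝓑 exBlocks := by
  have key : ∀ (W : Submodule (ZMod 3) V43) (g : GL43) (w : V43),
      W.map (e : V43 →ₗ[ZMod 3] V43) = baseSpan.map (g : V43 →ₗ[ZMod 3] V43) →
      e '' ((fun x => x + w) '' (W : Set V43)) = (fun x => g x + e w) '' exBase := by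
    intro W g w h
    have h' := congrArg (fun U : Submodule (ZMod 3) V43 => (U : Set V43)) h
    simp only [IsLinearFlagDesign.coe_map_eq] at h'
    have h1 : (fun x => g x + e w) '' exBase = (fun x => x + e w) '' (g '' (baseSpan : Set V43)) := by
      rw [Set.image_image]
      rfl
    rw [h1, ← h', Set.image_image, Set.image_image]
    exact Set.image_congr fun x _ => map_add e x w
  refine ⟨e.toEquiv, Set.ext fun C => ⟨?_, ?_⟩⟩
  · rintro ⟨B, hB, rfl⟩
    obtain ⟨W, hW, w, rfl⟩ := (h𝓑 B).1 hB
    obtain ⟨g, hg, h⟩ := (he W).1 hW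
    exact ⟨_, mul_mem (addRight_mem_affineGroup exGroup (e w)) (linToPerm_mem_affineGroup hg),
      key W g w h⟩
  · rintro ⟨σ, hσ, rfl⟩
    obtain ⟨g, hg, w, hw⟩ := exists_of_mem_affineGroup hσ
    have hW : (baseSpan.map ((e⁻¹ * g : GL43) : V43 →ₗ[ZMod 3] V43)).map (e : V43 →ₗ[ZMod 3] V43) =
        baseSpan.map (g : V43 →ₗ[ZMod 3] V43) := by
      rw [← submodule_map_mul, mul_inv_cancel_left]
    refine ⟨_, (h𝓑 _).2 ⟨_, (he _).2 ⟨g, hg, hW⟩, e.symm w, rfl⟩, (key _ _ _ hW).trans ?_⟩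
    refine Set.image_congr fun x _ => ?_
    rw [hw, e.apply_symm_apply]

theorem finite_subgroup (G₀ : Subgroup GL43) : Finite G₀ :=
  have : Finite GL43 := Finite.of_injective (fun g : GL43 => (g : V43 → V43)) DFunLike.coe_injective
  inferInstance

/-- The core of the argument, once `R` and the element of order 5 are standard: stabilizer dimension
1 contradicts the bound 30, and dimension 2 leads to one of the two good line sets. -/
theorem designIso_of_c0Cols {𝓑 : Set (Set V43)} {R G₀ : Subgroup GL43}
    (h : IsLinearFlagDesign 𝓑 G₀) (hR : IsInvolutionFrame R stdInv)
    (hG : G₀ ≤ Subgroup.normalizer (R : Set GL43)) {c : GL43} (hc : c ∈ G₀)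
    (hc0 : gcols c = c0Cols) : DesignIso 𝓑 exBlocks := by
  obtain ⟨d, hd, hd3, hd1⟩ : ∃ d ∈ G₀, d ^ 3 = 1 ∧ d ≠ 1 := by
    have := finite_subgroup G₀
    have : Fact (Nat.Prime 3) := ⟨Nat.prime_three⟩
    obtain ⟨d, hd⟩ := exists_prime_orderOf_dvd_card' (G := G₀) 3
      ((by norm_num : 3 ∣ 30).trans h.thirty_dvd)
    refine ⟨d, d.2, ?_, fun e => ?_⟩
    · exact congrArg Subtype.val (orderOf_dvd_iff_pow_eq_one.1 hd.dvd)
    · have : d = 1 := Subtype.ext e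
      rw [this, orderOf_one] at hd
      omega
  obtain ⟨f, hf, hdf⟩ := hR.exists_conj_eq (hG hd)
  -- The scalar `-1` has cube `-1`, so an element of order 3 is not scalar.
  have hscalar : scalarCheck (gcols d) ≠ true := by
    intro hs
    rcases eq_one_or_neg_of_scalarCheck hs with e | e
    · exact hd1 e
    · apply hd1
      rw [e, pow_three, negGL_mul_self, mul_one] at hd3
      rw [e]
      exact hd3
  have hstab := orderThreeAll_gcols stabCheck_all gcols_stdInv hf hdf hd3
  have hpoint := orderThreeAll_gcols pointCheck_all gcols_stdInv hf hdf hd3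
  rw [Bool.or_eq_true] at hstab hpoint
  obtain ⟨B₀, hB₀, h0⟩ := h.exists_through_zero
  have hle := h.finrank_transStab_le hB₀ h0
  have hne := h.finrank_transStab_ne_zero hB₀ h0
  obtain h1 | h2 : Module.finrank (ZMod 3) (transStab B₀) = 1 ∨
      Module.finrank (ZMod 3) (transStab B₀) = 2 := by omega
  · obtain ⟨U, hU, hU0, hUneg, hUG, hU20⟩ := h.exists_small_invariant hB₀ h0 h1
    have := thirty_le_ncard hU hU0 hUneg hc0 (hUG c hc) (hUG d hd) (hpoint.resolve_left hscalar)
    omega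
  · obtain ⟨F, hdim, hcov, hmap, htrans, h30, h𝓑⟩ := h.exists_lines hB₀ h0 h2
    obtain ⟨s, hs, rfl⟩ := mem_goodSols hc0 (hmap c hc) hdim hcov
      (lineSpan_eq_fixedSpan.1 ▸ fixedSpan_notMem hR hG htrans h30 (by norm_num))
      (lineSpan_eq_fixedSpan.2 ▸ fixedSpan_notMem hR hG htrans h30 (by norm_num)) (hmap d hd)
      (hstab.resolve_left hscalar)
    obtain ⟨e, he⟩ := exists_map_eq_of_mem_goodSols hs
    exact designIso_exBlocks h𝓑 he

theorem designIso_of_frame {𝓑 : Set (Set V43)} {R G₀ : Subgroup GL43}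
    (h : IsLinearFlagDesign 𝓑 G₀) (hR : IsInvolutionFrame R stdInv)
    (hG : G₀ ≤ Subgroup.normalizer (R : Set GL43)) : DesignIso 𝓑 exBlocks := by
  have := finite_subgroup G₀
  have : Fact (Nat.Prime 5) := ⟨Nat.prime_five⟩
  obtain ⟨c, hc⟩ := exists_prime_orderOf_dvd_card' (G := G₀) 5
    ((by norm_num : 5 ∣ 30).trans h.thirty_dvd)
  obtain ⟨P, hP, hcP⟩ := exists_conj_eq_c0Cols hR (hG c.2)
    (congrArg Subtype.val (orderOf_dvd_iff_pow_eq_one.1 hc.dvd)) (by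
      intro e
      have : c = 1 := Subtype.ext e
      rw [this, orderOf_one] at hc
      omega)
  exact designIso_of_transport (designIso_of_c0Cols (h.transport P) hP
    (conjSubgroup_le_normalizer hG P) (conj_mem_conjSubgroup c.2) hcP)

end Ternary

theorem mainTheorem7
    (𝓑 : Set (Set V43)) (h𝓑 : IsTwoDesign 𝓑 (3 ^ 4) (3 ^ 2) 3)
    (R : Subgroup GL43) (hR : IsD8CentralQ8 R)
    (G₀ : Subgroup GL43) (hG₀ : G₀ ≤ Subgroup.normalizer (R : Set GL43))
    (hflag : IsFlagTransitive (affineGroup G₀) 𝓑) :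
    DesignIso 𝓑 exBlocks := by
  obtain ⟨P, hP⟩ := Ternary.exists_stdInv_frame hR
  exact Ternary.designIso_of_transport (Ternary.designIso_of_frame
    ((Ternary.isLinearFlagDesign h𝓑 hflag).transport P) hP
    (Ternary.conjSubgroup_le_normalizer hG₀ P))
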